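/- **Theorem (approximation of a conjugate net).** Let $m\ge 1$, $N\ge 0$. Let there be given $m$ smooth curves $X_i:\mathbb R\to\mathbb R^N$ ($1\le i\le m$) with a common point $X_1(0)=\dots=X_m(0)$ and, for all $i\neq j$, smooth functions $C_{ij}:\mathbb R^2\to\mathbb R$, regarded as functions of $(\xi_i,\xi_j)$ on the $(i,j)$-coordinate plane of $\mathbb R^m$. *Continuous nets.* Put $B(r)=[0,r]^m$. A conjugate net on $B(r)$ with rotation coefficients $c=(c_{ij})_{i\ne j}$, $c_{ij}:B(r)\to\mathbb R$, is a smooth map $x:B(r)\to\mathbb R^N$ with $$\partial_i\partial_j x=c_{ji}\,\partial_i x+c_{ij}\,\partial_j x\qquad(i\ne j).$$ The coefficients are called compatible if they are smooth and $\partial_i c_{kj}=c_{ik}c_{kj}+c_{ki}c_{ij}-c_{kj}c_{ij}$ for pairwise distinct $i,j,k$. The pair $(x,c)$ has the given data on $B(r)$ if $x=X_i$ on the $i$-th coordinate axis and $c_{ij}=C_{ij}$ on the $(i,j)$-coordinate plane (within $B(r)$). *Discrete nets.* For $\varepsilon>0$ let $B^\varepsilon(r)=(\varepsilon\mathbb Z)^m\cap[0,r]^m$,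 $\tau_iu(\xi)=u(\xi+\varepsilon e_i)$ and $\delta_i=(\tau_i-1)/\varepsilon$. A discrete conjugate net on $B^\varepsilon(r)$ with rotation coefficients $c_{ij}$ is a map $x:B^\varepsilon(r)\to\mathbb R^N$ with $$\delta_i\delta_j x=c_{ji}\,\delta_i x+c_{ij}\,\delta_j x\qquad(i\ne j)$$ at every $\xi$ with $\xi+\varepsilon e_i+\varepsilon e_j\in B^\varepsilon(r)$. Here $c_{ij}$ matters only at such points $\xi$, that is, on the elementary quadrilaterals of $B^\varepsilon(r)$. The coefficients are called compatible if $\delta_i c_{kj}=(\tau_jc_{ik})c_{kj}+(\tau_jc_{ki})c_{ij}-(\tau_ic_{kj})c_{ij}$ for pairwise distinct $i,j,k$ at every $\xi$ with $\xi+\varepsilon(e_i+e_j+e_k)\in B^\varepsilon(r)$. The pair $(x,c)$ has the given discrete data if $x$ and $c_{ij}$ coincide with $X_i$ and $C_{ij}$ on the lattice points of the $i$-th axis and of the $(i,j)$-coordinate plane, respectively. Call the data *regular* if any three of the vectors $X_1'(0),\dots,X_m'(0)$ (with distinct indices) are linearly independent; this is no condition if $m\le 2$. Then there is $r_0>0$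 such that for every $0<r\le r_0$: 1. There is a conjugate net $x$ on $B(r)$ with compatible rotation coefficients $c$ that has the given data, and $(x,c)$ is the only such pair. If the data are regular, $(x,c)$ is moreover the only pair that consists of a conjugate net on $B(r)$ and rotation coefficients of it, compatible or not, and has the given data. 2. There are $\varepsilon_1>0$ and, for each $0<\varepsilon<\varepsilon_1$, a discrete conjugate net $x^\varepsilon$ on $B^\varepsilon(r)$ with compatible rotation coefficients $c^\varepsilon$ that has the given discrete data, and $(x^\varepsilon,c^\varepsilon)$ is the only such pair. If the data are regular, it is again the only one even when compatibility is not required. The family $x^\varepsilon$ is $O(\varepsilon)$-convergent to $x$ in $C^\infty$: for every integer $\ell\ge 0$ there is a constant $K_\ell$ such that for all $0<\varepsilon<\varepsilon_1$ with $\varepsilon\ell<r$, $$\bigl|\delta^\alpha(x^\varepsilon-x)(\xi)\bigr|\le K_\ell\,\varepsilon\qquad\text{for all multi-indices }|\alpha|\le\ell\text{ and all }\xi\in B^\varepsilon(r-\varepsilon|\alpha|).$$ -/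

import Mathlib

open scoped ContDiff

noncomputable section

namespace ConjugateNet

/-! ### Continuous nets -/

/-- The cube `B₀(r) = [0, r]^m`. -/
def box (m : ℕ) (r : ℝ) : Set (Fin m → ℝ) :=
  Set.Icc 0 (fun _ => r)

/-- The partial derivative `∂ᵢ f` of a function on the cube `B₀(r)` (one-sided on the faces). -/
def partialDeriv {m : ℕ} {E : Type*} [NormedAddCommGroup E] [NormedSpace ℝ E]
    (r : ℝ) (i : Fin m) (f : (Fin m → ℝ) → E) (ξ : Fin m → ℝ) : E :=
  fderivWithin ℝ f (box m r) ξ (Pi.single i 1)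

/-- `x : B₀(r) → ℝᴺ` is a (smooth) conjugate net with rotation coefficients `c i j`, `i ≠ j`:
`∂ᵢ∂ⱼ x = c_{ji} ∂ᵢ x + c_{ij} ∂ⱼ x`. The diagonal entries `c i i` are never used. -/
structure IsConjugateNet {m N : ℕ} (r : ℝ) (x : (Fin m → ℝ) → EuclideanSpace ℝ (Fin N))
    (c : Fin m → Fin m → (Fin m → ℝ) → ℝ) : Prop where
  smooth : ContDiffOn ℝ ∞ x (box m r)
  conj : ∀ i j, i ≠ j → ∀ ξ ∈ box m r,
    partialDeriv r i (partialDeriv r j x) ξ =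
      c j i ξ • partialDeriv r i x ξ + c i j ξ • partialDeriv r j x ξ

/-- The rotation coefficients are smooth and satisfy the compatibility equations
`∂ᵢ c_{kj} = c_{ik} c_{kj} + c_{ki} c_{ij} - c_{kj} c_{ij}` for pairwise distinct `i, j, k`. -/
structure IsCompatible {m : ℕ} (r : ℝ) (c : Fin m → Fin m → (Fin m → ℝ) → ℝ) : Prop where
  smooth : ∀ i j, i ≠ j → ContDiffOn ℝ ∞ (c i j) (box m r)
  compat : ∀ i j k, i ≠ j → j ≠ k → k ≠ i → ∀ ξ ∈ box m r,
    partialDeriv r i (c k j) ξ =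
      c i k ξ * c k j ξ + c k i ξ * c i j ξ - c k j ξ * c i j ξ

/-- `x` restricts to the curve `X i` on the `i`-th axis, and `c i j` restricts to `C i j` on the
`(i, j)`-coordinate plane; a point `ξ` of that plane is written `(ξ i, ξ j)` in the argument
of `C i j`. -/
structure HasData {m N : ℕ} (r : ℝ) (X : Fin m → ℝ → EuclideanSpace ℝ (Fin N))
    (C : Fin m → Fin m → ℝ × ℝ → ℝ) (x : (Fin m → ℝ) → EuclideanSpace ℝ (Fin N))
    (c : Fin m → Fin m → (Fin m → ℝ) → ℝ) : Prop where
  curves : ∀ i, ∀ t ∈ Set.Icc (0 : ℝ) r, x (Pi.single i t) = X i t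
  planes : ∀ i j, i ≠ j → ∀ ξ ∈ box m r, (∀ k, k ≠ i → k ≠ j → ξ k = 0) →
    c i j ξ = C i j (ξ i, ξ j)

/-- Two nets with rotation coefficients coincide on `B₀(r)`. -/
def SameNet {m N : ℕ} (r : ℝ) (x x' : (Fin m → ℝ) → EuclideanSpace ℝ (Fin N))
    (c c' : Fin m → Fin m → (Fin m → ℝ) → ℝ) : Prop :=
  Set.EqOn x x' (box m r) ∧ ∀ i j, i ≠ j → Set.EqOn (c i j) (c' i j) (box m r)

/-! ### Discrete nets

A point `ξ ∈ (ε ℤ)^m` with non-negative coordinates is represented by the integer vector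
`n` with `ξ = ε n`. -/

/-- The lattice cube `B₀^ε(r)`. -/
def latticeBox (m : ℕ) (ε r : ℝ) : Set (Fin m → ℕ) :=
  {n | ∀ i, ε * (n i : ℝ) ≤ r}

/-- The point shifted by one step in direction `i`. -/
def shift {m : ℕ} (i : Fin m) (n : Fin m → ℕ) : Fin m → ℕ :=
  n + Pi.single i 1

/-- The difference quotient `δᵢ u`. -/
def diff {m : ℕ} {E : Type*} [NormedAddCommGroup E] [NormedSpace ℝ E]
    (ε : ℝ) (i : Fin m) (u : (Fin m → ℕ) → E) (n : Fin m → ℕ) : E :=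
  ε⁻¹ • (u (shift i n) - u n)

/-- The iterated difference quotient `δ^α u = δ₁^{α₁} ⋯ δₘ^{αₘ} u`. -/
def multiDiff {m : ℕ} {E : Type*} [NormedAddCommGroup E] [NormedSpace ℝ E]
    (ε : ℝ) (α : Fin m → ℕ) (u : (Fin m → ℕ) → E) : (Fin m → ℕ) → E :=
  (List.finRange m).foldr (fun i v => (diff ε i)^[α i] v) u

/-- `x : B₀^ε(r) → ℝᴺ` is a discrete conjugate net with rotation coefficients `c i j`, `i ≠ j`:
`δᵢδⱼ x = c_{ji} δᵢ x + c_{ij} δⱼ x` on every elementary quadrilateral of the lattice cube. -/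
def IsDiscreteConjugateNet {m N : ℕ} (ε r : ℝ) (x : (Fin m → ℕ) → EuclideanSpace ℝ (Fin N))
    (c : Fin m → Fin m → (Fin m → ℕ) → ℝ) : Prop :=
  ∀ i j, i ≠ j → ∀ n, shift i (shift j n) ∈ latticeBox m ε r →
    diff ε i (diff ε j x) n = c j i n • diff ε i x n + c i j n • diff ε j x n

/-- The discrete compatibility equations
`δᵢ c_{kj} = (τⱼ c_{ik}) c_{kj} + (τⱼ c_{ki}) c_{ij} - (τᵢ c_{kj}) c_{ij}`, for pairwise distinct
`i, j, k`, on every elementary hexahedron of the lattice cube. -/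
def IsDiscreteCompatible {m : ℕ} (ε r : ℝ) (c : Fin m → Fin m → (Fin m → ℕ) → ℝ) : Prop :=
  ∀ i j k, i ≠ j → j ≠ k → k ≠ i → ∀ n, shift i (shift j (shift k n)) ∈ latticeBox m ε r →
    diff ε i (c k j) n =
      c i k (shift j n) * c k j n + c k i (shift j n) * c i j n - c k j (shift i n) * c i j n

/-- `x` and `c` take on the lattice axes and lattice coordinate planes the values of `X i`
and `C i j`. -/
structure HasDiscreteData {m N : ℕ} (ε r : ℝ) (X : Fin m → ℝ → EuclideanSpace ℝ (Fin N))
    (C : Fin m → Fin m → ℝ × ℝ → ℝ) (x : (Fin m → ℕ) → EuclideanSpace ℝ (Fin N))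
    (c : Fin m → Fin m → (Fin m → ℕ) → ℝ) : Prop where
  curves : ∀ i (a : ℕ), Pi.single i a ∈ latticeBox m ε r →
    x (Pi.single i a) = X i (ε * (a : ℝ))
  planes : ∀ i j, i ≠ j → ∀ n, shift i (shift j n) ∈ latticeBox m ε r →
    (∀ k, k ≠ i → k ≠ j → n k = 0) → c i j n = C i j (ε * (n i : ℝ), ε * (n j : ℝ))

/-- Two discrete nets coincide on the lattice cube, and their rotation coefficients coincide on
all elementary quadrilaterals of the lattice cube. -/
def SameDiscreteNet {m N : ℕ} (ε r : ℝ) (x x' : (Fin m → ℕ) → EuclideanSpace ℝ (Fin N))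
    (c c' : Fin m → Fin m → (Fin m → ℕ) → ℝ) : Prop :=
  (∀ n ∈ latticeBox m ε r, x n = x' n) ∧
    ∀ i j, i ≠ j → ∀ n, shift i (shift j n) ∈ latticeBox m ε r → c i j n = c' i j n

/-- `‖u‖_ℓ ≤ K` for the discrete `C^ℓ`-norm
`‖u‖_ℓ = sup {|δ^α u(ξ)| : |α| ≤ ℓ, ξ ∈ B₀^ε(r - ε|α|)}`. -/
def LatticeNormLE {m : ℕ} {E : Type*} [NormedAddCommGroup E] [NormedSpace ℝ E]
    (ε r : ℝ) (l : ℕ) (u : (Fin m → ℕ) → E) (K : ℝ) : Prop :=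
  ∀ α : Fin m → ℕ, ∑ i, α i ≤ l →
    ∀ n ∈ latticeBox m ε (r - ε * ((∑ i, α i : ℕ) : ℝ)), ‖multiDiff ε α u n‖ ≤ K

/-- The family `u ε`, `0 < ε < ε₁`, of functions on `B₀^ε(r)` is `O(ε)`-convergent in
`C^∞(B₀(r))` to `v`: there are constants `K_ℓ` with `‖u^ε - v|_{B₀^ε(r)}‖_ℓ ≤ K_ℓ ε` for all
`ℓ ≥ 0` and all positive `ε < ε₁` with `ε < r/ℓ`. -/
def ConvergesSmoothly {m : ℕ} {E : Type*} [NormedAddCommGroup E] [NormedSpace ℝ E]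
    (r ε₁ : ℝ) (u : ℝ → (Fin m → ℕ) → E) (v : (Fin m → ℝ) → E) : Prop :=
  ∃ K : ℕ → ℝ, ∀ (l : ℕ) (ε : ℝ), 0 < ε → ε < ε₁ → ε * (l : ℝ) < r →
    LatticeNormLE ε r l (fun n => u ε n - v (fun i => ε * (n i : ℝ))) (K l * ε)

/-- Any three of the tangent vectors `X i'(0)` are linearly independent
(no condition if `m ≤ 2`). -/
def IsRegularData {m N : ℕ} (X : Fin m → ℝ → EuclideanSpace ℝ (Fin N)) : Prop :=
  ∀ i j k, i ≠ j → j ≠ k → k ≠ i →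
    LinearIndependent ℝ ![deriv (X i) 0, deriv (X j) 0, deriv (X k) 0]

end ConjugateNet

end

open scoped ContDiff

noncomputable section

open Set Filter Topology

namespace ConjugateNet


/-! ### Superposition operators and a smooth implicit function -/

/-! Once the tangent vectors `∂ⱼ x` are added to the unknowns, conjugate nets with compatible
coefficients solve a first-order system `∂ᵢ uₖ = fₖᵢ(u)` in which the unknown `k` evolves only in
certain directions (`evolves`, `rhs`). The given curves and coefficient functions supply Goursat
data: each unknown is prescribed where its evolution coordinates vanish. The system is consistent,
in that the two ways of computing a mixed derivative agree (`rhs_consistent`).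

Continuous existence. Integrating along rays in the evolution directions turns the problem into an
equation in the space of continuous functions on the unit cube, with the scaling vector of the cube
as a parameter. At parameter zero its linearisation is the identity, so the implicit function
theorem applies, and smooth dependence on the parameter is smoothness of the solution
(`exists_radial_solution`). Only the radial equations have been solved so far. The defects in the
individual equations satisfy an Euler identity, and by consistency their curl is bounded by the
defects themselves, so they vanish near the origin (`equations_of_radial`). Uniqueness follows from
an exponentially weighted maximum (`goursat_unique`). For regular data compatibility is automatic:
comparing mixed third derivatives of `x` gives the equation for the coefficients wherever the
tangents are independent (`isCompatible_of_linearIndependent`), and a continuity argument in the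
size of the cube propagates independence (`sameNet_of_linearIndependent`).

Discrete existence. The discrete compatibility equations are implicit, since they contain several
shifted coefficients. The substitution `b k j = c k j / (1 + ε c j k)` makes them an explicit
evolution (`stepRot`) that is consistent in four dimensions (`stepRot_consistent`); the lattice
system can then be solved step by step (`exists_lattice_solution`). Each step is an Euler step for
the continuous system up to `ε²` (`latticeStep_eq`). Discrete uniqueness is an induction over
lattice points: on one hexahedron the difference of two solutions satisfies a homogeneous linear
system close to the identity (`eq_zero_of_near_identity`).

Convergence. The scaled errors `y = (u - v) / ε` satisfy equations `δᵢ yₖ = gₖᵢ` whose right-hand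
sides inherit bounds from `y`. An induction on the order of the difference quotients, with a
discrete Gronwall estimate at the top order, bounds them all uniformly in `ε` (`tame_of_evolution`,
`exists_discrete_approximation`). Multiplication by `ε` gives the convergence in every norm. -/

/-- The superposition operator `h ↦ G ∘ h` on continuous functions. -/
def superpose {K E F : Type*} [TopologicalSpace K] [TopologicalSpace E] [TopologicalSpace F]
    (G : E → F) (hG : Continuous G) (h : C(K, E)) : C(K, F) :=
  ⟨fun ξ => G (h ξ), hG.comp h.continuous⟩

lemma continuous_superpose {K E F : Type*} [TopologicalSpace K] [TopologicalSpace E]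
    [TopologicalSpace F] (G : E → F) (hG : Continuous G) :
    Continuous (superpose (K := K) G hG) :=
  ContinuousMap.continuous_postcomp ⟨G, hG⟩

section Superposition

variable {K : Type} [TopologicalSpace K] [CompactSpace K]
  {E F : Type} [NormedAddCommGroup E] [NormedSpace ℝ E] [NormedAddCommGroup F] [NormedSpace ℝ F]

/-- Pointwise application of a continuous family of linear maps. -/
def pointwiseApply : C(K, E →L[ℝ] F) →L[ℝ] C(K, E) →L[ℝ] C(K, F) :=
  LinearMap.mkContinuous₂
    (LinearMap.mk₂ ℝ
      (fun (H : C(K, E →L[ℝ] F)) (k : C(K, E)) =>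
        (⟨fun ξ => H ξ (k ξ), H.continuous.clm_apply k.continuous⟩ : C(K, F)))
      (fun _ _ _ => by ext; simp) (fun _ _ _ => by ext; simp)
      (fun _ _ _ => by ext; simp) (fun _ _ _ => by ext; simp)) 1
    (fun H k => by
      rw [ContinuousMap.norm_le _ (by positivity)]
      intro ξ
      rw [one_mul]
      exact ((H ξ).le_opNorm _).trans
        (by
          gcongr
          · exact H.norm_coe_le_norm ξ
          · exact k.norm_coe_le_norm ξ))

lemma pointwiseApply_apply (H : C(K, E →L[ℝ] F)) (k : C(K, E)) (ξ : K) :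
    pointwiseApply H k ξ = H ξ (k ξ) := rfl

/-- The mean value inequality on each segment from `h ξ` to `h ξ + k ξ` needs `fderiv ℝ G` to vary
little along it, uniformly in `ξ`. This is continuity at `h` of the superposition operator of
`fderiv ℝ G` in the sup norm, since `h + t • k` stays in the same ball. -/
lemma hasFDerivAt_superpose (G : E → F) (hG : ContDiff ℝ 1 G) (h : C(K, E)) :
    HasFDerivAt (superpose (K := K) G hG.continuous)
      (pointwiseApply (superpose (K := K) (fderiv ℝ G) (hG.continuous_fderiv one_ne_zero) h)) h := by
  have hc := continuous_superpose (K := K) (fderiv ℝ G) (hG.continuous_fderiv one_ne_zero)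
  rw [hasFDerivAt_iff_isLittleO_nhds_zero, Asymptotics.isLittleO_iff]
  intro ε hε
  obtain ⟨δ, hδ, hball⟩ := (Metric.continuous_iff (α := C(K, E)) (β := C(K, E →L[ℝ] F))).mp hc h ε hε
  filter_upwards [Metric.ball_mem_nhds (0 : C(K, E)) hδ] with k hk
  rw [mem_ball_zero_iff] at hk
  rw [ContinuousMap.norm_le _ (by positivity)]
  intro ξ
  have key : ∀ y ∈ segment ℝ (h ξ) (h ξ + k ξ), ‖fderiv ℝ G y - fderiv ℝ G (h ξ)‖ ≤ ε := by
    intro y hy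
    rw [segment_eq_image'] at hy
    obtain ⟨t, ht, rfl⟩ := hy
    have h1 : dist (h + t • k) h < δ := by
      rw [dist_eq_norm, add_sub_cancel_left, norm_smul, Real.norm_of_nonneg ht.1]
      nlinarith [norm_nonneg k, ht.2]
    have h2 := ContinuousMap.dist_lt_iff hε |>.mp (hball _ h1) ξ
    simp only [superpose, ContinuousMap.coe_mk, dist_eq_norm] at h2
    simpa using h2.le
  have := (convex_segment (h ξ) (h ξ + k ξ)).norm_image_sub_le_of_norm_hasFDerivWithin_le'
    (f := G) (f' := fderiv ℝ G) (φ := fderiv ℝ G (h ξ))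
    (fun y _ => ((hG.differentiable one_ne_zero) y).hasFDerivAt.hasFDerivWithinAt) key
    (left_mem_segment ℝ _ _) (right_mem_segment ℝ _ _)
  refine le_trans (le_of_eq ?_) (this.trans ?_)
  · simp [superpose, pointwiseApply_apply]
  · rw [add_sub_cancel_left]
    exact mul_le_mul_of_nonneg_left (k.norm_coe_le_norm ξ) hε.le

/-- The derivative of a superposition operator is again one, with symbol `fderiv ℝ G`, followed by a
bounded linear map. The target space varies in the induction because `fderiv ℝ G` takes values in a
space of operators. -/
theorem contDiff_superpose_nat (n : ℕ) :
    ∀ {F : Type} [NormedAddCommGroup F] [NormedSpace ℝ F] (G : E → F) (hG : ContDiff ℝ n G),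
      ContDiff ℝ n (superpose (K := K) G hG.continuous) := by
  induction n with
  | zero =>
    intro F _ _ G hG
    exact contDiff_zero.2 (continuous_superpose G hG.continuous)
  | succ n ih =>
    intro F _ _ G hG
    have h1 : ContDiff ℝ 1 G := hG.of_le (by exact_mod_cast Nat.le_add_left 1 n)
    have h2 : ContDiff ℝ n (fderiv ℝ G) := hG.fderiv_right (by norm_cast)
    have h3 := (ContinuousLinearMap.contDiff (n := n)
      (pointwiseApply (K := K) (E := E) (F := F))).comp (ih (fderiv ℝ G) h2)
    refine contDiff_succ_iff_hasFDerivAt.2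
      ⟨fun h => pointwiseApply (superpose (fderiv ℝ G) h2.continuous h),
      h3,
      fun h => hasFDerivAt_superpose G h1 h⟩

theorem contDiff_superpose (G : E → F) (hG : ContDiff ℝ ∞ G) :
    ContDiff ℝ ∞ (superpose (K := K) G hG.continuous) :=
  contDiff_infty.2 fun n => contDiff_superpose_nat n G (hG.of_le (by exact_mod_cast le_top))

end Superposition

/-- A smooth equation `Φ (x, y) = 0` with invertible partial derivative in `y` has near the base
point a smooth and locally unique solution `y = S x`. -/
theorem exists_contDiffAt_implicit {E₁ E₂ F : Type*} [NormedAddCommGroup E₁] [NormedSpace ℝ E₁]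
    [CompleteSpace E₁] [NormedAddCommGroup E₂] [NormedSpace ℝ E₂] [CompleteSpace E₂]
    [NormedAddCommGroup F] [NormedSpace ℝ F] [CompleteSpace F]
    {Φ : E₁ × E₂ → F} (hΦ : ContDiff ℝ ∞ Φ) (u : E₁ × E₂) (hu : Φ u = 0)
    (hinv : (fderiv ℝ Φ u ∘L .inr ℝ E₁ E₂).IsInvertible) :
    ∃ S : E₁ → E₂, S u.1 = u.2 ∧ (∀ᶠ x in 𝓝 u.1, ContDiffAt ℝ ∞ S x) ∧
      (∀ᶠ x in 𝓝 u.1, Φ (x, S x) = 0) ∧ ∀ᶠ v in 𝓝 u, Φ v = 0 → S v.1 = v.2 := by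
  have h0 : (∞ : WithTop ℕ∞) ≠ 0 := by simp
  have hd : ∀ v, ContDiffAt ℝ ∞ Φ v := fun v => hΦ.contDiffAt
  set S := (hd u).implicitFunction h0 hinv with hS
  have hSu : S u.1 = u.2 := (hd u).implicitFunction_apply_self h0 hinv
  have hS1 : ∀ᶠ x in 𝓝 u.1, Φ (x, S x) = 0 := by
    simpa [hu] using (hd u).eventually_apply_implicitFunction h0 hinv
  have hS2 : ∀ᶠ v in 𝓝 u, Φ v = 0 → S v.1 = v.2 := by
    filter_upwards [(hd u).eventually_apply_eq_iff_implicitFunction h0 hinv] with v hv h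
    exact hv.1 (h.trans hu.symm)
  refine ⟨S, hSu, ?_, hS1, hS2⟩
  have hsm : ContDiffAt ℝ ∞ S u.1 := (hd u).contDiffAt_implicitFunction h0 hinv
  have hcont : ∀ᶠ x in 𝓝 u.1, ContinuousAt S x := by
    have h1 : ContDiffAt ℝ 1 S u.1 := hsm.of_le (by exact_mod_cast le_top)
    filter_upwards [h1.eventually (by simp)] with x hx using hx.continuousAt
  have hpair : ContinuousAt (fun x => (x, S x)) u.1 :=
    continuousAt_id.prodMk hsm.continuousAt
  have hpair' : Tendsto (fun x => (x, S x)) (𝓝 u.1) (𝓝 u) := by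
    have := hpair.tendsto
    rwa [hSu] at this
  have hinv' : ∀ᶠ x in 𝓝 u.1, (fderiv ℝ Φ (x, S x) ∘L .inr ℝ E₁ E₂).IsInvertible := by
    obtain ⟨e, he⟩ := hinv
    have hc : Continuous fun v => fderiv ℝ Φ v ∘L .inr ℝ E₁ E₂ :=
      (hΦ.continuous_fderiv h0).clm_comp continuous_const
    have hn := e.nhds
    rw [he] at hn
    filter_upwards [(hc.continuousAt.tendsto.comp hpair').eventually_mem hn] with x hx
    obtain ⟨e', he'⟩ := hx
    exact ⟨e', he'⟩
  -- `ContDiffAt` of order `∞` at the base point need not persist nearby. The implicit function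
  -- theorem is therefore applied anew at each nearby `(x, S x)`, and local uniqueness identifies
  -- the new implicit function with `S` near `x`.
  filter_upwards [hcont, hinv', hS1.eventually_nhds] with x hx hxi hx1
  have hx0 : Φ (x, S x) = 0 := hx1.self_of_nhds
  have h2 := (hd (x, S x)).contDiffAt_implicitFunction h0 hxi
  refine h2.congr_of_eventuallyEq ?_
  have h3 : Tendsto (fun y => (y, S y)) (𝓝 x) (𝓝 (x, S x)) :=
    (continuousAt_id.prodMk hx).tendsto
  filter_upwards [h3.eventually ((hd (x, S x)).eventually_apply_eq_iff_implicitFunction h0 hxi),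
    hx1] with y hy hy1
  exact (hy.1 (hy1.trans hx0.symm)).symm


/-! ### Local solvability of the integrated Goursat problem -/

open Classical in
/-- The point `ξ` with the coordinates in the evolution directions of the unknown `k` multiplied
by `t`. -/
def ray {m : ℕ} {κ : Type} (E : κ → Fin m → Prop) (k : κ) (t : ℝ) (ξ : Fin m → ℝ) : Fin m → ℝ :=
  fun i => if E k i then t * ξ i else ξ i

section Goursat

variable {m : ℕ} {κ : Type} (E : κ → Fin m → Prop)

lemma ray_one (k : κ) (ξ : Fin m → ℝ) : ray E k 1 ξ = ξ := by
  funext i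
  simp [ray]

lemma ray_mul (k : κ) (t : ℝ) (l ξ : Fin m → ℝ) : ray E k t (l * ξ) = l * ray E k t ξ := by
  funext i
  simp only [ray, Pi.mul_apply]
  split_ifs <;> ring

lemma ray_ray (k : κ) (s t : ℝ) (ξ : Fin m → ℝ) : ray E k s (ray E k t ξ) = ray E k (s * t) ξ := by
  funext i
  simp only [ray]
  split_ifs <;> ring

lemma continuous_ray (k : κ) : Continuous fun p : ℝ × (Fin m → ℝ) => ray E k p.1 p.2 := by
  refine continuous_pi fun i => ?_
  simp only [ray]
  split_ifs <;> fun_prop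

lemma contDiff_ray (k : κ) (t : ℝ) : ContDiff ℝ ∞ (ray (m := m) E k t) := by
  refine contDiff_pi.2 fun i => ?_
  simp only [ray]
  split_ifs <;> fun_prop

lemma norm_ray_le (k : κ) {t : ℝ} (ht : t ∈ Icc (0 : ℝ) 1) (ξ : Fin m → ℝ) :
    ‖ray E k t ξ‖ ≤ ‖ξ‖ := by
  refine (pi_norm_le_iff_of_nonneg (norm_nonneg _)).2 fun i => ?_
  refine le_trans ?_ (norm_le_pi_norm ξ i)
  simp only [ray]
  split_ifs
  · rw [norm_mul, Real.norm_of_nonneg ht.1]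
    exact mul_le_of_le_one_left (norm_nonneg _) ht.2
  · exact le_rfl

/-- The unit cube. -/
abbrev Cube (m : ℕ) : Type := Icc (0 : Fin m → ℝ) 1

/-- The ray as a map of the unit cube. -/
def cubeRay (k : κ) (t : ℝ) (ξ : Cube m) : Cube m :=
  ⟨ray E k (projIcc (0 : ℝ) 1 zero_le_one t) ξ, by
    have ht := (projIcc (0 : ℝ) 1 zero_le_one t).2
    have hξ := ξ.2
    constructor <;> intro i
    · simp only [ray, Pi.zero_apply]
      split_ifs
      · exact mul_nonneg ht.1 (hξ.1 i)
      · exact hξ.1 i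
    · simp only [ray, Pi.one_apply]
      split_ifs
      · exact mul_le_one₀ ht.2 (hξ.1 i) (hξ.2 i)
      · exact hξ.2 i⟩

lemma continuous_cubeRay (k : κ) : Continuous fun p : ℝ × Cube m => cubeRay E k p.1 p.2 := by
  refine Continuous.subtype_mk ?_ _
  have h1 : Continuous fun p : ℝ × Cube m => (projIcc (0 : ℝ) 1 zero_le_one p.1 : ℝ) :=
    continuous_subtype_val.comp (continuous_projIcc.comp continuous_fst)
  have h2 : Continuous fun p : ℝ × Cube m => (p.2 : Fin m → ℝ) :=
    continuous_subtype_val.comp continuous_snd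
  exact (continuous_ray E k).comp (h1.prodMk h2)

variable [Fintype κ]

/-- Integration along the ray, weighted with the `i`-th coordinate. -/
def rayIntegral (i : Fin m) : C(Cube m, κ → ℝ) →L[ℝ] C(Cube m, κ → ℝ) :=
  have hcont : ∀ (g : C(Cube m, κ → ℝ)) (k : κ),
      Continuous fun p : Cube m × ℝ => (p.1 : Fin m → ℝ) i * g (cubeRay E k p.2 p.1) k := by
    intro g k
    have h1 : Continuous fun p : Cube m × ℝ => cubeRay E k p.2 p.1 :=
      (continuous_cubeRay E k).comp (continuous_snd.prodMk continuous_fst)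
    have h2 : Continuous fun p : Cube m × ℝ => (p.1 : Fin m → ℝ) i :=
      (continuous_apply i).comp (continuous_subtype_val.comp continuous_fst)
    exact h2.mul ((continuous_apply k).comp (g.continuous.comp h1))
  LinearMap.mkContinuous
    { toFun := fun g => ⟨fun ξ k => ∫ t in (0 : ℝ)..1, (ξ : Fin m → ℝ) i * g (cubeRay E k t ξ) k,
        continuous_pi fun k =>
          intervalIntegral.continuous_parametric_intervalIntegral_of_continuous' (hcont g k) 0 1⟩
      map_add' := fun g h => by
        ext ξ k
        simp only [ContinuousMap.coe_mk, ContinuousMap.add_apply, Pi.add_apply, mul_add]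
        exact intervalIntegral.integral_add
          (((hcont g k).comp (Continuous.prodMk_right ξ)).intervalIntegrable _ _)
          (((hcont h k).comp (Continuous.prodMk_right ξ)).intervalIntegrable _ _)
      map_smul' := fun c g => by
        ext ξ k
        simp only [ContinuousMap.coe_mk, ContinuousMap.smul_apply, Pi.smul_apply, smul_eq_mul,
          RingHom.id_apply, ← intervalIntegral.integral_const_mul]
        congr 1
        funext t
        ring } 1
    (fun g => by
      rw [ContinuousMap.norm_le _ (by positivity), one_mul]
      intro ξ
      refine (pi_norm_le_iff_of_nonneg (norm_nonneg _)).2 fun k => ?_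
      refine (intervalIntegral.norm_integral_le_of_norm_le_const (C := ‖g‖) ?_).trans (by simp)
      intro t _
      rw [norm_mul, Real.norm_of_nonneg (ξ.2.1 i)]
      calc (ξ : Fin m → ℝ) i * ‖g (cubeRay E k t ξ) k‖ ≤ 1 * ‖g‖ :=
            mul_le_mul (ξ.2.2 i) ((norm_le_pi_norm _ k).trans (g.norm_coe_le_norm _))
              (norm_nonneg _) zero_le_one
        _ = ‖g‖ := one_mul _)

lemma rayIntegral_apply (i : Fin m) (g : C(Cube m, κ → ℝ)) (ξ : Cube m) (k : κ) :
    rayIntegral E i g ξ k =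
      ∫ t in (0 : ℝ)..1, (ξ : Fin m → ℝ) i * g (cubeRay E k t ξ) k := rfl

/-- The map `l ↦ (ξ ↦ l * ξ)` into the continuous functions on the unit cube. -/
def dilation (m : ℕ) : (Fin m → ℝ) →L[ℝ] C(Cube m, Fin m → ℝ) :=
  LinearMap.toContinuousLinearMap
    { toFun := fun l => ⟨fun ξ => l * ξ, continuous_const.mul continuous_subtype_val⟩
      map_add' := fun a b => by ext; simp [add_mul]
      map_smul' := fun c a => by ext; simp }

lemma dilation_apply (l : Fin m → ℝ) (ξ : Cube m) : dilation m l ξ = l * ξ := rfl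

/-- Goursat problems are locally solvable in integrated form, by a smooth function. -/
theorem exists_radial_solution (f : Fin m → (κ → ℝ) → (κ → ℝ)) (hf : ∀ i, ContDiff ℝ ∞ (f i))
    (U : κ → (Fin m → ℝ) → ℝ) (hU : ∀ k, ContDiff ℝ ∞ (U k)) :
    ∃ ρ : ℝ, 0 < ρ ∧ ∃ u : (Fin m → ℝ) → (κ → ℝ),
      (∀ ξ ∈ Metric.ball (0 : Fin m → ℝ) ρ, ContDiffAt ℝ ∞ u ξ) ∧
      ∀ ξ ∈ Metric.ball (0 : Fin m → ℝ) ρ, ∀ k, u ξ k = U k (ray E k 0 ξ) +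
        ∑ i, ∫ t in (0 : ℝ)..1, ξ i * f i (u (ray E k t ξ)) k := by
  set G : (Fin m → ℝ) → (κ → ℝ) := fun ζ k => U k (ray E k 0 ζ) with hG
  have hGs : ContDiff ℝ ∞ G := contDiff_pi.2 fun k => (hU k).comp (contDiff_ray E k 0)
  set D : (Fin m → ℝ) → C(Cube m, κ → ℝ) := fun l => superpose G hGs.continuous (dilation m l)
    with hD
  have hDs : ContDiff ℝ ∞ D := (contDiff_superpose G hGs).comp (dilation m).contDiff
  set N : Fin m → C(Cube m, κ → ℝ) → C(Cube m, κ → ℝ) :=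
    fun i => superpose (f i) (hf i).continuous with hN
  have hNs : ∀ i, ContDiff ℝ ∞ (N i) := fun i => contDiff_superpose (f i) (hf i)
  -- The function `v` stands for `ξ ↦ u (l * ξ)`. The size of the domain thus becomes the parameter
  -- `l`, and for `l = 0` the integral terms disappear.
  set Φ : (Fin m → ℝ) × C(Cube m, κ → ℝ) → C(Cube m, κ → ℝ) :=
    fun p => p.2 - D p.1 - ∑ i, p.1 i • rayIntegral E i (N i p.2) with hΦ
  have hΦs : ContDiff ℝ ∞ Φ := by
    refine (contDiff_snd.sub (hDs.comp contDiff_fst)).sub (ContDiff.sum fun i _ => ?_)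
    have h1 : ContDiff ℝ ∞ fun g => rayIntegral E i g := (rayIntegral E i).contDiff
    have h2 : ContDiff ℝ ∞ fun p : (Fin m → ℝ) × C(Cube m, κ → ℝ) => rayIntegral E i (N i p.2) :=
      h1.comp ((hNs i).comp contDiff_snd)
    have h3 : ContDiff ℝ ∞ fun p : (Fin m → ℝ) × C(Cube m, κ → ℝ) => p.1 i :=
      (contDiff_apply ℝ ℝ i).comp contDiff_fst
    exact h3.smul h2
  have hΦ0 : ∀ v, Φ (0, v) = v - D 0 := fun v => by simp [hΦ]
  have hinv : (fderiv ℝ Φ (0, D 0) ∘L .inr ℝ (Fin m → ℝ) C(Cube m, κ → ℝ)).IsInvertible := by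
    have h1 : HasFDerivAt (fun v => Φ (0, v))
        (fderiv ℝ Φ (0, D 0) ∘L .inr ℝ (Fin m → ℝ) C(Cube m, κ → ℝ)) (D 0) := by
      have h2 : HasFDerivAt Φ (fderiv ℝ Φ (0, D 0)) (0, D 0) :=
        (hΦs.differentiable (by simp) _).hasFDerivAt
      exact h2.comp (D 0) (hasFDerivAt_prodMk_right 0 (D 0))
    have h3 : HasFDerivAt (fun v => Φ (0, v)) (ContinuousLinearMap.id ℝ C(Cube m, κ → ℝ)) (D 0) := by
      simp only [hΦ0]
      exact (hasFDerivAt_id _).sub_const _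
    rw [h1.unique h3]
    exact ⟨ContinuousLinearEquiv.refl ℝ _, rfl⟩
  obtain ⟨S, hS0, hSs, hSeq, hSu⟩ := exists_contDiffAt_implicit hΦs (0, D 0) (by simp [hΦ0]) hinv
  simp only at hS0 hSs hSeq
  obtain ⟨η, hη, hηS⟩ := Metric.eventually_nhds_iff.1 hSu
  have hSc : ∀ᶠ l in 𝓝 (0 : Fin m → ℝ), dist (S l) (D 0) < η := by
    have := hSs.self_of_nhds.continuousAt
    rw [ContinuousAt, hS0] at this
    exact this.eventually (Metric.ball_mem_nhds _ hη)
  obtain ⟨ρ', hρ', hball⟩ := Metric.eventually_nhds_iff.1 (hSs.and (hSeq.and hSc))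
  set ρ := min ρ' η
  have hρ : 0 < ρ := lt_min hρ' hη
  have hprop : ∀ l ∈ Metric.ball (0 : Fin m → ℝ) ρ,
      ContDiffAt ℝ ∞ S l ∧ Φ (l, S l) = 0 ∧ dist (S l) (D 0) < η := fun l hl =>
    hball (lt_of_lt_of_le hl (min_le_left _ _))
  have hmulball : ∀ l ∈ Metric.ball (0 : Fin m → ℝ) ρ, ∀ ξ : Cube m,
      l * (ξ : Fin m → ℝ) ∈ Metric.ball (0 : Fin m → ℝ) ρ := by
    intro l hl ξ
    rw [mem_ball_zero_iff] at hl ⊢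
    refine lt_of_le_of_lt ?_ hl
    refine (pi_norm_le_iff_of_nonneg (norm_nonneg _)).2 fun i => ?_
    rw [Pi.mul_apply, norm_mul, Real.norm_of_nonneg (ξ.2.1 i)]
    exact (mul_le_of_le_one_right (norm_nonneg _) (ξ.2.2 i)).trans (norm_le_pi_norm l i)
  have hpt : ∀ l v, Φ (l, v) = 0 ↔ ∀ (ξ : Cube m) k, v ξ k = U k (ray E k 0 (l * ξ)) +
      ∑ i, ∫ t in (0 : ℝ)..1, (l i * (ξ : Fin m → ℝ) i) * f i (v (cubeRay E k t ξ)) k := by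
    intro l v
    have h1 : Φ (l, v) = 0 ↔ v = D l + ∑ i, l i • rayIntegral E i (N i v) := by
      simp only [hΦ]
      rw [sub_sub, sub_eq_zero]
    rw [h1, ContinuousMap.ext_iff]
    refine forall_congr' fun ξ => ?_
    rw [funext_iff]
    refine forall_congr' fun k => ?_
    simp only [ContinuousMap.add_apply, ContinuousMap.sum_apply, ContinuousMap.smul_apply,
      Pi.add_apply, Finset.sum_apply, Pi.smul_apply, rayIntegral_apply, smul_eq_mul,
      ← intervalIntegral.integral_const_mul, ← mul_assoc]
    rfl
  let one : Cube m := ⟨1, zero_le_one, le_rfl⟩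
  -- Restricting the solution with parameter `l` to a subcube and rescaling gives a solution with
  -- parameter `l * μ`. By local uniqueness all `S l` come from the single function `l ↦ S l one`,
  -- which inherits the smoothness of `S`.
  have hscale : ∀ l ∈ Metric.ball (0 : Fin m → ℝ) ρ, ∀ ξ : Cube m,
      S l ξ = S (l * (ξ : Fin m → ℝ)) one := by
    intro l hl μ
    have hmulmem : ∀ ξ : Cube m, (μ : Fin m → ℝ) * ξ ∈ Icc (0 : Fin m → ℝ) 1 := fun ξ =>
      ⟨fun i => mul_nonneg (μ.2.1 i) (ξ.2.1 i),
        fun i => mul_le_one₀ (μ.2.2 i) (ξ.2.1 i) (ξ.2.2 i)⟩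
    let v : C(Cube m, κ → ℝ) := ⟨fun ξ => S l ⟨(μ : Fin m → ℝ) * ξ, hmulmem ξ⟩, by
      exact (S l).continuous.comp
        ((continuous_const.mul continuous_subtype_val).subtype_mk _)⟩
    have hv0 : Φ (l * (μ : Fin m → ℝ), v) = 0 := by
      rw [hpt]
      intro ξ k
      have := (hpt l (S l)).1 (hprop l hl).2.1 ⟨(μ : Fin m → ℝ) * ξ, hmulmem ξ⟩ k
      simp only [v, ContinuousMap.coe_mk]
      rw [this]
      congr 1
      · rw [mul_assoc]
      · refine Finset.sum_congr rfl fun i _ => ?_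
        congr 1
        funext t
        congr 1
        · simp only [Pi.mul_apply, mul_assoc]
        · congr 3
          exact Subtype.ext (ray_mul E k _ _ _)
    have hvd : dist v (D 0) < η := by
      refine lt_of_le_of_lt ?_ (hprop l hl).2.2
      rw [ContinuousMap.dist_le dist_nonneg]
      intro ξ
      have := ContinuousMap.dist_apply_le_dist (f := S l) (g := D 0)
        (⟨(μ : Fin m → ℝ) * ξ, hmulmem ξ⟩ : Cube m)
      simpa [v, hD, superpose, dilation_apply] using this
    have := hηS (y := (l * (μ : Fin m → ℝ), v)) (by
      rw [Prod.dist_eq]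
      refine max_lt ?_ hvd
      exact lt_of_lt_of_le (hmulball l hl μ) (min_le_right _ _)) hv0
    simp only at this
    rw [this]
    simp [v, one]
  refine ⟨ρ, hρ, fun l => S l one, fun l hl => ?_, fun l hl k => ?_⟩
  · have h1 : ContDiffAt ℝ ∞ (fun v : C(Cube m, κ → ℝ) => v one) (S l) :=
      (ContinuousMap.evalCLM (M := κ → ℝ) ℝ one).contDiff.contDiffAt
    exact h1.comp l (hprop l hl).1
  · have := (hpt l (S l)).1 (hprop l hl).2.1 one k
    simp only [this]
    simp only [one, mul_one, Pi.one_apply]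
    congr 1
    refine Finset.sum_congr rfl fun i _ => ?_
    refine intervalIntegral.integral_congr fun t ht => ?_
    rw [uIcc_of_le zero_le_one] at ht
    rw [hscale l hl]
    congr 4
    simp only [cubeRay, projIcc_of_mem zero_le_one ht]
    rw [← ray_mul, mul_one]

end Goursat


/-! ### Local solvability of consistent Goursat problems -/

/-- A bump function makes the local solution global and compactly supported. Derivatives then need
no domain, and each of them is bounded on the whole space, which the error estimates use. -/
lemma exists_contDiff_eq_on_ball {V Y : Type*} [NormedAddCommGroup V] [NormedSpace ℝ V]
    [FiniteDimensional ℝ V] [NormedAddCommGroup Y] [NormedSpace ℝ Y] (u : V → Y) {ρ : ℝ}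
    (hρ : 0 < ρ) (hu : ∀ ξ ∈ Metric.ball (0 : V) ρ, ContDiffAt ℝ ∞ u ξ) :
    ∃ w : V → Y, ContDiff ℝ ∞ w ∧ HasCompactSupport w ∧ ∀ ξ, ‖ξ‖ < ρ / 2 → w ξ = u ξ := by
  let χ : ContDiffBump (0 : V) := ⟨ρ / 2, 3 * ρ / 4, by positivity, by linarith⟩
  have hsupp : tsupport χ ⊆ Metric.ball (0 : V) ρ := by
    rw [χ.tsupport_eq]
    exact Metric.closedBall_subset_ball (by change 3 * ρ / 4 < ρ; linarith)
  refine ⟨fun ξ => χ ξ • u ξ, contDiff_iff_contDiffAt.2 fun ξ => ?_, ?_, fun ξ hξ => ?_⟩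
  · by_cases h : ξ ∈ tsupport χ
    · exact χ.contDiff.contDiffAt.smul (hu ξ (hsupp h))
    · have h0 : χ =ᶠ[𝓝 ξ] 0 := notMem_tsupport_iff_eventuallyEq.1 h
      refine (contDiffAt_const (c := (0 : Y))).congr_of_eventuallyEq ?_
      filter_upwards [h0] with ζ hζ
      simp [hζ]
  · exact χ.hasCompactSupport.smul_right
  · have : χ ξ = 1 := χ.one_of_mem_closedBall (by
      rw [mem_closedBall_zero_iff]; exact hξ.le)
    simp [this]

lemma clm_apply_eq_sum {m : ℕ} (L : (Fin m → ℝ) →L[ℝ] ℝ) (v : Fin m → ℝ) :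
    L v = ∑ i, v i * L (Pi.single i 1) := by
  conv_lhs => rw [← Finset.univ_sum_single v]
  rw [map_sum]
  refine Finset.sum_congr rfl fun i _ => ?_
  have : (Pi.single i (v i) : Fin m → ℝ) = v i • Pi.single i 1 := by
    rw [← Pi.single_smul, smul_eq_mul, mul_one]
  rw [this, map_smul, smul_eq_mul]

section Goursat

variable {m : ℕ} {κ : Type} (E : κ → Fin m → Prop)

open Classical in
/-- The part of a vector along the evolution directions of the unknown `k`. -/
def evolPart (k : κ) (ξ : Fin m → ℝ) : Fin m → ℝ := fun i => if E k i then ξ i else 0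

lemma hasDerivAt_ray (k : κ) (ξ : Fin m → ℝ) (t : ℝ) :
    HasDerivAt (fun s => ray E k s ξ) (evolPart E k ξ) t := by
  rw [hasDerivAt_pi]
  intro i
  simp only [ray, evolPart]
  split_ifs
  · simpa using (hasDerivAt_id t).mul_const (ξ i)
  · exact hasDerivAt_const _ _

lemma evolPart_ray (k : κ) (t : ℝ) (ξ : Fin m → ℝ) :
    evolPart E k (ray E k t ξ) = t • evolPart E k ξ := by
  funext i
  simp only [ray, evolPart, Pi.smul_apply, smul_eq_mul]
  split_ifs <;> simp

variable [Fintype κ]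

/-- The integrated equation implies that the radial derivatives are the prescribed ones. -/
lemma radial_derivative (f : κ → Fin m → (κ → ℝ) → ℝ) (hf : ∀ k i, ContDiff ℝ ∞ (f k i))
    (hfE : ∀ k i, ¬ E k i → f k i = 0)
    (U : κ → (Fin m → ℝ) → ℝ) (u : (Fin m → ℝ) → κ → ℝ) (hu : ContDiff ℝ ∞ u) {ρ : ℝ}
    (heq : ∀ ξ, ‖ξ‖ < ρ → ∀ k, u ξ k = U k (ray E k 0 ξ) +
        ∑ i, ∫ t in (0 : ℝ)..1, ξ i * f k i (u (ray E k t ξ)))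
    (k : κ) (ξ : Fin m → ℝ) (hξ : ‖ξ‖ < ρ) :
    fderiv ℝ (fun ζ => u ζ k) ξ (evolPart E k ξ) = ∑ i, ξ i * f k i (u ξ) := by
  have huk : ContDiff ℝ ∞ fun ζ => u ζ k := contDiff_pi.1 hu k
  have hr1 : ray E k 1 ξ = ξ := ray_one E k ξ
  have h1 : HasDerivAt (fun s => u (ray E k s ξ) k)
      (fderiv ℝ (fun ζ => u ζ k) ξ (evolPart E k ξ)) 1 := by
    have h2 : HasFDerivAt (fun ζ => u ζ k) (fderiv ℝ (fun ζ => u ζ k) ξ) (ray E k 1 ξ) := by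
      rw [hr1]
      exact (huk.differentiable (by simp) ξ).hasFDerivAt
    exact h2.comp_hasDerivAt 1 (hasDerivAt_ray E k ξ 1)
  have hcray : Continuous fun s : ℝ => ray E k s ξ :=
    (continuous_ray E k).comp (continuous_id.prodMk continuous_const)
  have hF : ∀ i, Continuous fun t => f k i (u (ray E k t ξ)) := fun i =>
    (hf k i).continuous.comp (hu.continuous.comp hcray)
  have h3 : HasDerivAt (fun s => U k (ray E k 0 ξ) +
      ∑ i, ξ i * ∫ t in (0 : ℝ)..s, f k i (u (ray E k t ξ))) (∑ i, ξ i * f k i (u ξ)) 1 := by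
    refine HasDerivAt.const_add _ ?_
    refine HasDerivAt.fun_sum fun i _ => ?_
    have := (intervalIntegral.integral_hasDerivAt_right ((hF i).intervalIntegrable 0 1)
      ((hF i).stronglyMeasurableAtFilter _ _) (hF i).continuousAt).const_mul (ξ i)
    simpa [hr1] using this
  refine h1.unique (h3.congr_of_eventuallyEq ?_)
  have hev : ∀ᶠ s in 𝓝 (1 : ℝ), ‖ray E k s ξ‖ < ρ := by
    have : ContinuousAt (fun s : ℝ => ‖ray E k s ξ‖) 1 := hcray.norm.continuousAt
    exact this.eventually (gt_mem_nhds (by simpa [hr1] using hξ))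
  filter_upwards [hev] with s hs
  -- At the point `ray E k s ξ` the substitution `t ↦ s t` turns the weighted ray integral into `ξ i
  -- * ∫ t in 0..s`, so that differentiation in `s` is the fundamental theorem of calculus.
  rw [heq _ hs k, ray_ray, zero_mul]
  congr 1
  refine Finset.sum_congr rfl fun i _ => ?_
  by_cases hE : E k i
  · have h4 := intervalIntegral.mul_integral_comp_mul_left (a := 0) (b := 1)
      (f := fun t => f k i (u (ray E k t ξ))) s
    rw [mul_zero, mul_one] at h4
    rw [← h4, intervalIntegral.integral_const_mul, ← mul_assoc]
    congr 1
    · simp [ray, hE, mul_comm]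
    · simp only [ray_ray, mul_comm s]
  · simp [hfE k i hE]

/-- A smooth solution of the radial equations of a consistent system is a solution of all its
equations near the origin. -/
lemma equations_of_radial (f : κ → Fin m → (κ → ℝ) → ℝ) (hf : ∀ k i, ContDiff ℝ ∞ (f k i))
    (hfE : ∀ k i, ¬ E k i → f k i = 0)
    (hcons : ∀ k i j, E k i → E k j → i ≠ j → ∀ v a b : κ → ℝ, (∀ l, E l i → a l = f l i v) →
      (∀ l, E l j → b l = f l j v) → fderiv ℝ (f k j) v a = fderiv ℝ (f k i) v b)
    (u : (Fin m → ℝ) → κ → ℝ) (hu : ContDiff ℝ ∞ u) {ρ : ℝ} (hρ : 0 < ρ)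
    (hrad : ∀ k ξ, ‖ξ‖ < ρ →
      fderiv ℝ (fun ζ => u ζ k) ξ (evolPart E k ξ) = ∑ i, ξ i * f k i (u ξ)) :
    ∃ σ : ℝ, 0 < σ ∧ σ ≤ ρ ∧ ∀ k i, E k i → ∀ ξ, ‖ξ‖ < σ →
      fderiv ℝ (fun ζ => u ζ k) ξ (Pi.single i 1) = f k i (u ξ) := by
  classical
  have hinf : (∞ : WithTop ℕ∞) ≠ 0 := by simp
  have huk : ∀ k, ContDiff ℝ ∞ fun ζ => u ζ k := contDiff_pi.1 hu
  -- The defect in the equation for `∂ᵢ uₖ`, set to zero when there is no such equation. The radial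
  -- equations say that its contraction with `ξ` vanishes.
  set d : κ → Fin m → (Fin m → ℝ) → ℝ := fun k i ξ =>
    if E k i then fderiv ℝ (fun ζ => u ζ k) ξ (Pi.single i 1) - f k i (u ξ) else 0 with hd
  have hfu : ∀ k i, ContDiff ℝ ∞ fun ξ => f k i (u ξ) := fun k i => (hf k i).comp hu
  have hdu : ∀ k i, ContDiff ℝ ∞ fun ξ => fderiv ℝ (fun ζ => u ζ k) ξ (Pi.single i 1) :=
    fun k i => ((huk k).fderiv_right (by simp)).clm_apply contDiff_const
  have hds : ∀ k i, ContDiff ℝ ∞ (d k i) := by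
    intro k i
    by_cases h : E k i
    · simp only [hd, h, if_true]
      exact (hdu k i).sub (hfu k i)
    · simp only [hd, h, if_false]
      exact contDiff_const
  have heuler : ∀ k ξ, ‖ξ‖ < ρ → ∑ j, ξ j * d k j ξ = 0 := by
    intro k ξ hξ
    have h1 := hrad k ξ hξ
    rw [clm_apply_eq_sum] at h1
    rw [← sub_eq_zero, ← Finset.sum_sub_distrib] at h1
    rw [← h1]
    refine Finset.sum_congr rfl fun j _ => ?_
    by_cases h : E k j
    · simp [hd, evolPart, h, mul_sub]
    · simp [hd, evolPart, h, hfE k j h]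
  -- The Euler identity differentiated in direction `i`: it expresses `d k i` by derivatives of the
  -- other defects, and up to the curl by its own radial derivative.
  have heuler' : ∀ k i ξ, ‖ξ‖ < ρ →
      d k i ξ + ∑ j, ξ j * fderiv ℝ (d k j) ξ (Pi.single i 1) = 0 := by
    intro k i ξ hξ
    have h1 : HasFDerivAt (fun ζ : Fin m → ℝ => ∑ j, ζ j * d k j ζ)
        (∑ j, (ξ j • fderiv ℝ (d k j) ξ + d k j ξ • ContinuousLinearMap.proj (R := ℝ)
          (φ := fun _ : Fin m => ℝ) j)) ξ :=
      HasFDerivAt.fun_sum fun j _ => (hasFDerivAt_apply j ξ).mul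
        ((hds k j).differentiable hinf ξ).hasFDerivAt
    have h2 : HasFDerivAt (fun ζ : Fin m → ℝ => ∑ j, ζ j * d k j ζ)
        (0 : (Fin m → ℝ) →L[ℝ] ℝ) ξ := by
      refine (hasFDerivAt_const (0 : ℝ) ξ).congr_of_eventuallyEq ?_
      have : ∀ᶠ ζ : Fin m → ℝ in 𝓝 ξ, ‖ζ‖ < ρ :=
        continuous_norm.continuousAt.eventually (gt_mem_nhds hξ)
      filter_upwards [this] with ζ hζ using heuler k ζ hζ
    have h3 := congrArg (fun L : (Fin m → ℝ) →L[ℝ] ℝ => L (Pi.single i 1)) (h1.unique h2)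
    simp only [sum_apply, add_apply,
      smul_apply, ContinuousLinearMap.proj_apply, smul_eq_mul,
      zero_apply, Finset.sum_add_distrib] at h3
    rw [add_comm] at h3
    rw [← h3]
    congr 1
    simp [Pi.single_apply]
  have hcomp : IsCompact (Metric.closedBall (0 : Fin m → ℝ) (ρ / 2)) := isCompact_closedBall _ _
  obtain ⟨K, hK⟩ : ∃ K : ℝ, ∀ k i, ∀ ξ ∈ Metric.closedBall (0 : Fin m → ℝ) (ρ / 2),
      ‖fderiv ℝ (f k i) (u ξ)‖ ≤ K := by
    have h1 : ∀ p : κ × Fin m, ∃ K : ℝ, ∀ ξ ∈ Metric.closedBall (0 : Fin m → ℝ) (ρ / 2),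
        ‖fderiv ℝ (f p.1 p.2) (u ξ)‖ ≤ K := fun p => by
      obtain ⟨K, hK⟩ := hcomp.exists_bound_of_continuousOn
        (f := fun ξ => fderiv ℝ (f p.1 p.2) (u ξ))
        (((hf p.1 p.2).continuous_fderiv hinf).comp hu.continuous).continuousOn
      exact ⟨K, hK⟩
    choose K hK using h1
    refine ⟨∑ p, |K p|, fun k i ξ hξ => (hK (k, i) ξ hξ).trans ((le_abs_self _).trans ?_)⟩
    exact Finset.single_le_sum (f := fun p => |K p|) (fun p _ => abs_nonneg _)
      (Finset.mem_univ (k, i))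
  have hK0 : 0 ≤ |K| := abs_nonneg K
  -- Small enough that the curl bound `2 * |K| * D`, integrated over a ray and summed over `m`
  -- directions, gives at most `D / 2`.
  set σ : ℝ := min (ρ / 2) (1 / (4 * m * |K| + 1)) with hσ
  have hσ0 : 0 < σ := lt_min (by positivity) (by positivity)
  have hσρ : σ ≤ ρ / 2 := min_le_left _ _
  have hσK : m * (σ * (2 * |K|)) ≤ 1 / 2 := by
    have h1 : σ ≤ 1 / (4 * m * |K| + 1) := min_le_right _ _
    rw [le_div_iff₀ (by positivity)] at h1
    nlinarith
  set dv : (Fin m → ℝ) → (κ × Fin m → ℝ) := fun ξ p => d p.1 p.2 ξ with hdv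
  have hdvc : Continuous dv := continuous_pi fun p => (hds p.1 p.2).continuous
  obtain ⟨ξ₀, hξ₀, hmax⟩ := (isCompact_closedBall (0 : Fin m → ℝ) σ).exists_isMaxOn
    ⟨0, Metric.mem_closedBall_self hσ0.le⟩ hdvc.norm.continuousOn
  set D := ‖dv ξ₀‖ with hD
  have hD0 : 0 ≤ D := norm_nonneg _
  have hdD : ∀ k i ξ, ‖ξ‖ ≤ σ → |d k i ξ| ≤ D := fun k i ξ hξ =>
    (norm_le_pi_norm (dv ξ) (k, i)).trans (hmax (mem_closedBall_zero_iff.2 hξ))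
  have hcurl : ∀ k i j, E k i → E k j → ∀ ξ, ‖ξ‖ ≤ σ →
      |fderiv ℝ (d k i) ξ (Pi.single j 1) - fderiv ℝ (d k j) ξ (Pi.single i 1)| ≤
        2 * |K| * D := by
    intro k i j hi hj ξ hξ
    by_cases hij : i = j
    · subst hij
      simp only [sub_self, abs_zero]
      positivity
    have hmem : ξ ∈ Metric.closedBall (0 : Fin m → ℝ) (ρ / 2) :=
      mem_closedBall_zero_iff.2 (hξ.trans hσρ)
    set a : Fin m → κ → ℝ := fun p => fderiv ℝ u ξ (Pi.single p 1) with ha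
    have hak : ∀ p l, a p l = fderiv ℝ (fun ζ => u ζ l) ξ (Pi.single p 1) := by
      intro p l
      have h1 := (hasFDerivAt_pi'.1 (hu.differentiable hinf ξ).hasFDerivAt) l
      rw [h1.fderiv]
      rfl
    have hder : ∀ p q, E k p → fderiv ℝ (d k p) ξ (Pi.single q 1) =
        fderiv ℝ (fderiv ℝ (fun ζ => u ζ k)) ξ (Pi.single q 1) (Pi.single p 1) -
          fderiv ℝ (f k p) (u ξ) (a q) := by
      intro p q hp
      have h1 : d k p = fun ξ => fderiv ℝ (fun ζ => u ζ k) ξ (Pi.single p 1) - f k p (u ξ) := by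
        funext ζ
        simp [hd, hp]
      have h2 : HasFDerivAt (fun ζ => f k p (u ζ)) ((fderiv ℝ (f k p) (u ξ)).comp (fderiv ℝ u ξ)) ξ :=
        ((hf k p).differentiable hinf _).hasFDerivAt.comp ξ (hu.differentiable hinf ξ).hasFDerivAt
      have h3 : HasFDerivAt (fun ξ => fderiv ℝ (fun ζ => u ζ k) ξ (Pi.single p 1))
          ((fderiv ℝ (fderiv ℝ (fun ζ => u ζ k)) ξ).flip (Pi.single p 1)) ξ := by
        have h4 : HasFDerivAt (fderiv ℝ (fun ζ => u ζ k))
            (fderiv ℝ (fderiv ℝ (fun ζ => u ζ k)) ξ) ξ :=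
          (((huk k).fderiv_right (m := ∞) (by simp)).differentiable hinf ξ).hasFDerivAt
        simpa using h4.clm_apply (hasFDerivAt_const (Pi.single p 1 : Fin m → ℝ) ξ)
      rw [h1, (h3.fun_sub h2).fderiv]
      rfl
    have hsymm := (huk k).contDiffAt (x := ξ) |>.isSymmSndFDerivAt (by
      rw [minSmoothness_of_isRCLikeNormedField]
      exact WithTop.coe_le_coe.2 (le_top : (2 : ℕ∞) ≤ ⊤))
    -- Subtracting the defects from the actual derivatives gives vectors that satisfy the equations
    -- exactly, as consistency requires. In the curl the second derivatives cancel by symmetry and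
    -- the consistent parts by `hcons`; what remains is linear in the defects.
    set δ : Fin m → κ → ℝ := fun p l => d l p ξ with hδ
    have hδD : ∀ p, ‖δ p‖ ≤ D := fun p =>
      (pi_norm_le_iff_of_nonneg hD0).2 fun l => hdD l p ξ hξ
    have hgood : ∀ p l, E l p → (a p - δ p) l = f l p (u ξ) := by
      intro p l hl
      simp [hδ, hd, hl, hak]
    have hc := hcons k i j hi hj hij (u ξ) (a i - δ i) (a j - δ j) (hgood i) (hgood j)
    rw [map_sub, map_sub] at hc
    rw [hder i j hi, hder j i hj, hsymm.eq (Pi.single i 1) (Pi.single j 1)]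
    have h5 : ∀ x p q, |fderiv ℝ (f k p) (u ξ) (δ q) * x| ≤ |K| * D * |x| := by
      intro x p q
      rw [abs_mul]
      refine mul_le_mul_of_nonneg_right ?_ (abs_nonneg x)
      exact ((fderiv ℝ (f k p) (u ξ)).le_opNorm _).trans (mul_le_mul
        ((hK k p ξ hmem).trans (le_abs_self K)) (hδD q) (norm_nonneg _) hK0)
    have h6 := h5 1 i j
    have h7 := h5 1 j i
    simp only [mul_one, abs_one] at h6 h7
    rw [abs_le] at h6 h7 ⊢
    constructor <;> linarith
  -- By the differentiated Euler identity the derivative of `t * d k i (ray E k t ξ)` involves only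
  -- the curl. This function vanishes at `t = 0` and equals the defect at `t = 1`.
  have hhalf : ∀ k i ξ, ‖ξ‖ ≤ σ → |d k i ξ| ≤ 1 / 2 * D := by
    intro k i ξ hξ
    by_cases hi : E k i
    swap
    · simp only [hd, hi, if_false, abs_zero]
      positivity
    have hg : ∀ t ∈ Icc (0 : ℝ) 1, HasDerivWithinAt (fun t => t * d k i (ray E k t ξ))
        (∑ j, ray E k t ξ j * (if E k j then fderiv ℝ (d k i) (ray E k t ξ) (Pi.single j 1) -
          fderiv ℝ (d k j) (ray E k t ξ) (Pi.single i 1) else 0)) (Icc (0 : ℝ) 1) t := by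
      intro t ht
      have hn : ‖ray E k t ξ‖ < ρ :=
        lt_of_le_of_lt ((norm_ray_le E k ht ξ).trans (hξ.trans hσρ)) (by linarith)
      have h1 : HasDerivAt (fun t => d k i (ray E k t ξ))
          (fderiv ℝ (d k i) (ray E k t ξ) (evolPart E k ξ)) t :=
        ((hds k i).differentiable hinf _).hasFDerivAt.comp_hasDerivAt t (hasDerivAt_ray E k ξ t)
      have h2 := (hasDerivAt_id t).mul h1
      refine (h2.congr_deriv ?_).hasDerivWithinAt
      have h3 := heuler' k i (ray E k t ξ) hn
      have h4 : t * fderiv ℝ (d k i) (ray E k t ξ) (evolPart E k ξ) =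
          fderiv ℝ (d k i) (ray E k t ξ) (evolPart E k (ray E k t ξ)) := by
        rw [evolPart_ray, map_smul, smul_eq_mul]
      rw [clm_apply_eq_sum _ (evolPart E k (ray E k t ξ))] at h4
      simp only [id, one_mul]
      rw [h4]
      have h5 : d k i (ray E k t ξ) =
          - ∑ j, ray E k t ξ j * fderiv ℝ (d k j) (ray E k t ξ) (Pi.single i 1) := by linarith
      rw [h5, ← Finset.sum_neg_distrib, ← Finset.sum_add_distrib]
      refine Finset.sum_congr rfl fun j _ => ?_
      by_cases hj : E k j
      · simp only [evolPart, hj, if_true]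
        ring
      · have h6 : d k j = fun _ => 0 := by
          funext ζ
          simp [hd, hj]
        simp [evolPart, hj, h6]
    have hbd : ∀ t ∈ Ico (0 : ℝ) 1, ‖∑ j, ray E k t ξ j *
        (if E k j then fderiv ℝ (d k i) (ray E k t ξ) (Pi.single j 1) -
          fderiv ℝ (d k j) (ray E k t ξ) (Pi.single i 1) else 0)‖ ≤ 1 / 2 * D := by
      intro t ht
      have hn : ‖ray E k t ξ‖ ≤ σ := (norm_ray_le E k ⟨ht.1, ht.2.le⟩ ξ).trans hξ
      refine (norm_sum_le _ _).trans ?_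
      have h1 : ∀ j ∈ Finset.univ, ‖ray E k t ξ j *
          (if E k j then fderiv ℝ (d k i) (ray E k t ξ) (Pi.single j 1) -
          fderiv ℝ (d k j) (ray E k t ξ) (Pi.single i 1) else 0)‖ ≤ σ * (2 * |K| * D) := by
        intro j _
        rw [norm_mul]
        refine mul_le_mul ((norm_le_pi_norm _ j).trans hn) ?_ (norm_nonneg _) hσ0.le
        split_ifs with hj
        · exact hcurl k i j hi hj _ hn
        · rw [norm_zero]
          positivity
      refine (Finset.sum_le_sum h1).trans ?_
      rw [Finset.sum_const, Finset.card_univ, Fintype.card_fin, nsmul_eq_mul]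
      calc (m : ℝ) * (σ * (2 * |K| * D)) = m * (σ * (2 * |K|)) * D := by ring
        _ ≤ 1 / 2 * D := mul_le_mul_of_nonneg_right hσK hD0
    have := norm_image_sub_le_of_norm_deriv_le_segment_01' hg hbd
    simpa [ray_one] using this
  have hDz : D = 0 := by
    have h1 : D ≤ 1 / 2 * D := (pi_norm_le_iff_of_nonneg (by positivity)).2 fun p =>
      hhalf p.1 p.2 ξ₀ (mem_closedBall_zero_iff.1 hξ₀)
    linarith
  refine ⟨σ, hσ0, hσρ.trans (by linarith), fun k i hi ξ hξ => ?_⟩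
  have h1 := hdD k i ξ hξ.le
  rw [hDz, abs_nonpos_iff] at h1
  simp only [hd, hi, if_true] at h1
  linarith

/-- Consistent Goursat problems have a smooth solution near the origin. -/
theorem exists_goursat_solution (f : κ → Fin m → (κ → ℝ) → ℝ) (hf : ∀ k i, ContDiff ℝ ∞ (f k i))
    (hfE : ∀ k i, ¬ E k i → f k i = 0)
    (hcons : ∀ k i j, E k i → E k j → i ≠ j → ∀ v a b : κ → ℝ, (∀ l, E l i → a l = f l i v) →
      (∀ l, E l j → b l = f l j v) → fderiv ℝ (f k j) v a = fderiv ℝ (f k i) v b)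
    (U : κ → (Fin m → ℝ) → ℝ) (hU : ∀ k, ContDiff ℝ ∞ (U k)) :
    ∃ ρ : ℝ, 0 < ρ ∧ ∃ u : κ → (Fin m → ℝ) → ℝ, (∀ k, ContDiff ℝ ∞ (u k)) ∧
      (∀ k, HasCompactSupport (u k)) ∧
      (∀ k i, E k i → ∀ ξ, ‖ξ‖ < ρ →
        fderiv ℝ (u k) ξ (Pi.single i 1) = f k i (fun l => u l ξ)) ∧
      ∀ k ξ, ‖ξ‖ < ρ → (∀ i, E k i → ξ i = 0) → u k ξ = U k ξ := by
  obtain ⟨ρ, hρ, u₀, hu₀, heq₀⟩ := exists_radial_solution E (fun i v k => f k i v)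
    (fun i => contDiff_pi.2 fun k => hf k i) U hU
  obtain ⟨u, hu, hsupp, huu⟩ := exists_contDiff_eq_on_ball u₀ hρ hu₀
  have heq : ∀ ξ, ‖ξ‖ < ρ / 2 → ∀ k, u ξ k = U k (ray E k 0 ξ) +
        ∑ i, ∫ t in (0 : ℝ)..1, ξ i * f k i (u (ray E k t ξ)) := by
    intro ξ hξ k
    rw [huu ξ hξ, heq₀ ξ (by rw [mem_ball_zero_iff]; linarith) k]
    congr 1
    refine Finset.sum_congr rfl fun i _ => ?_
    refine intervalIntegral.integral_congr fun t ht => ?_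
    rw [uIcc_of_le zero_le_one] at ht
    simp only [huu _ ((norm_ray_le E k ht ξ).trans_lt hξ)]
  obtain ⟨σ, hσ, hσρ, hall⟩ := equations_of_radial E f hf hfE hcons u hu (half_pos hρ)
    (fun k ξ hξ => radial_derivative E f hf hfE U u hu heq k ξ hξ)
  refine ⟨σ, hσ, fun k ξ => u ξ k, contDiff_pi.1 hu, fun k => ?_, hall, fun k ξ hξ h0 => ?_⟩
  · exact hsupp.comp_left (g := fun v : κ → ℝ => v k) rfl
  · have hr : ∀ t, ray E k t ξ = ξ := by
      intro t
      funext i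
      simp only [ray]
      split_ifs with h
      · rw [h0 i h, mul_zero]
      · rfl
    have hz : ∀ i, ∫ t in (0 : ℝ)..1, ξ i * f k i (u (ray E k t ξ)) = 0 := by
      intro i
      by_cases h : E k i
      · simp [h0 i h]
      · simp [hfE k i h]
    have := heq ξ (hξ.trans_le hσρ) k
    rw [Finset.sum_eq_zero fun i _ => hz i, hr, add_zero] at this
    exact this

end Goursat


/-! ### The first-order system of conjugate nets -/

/-- The scalar unknowns of the first-order system: the components of the position `x`, of the
tangent vectors `∂ⱼ x`, and the rotation coefficients `c k j`. -/
inductive Unknown (m N : ℕ) : Type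
  | pos (a : Fin N) : Unknown m N
  | tan (j : Fin m) (a : Fin N) : Unknown m N
  | rot (k j : Fin m) : Unknown m N

/-- The unknowns as a disjoint union. -/
def Unknown.equivSum (m N : ℕ) : Fin N ⊕ (Fin m × Fin N) ⊕ (Fin m × Fin m) ≃ Unknown m N where
  toFun
    | Sum.inl a => .pos a
    | Sum.inr (Sum.inl p) => .tan p.1 p.2
    | Sum.inr (Sum.inr p) => .rot p.1 p.2
  invFun
    | .pos a => Sum.inl a
    | .tan j a => Sum.inr (Sum.inl (j, a))
    | .rot k j => Sum.inr (Sum.inr (k, j))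
  left_inv := by rintro (_ | _ | _) <;> rfl
  right_inv := by rintro (_ | _ | _) <;> rfl

instance (m N : ℕ) : Fintype (Unknown m N) := Fintype.ofEquiv _ (Unknown.equivSum m N)

/-- Three pairwise distinct directions. -/
abbrev Distinct {m : ℕ} (i j k : Fin m) : Prop := i ≠ j ∧ j ≠ k ∧ k ≠ i

/-- The evolution directions of the unknowns. -/
def evolves {m N : ℕ} : Unknown m N → Fin m → Prop
  | .pos _, _ => True
  | .tan j _, i => i ≠ j
  | .rot k j, i => Distinct i j k

/-- The right-hand sides of the first-order system. -/
def rhs {m N : ℕ} : Unknown m N → Fin m → (Unknown m N → ℝ) → ℝ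
  | .pos a, i => fun v => v (.tan i a)
  | .tan j a, i => fun v =>
      if i = j then 0 else v (.rot j i) * v (.tan i a) + v (.rot i j) * v (.tan j a)
  | .rot k j, i => fun v =>
      if Distinct i j k then
        v (.rot i k) * v (.rot k j) + v (.rot k i) * v (.rot i j) - v (.rot k j) * v (.rot i j)
      else 0

variable {m N : ℕ}

lemma contDiff_rhs (k : Unknown m N) (i : Fin m) : ContDiff ℝ ∞ (rhs k i) := by
  cases k with
  | pos a => exact contDiff_apply ℝ ℝ _
  | tan j a =>
    simp only [rhs]
    split_ifs
    · exact contDiff_const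
    · fun_prop
  | rot k j =>
    simp only [rhs]
    split_ifs
    · fun_prop
    · exact contDiff_const

lemma rhs_eq_zero (k : Unknown m N) (i : Fin m) (h : ¬ evolves k i) : rhs k i = 0 := by
  cases k with
  | pos a => exact absurd trivial h
  | tan j a =>
    have : i = j := not_not.1 h
    funext v
    simp [rhs, this]
  | rot k j =>
    funext v
    exact if_neg h

lemma fderiv_rhs_pos (a : Fin N) (i : Fin m) (v w : Unknown m N → ℝ) :
    fderiv ℝ (rhs (.pos a) i) v w = w (.tan i a) := by
  have : HasFDerivAt (rhs (.pos a) i) _ v := hasFDerivAt_apply (𝕜 := ℝ) (Unknown.tan i a) v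
  rw [this.fderiv]
  rfl

lemma fderiv_rhs_tan (j : Fin m) (a : Fin N) (i : Fin m) (hij : i ≠ j) (v w : Unknown m N → ℝ) :
    fderiv ℝ (rhs (.tan j a) i) v w =
      v (.rot j i) * w (.tan i a) + w (.rot j i) * v (.tan i a) +
      (v (.rot i j) * w (.tan j a) + w (.rot i j) * v (.tan j a)) := by
  have h := fun p => hasFDerivAt_apply (𝕜 := ℝ) (F' := fun _ => ℝ) (p : Unknown m N) v
  have h1 := ((h (.rot j i)).fun_mul (h (.tan i a))).fun_add
    ((h (.rot i j)).fun_mul (h (.tan j a)))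
  have h2 : rhs (.tan j a) i = fun v : Unknown m N → ℝ =>
      v (.rot j i) * v (.tan i a) + v (.rot i j) * v (.tan j a) := by
    simp only [rhs, if_neg hij]
  rw [h2, h1.fderiv]
  simp [mul_comm]

lemma fderiv_rhs_rot (k j i : Fin m) (hd : Distinct i j k) (v w : Unknown m N → ℝ) :
    fderiv ℝ (rhs (.rot k j) i) v w =
      v (.rot i k) * w (.rot k j) + w (.rot i k) * v (.rot k j) +
      (v (.rot k i) * w (.rot i j) + w (.rot k i) * v (.rot i j)) -
      (v (.rot k j) * w (.rot i j) + w (.rot k j) * v (.rot i j)) := by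
  have h := fun p => hasFDerivAt_apply (𝕜 := ℝ) (F' := fun _ => ℝ) (p : Unknown m N) v
  have h1 := (((h (.rot i k)).fun_mul (h (.rot k j))).fun_add
    ((h (.rot k i)).fun_mul (h (.rot i j)))).fun_sub ((h (.rot k j)).fun_mul (h (.rot i j)))
  have h2 : rhs (.rot k j) i = fun v : Unknown m N → ℝ => v (.rot i k) * v (.rot k j) +
      v (.rot k i) * v (.rot i j) - v (.rot k j) * v (.rot i j) := by
    simp only [rhs, if_pos hd]
  rw [h2, h1.fderiv]
  simp [mul_comm]

/-- Every entry of `a` or `b` that enters the two derivatives belongs to an unknown evolving in the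
corresponding direction, so it can be replaced by a polynomial in `v`. Consistency is then a
polynomial identity in each of the three cases. -/
lemma rhs_consistent (k : Unknown m N) (i j : Fin m) (hi : evolves k i) (hj : evolves k j)
    (hij : i ≠ j) (v a b : Unknown m N → ℝ) (ha : ∀ l, evolves l i → a l = rhs l i v)
    (hb : ∀ l, evolves l j → b l = rhs l j v) :
    fderiv ℝ (rhs k j) v a = fderiv ℝ (rhs k i) v b := by
  have hji := hij.symm
  have hat : ∀ p q, i ≠ p → a (.tan p q) =
      v (.rot p i) * v (.tan i q) + v (.rot i p) * v (.tan p q) := fun p q h =>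
    (ha (.tan p q) h).trans (if_neg h)
  have hbt : ∀ p q, j ≠ p → b (.tan p q) =
      v (.rot p j) * v (.tan j q) + v (.rot j p) * v (.tan p q) := fun p q h =>
    (hb (.tan p q) h).trans (if_neg h)
  have har : ∀ p q, Distinct i q p → a (.rot p q) =
      v (.rot i p) * v (.rot p q) + v (.rot p i) * v (.rot i q) - v (.rot p q) * v (.rot i q) :=
    fun p q h => (ha (.rot p q) h).trans (if_pos h)
  have hbr : ∀ p q, Distinct j q p → b (.rot p q) =
      v (.rot j p) * v (.rot p q) + v (.rot p j) * v (.rot j q) - v (.rot p q) * v (.rot j q) :=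
    fun p q h => (hb (.rot p q) h).trans (if_pos h)
  cases k with
  | pos q =>
    rw [fderiv_rhs_pos, fderiv_rhs_pos, hat j q hij, hbt i q hji]
    ring
  | tan l q =>
    have hi' : i ≠ l := hi
    have hj' : j ≠ l := hj
    rw [fderiv_rhs_tan l q j hj', fderiv_rhs_tan l q i hi', hat j q hij, hat l q hi',
      hbt i q hji, hbt l q hj', har l j ⟨hij, hj', hi'.symm⟩, har j l ⟨hi', hj'.symm, hji⟩,
      hbr l i ⟨hji, hi', hj'.symm⟩, hbr i l ⟨hj', hi'.symm, hij⟩]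
    ring
  | rot p l =>
    obtain ⟨h1, h2, h3⟩ := hi
    obtain ⟨h4, -, h6⟩ := hj
    rw [fderiv_rhs_rot p l j ⟨h4, h2, h6⟩, fderiv_rhs_rot p l i ⟨h1, h2, h3⟩,
      har p l ⟨h1, h2, h3⟩, har j p ⟨h3.symm, h6, hji⟩, har p j ⟨hij, h6.symm, h3⟩,
      har j l ⟨h1, h4.symm, hji⟩,
      hbr p l ⟨h4, h2, h6⟩, hbr i p ⟨h6.symm, h3, hij⟩, hbr p i ⟨hji, h3.symm, h6⟩,
      hbr i l ⟨h4, h1.symm, hij⟩]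
    ring

/-- The Goursat data of the first-order system, extended to the whole space. -/
def goursatData (X : Fin m → ℝ → EuclideanSpace ℝ (Fin N)) (C : Fin m → Fin m → ℝ × ℝ → ℝ)
    (i₀ : Fin m) : Unknown m N → (Fin m → ℝ) → ℝ
  | .pos a => fun _ => X i₀ 0 a
  | .tan j a => fun ξ => deriv (X j) (ξ j) a
  | .rot k j => fun ξ => if k = j then 0 else C k j (ξ k, ξ j)

lemma contDiff_goursatData (X : Fin m → ℝ → EuclideanSpace ℝ (Fin N))
    (C : Fin m → Fin m → ℝ × ℝ → ℝ) (hX : ∀ i, ContDiff ℝ ∞ (X i))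
    (hC : ∀ i j, i ≠ j → ContDiff ℝ ∞ (C i j)) (i₀ : Fin m) (k : Unknown m N) :
    ContDiff ℝ ∞ (goursatData X C i₀ k) := by
  cases k with
  | pos a => exact contDiff_const
  | tan j a =>
    have h1 : ContDiff ℝ ∞ (deriv (X j)) := ContDiff.iterate_deriv 1 (hX j)
    have h2 : ContDiff ℝ ∞ fun t => deriv (X j) t a :=
      (EuclideanSpace.proj (𝕜 := ℝ) a).contDiff.comp h1
    exact h2.comp (contDiff_apply ℝ ℝ j)
  | rot k j =>
    simp only [goursatData]
    split_ifs with h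
    · exact contDiff_const
    · exact (hC k j h).comp ((contDiff_apply ℝ ℝ k).prodMk (contDiff_apply ℝ ℝ j))


/-! ### Uniqueness for Goursat problems on a cube -/

section Box

variable {m : ℕ} {r : ℝ}

lemma mem_box {ξ : Fin m → ℝ} : ξ ∈ box m r ↔ ∀ i, 0 ≤ ξ i ∧ ξ i ≤ r :=
  ⟨fun h i => ⟨h.1 i, h.2 i⟩, fun h => ⟨fun i => (h i).1, fun i => (h i).2⟩⟩

lemma isCompact_box : IsCompact (box m r) := isCompact_Icc

lemma convex_box : Convex ℝ (box m r) := convex_Icc _ _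

lemma zero_mem_box (hr : 0 ≤ r) : (0 : Fin m → ℝ) ∈ box m r := mem_box.2 fun _ => ⟨le_rfl, hr⟩

lemma box_mono {s : ℝ} (h : s ≤ r) : box m s ⊆ box m r := fun _ hξ =>
  mem_box.2 fun i => ⟨(mem_box.1 hξ i).1, (mem_box.1 hξ i).2.trans h⟩

lemma uniqueDiffOn_box (hr : 0 < r) : UniqueDiffOn ℝ (box m r) := by
  have : box m r = Set.univ.pi fun _ => Icc (0 : ℝ) r := by
    rw [box, ← pi_univ_Icc]
    rfl
  rw [this]
  exact UniqueDiffOn.univ_pi fun _ => uniqueDiffOn_Icc hr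

lemma single_mem_box (i : Fin m) {t : ℝ} (ht : t ∈ Icc 0 r) : Pi.single i t ∈ box m r := by
  refine mem_box.2 fun j => ?_
  rcases eq_or_ne j i with rfl | h
  · simpa using ht
  · simpa [h] using ht.1.trans ht.2

variable {κ : Type} (E : κ → Fin m → Prop)

lemma ray_mem_box (k : κ) {t : ℝ} (ht : t ∈ Icc (0 : ℝ) 1) {ξ : Fin m → ℝ} (hξ : ξ ∈ box m r) :
    ray E k t ξ ∈ box m r := by
  rw [mem_box] at hξ ⊢
  intro i
  simp only [ray]
  split_ifs
  · exact ⟨mul_nonneg ht.1 (hξ i).1, (mul_le_of_le_one_left (hξ i).1 ht.2).trans (hξ i).2⟩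
  · exact hξ i

end Box

lemma exists_lipschitz_bound {κ : Type} [Fintype κ] {g : (κ → ℝ) → ℝ} (hg : ContDiff ℝ ∞ g)
    (M : ℝ) : ∃ K : ℝ, ∀ v w : κ → ℝ, ‖v‖ ≤ M → ‖w‖ ≤ M → |g v - g w| ≤ K * ‖v - w‖ := by
  obtain ⟨K, hK⟩ := (isCompact_closedBall (0 : κ → ℝ) M).exists_bound_of_continuousOn
    (hg.continuous_fderiv (by simp)).continuousOn
  refine ⟨K, fun v w hv hw => ?_⟩
  exact (convex_closedBall (0 : κ → ℝ) M).norm_image_sub_le_of_norm_fderiv_le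
    (fun x _ => hg.differentiable (by simp) x) hK
    (mem_closedBall_zero_iff.2 hw) (mem_closedBall_zero_iff.2 hv)

/-- The maximum `S` of the difference weighted by `exp (-L * ∑ ξ i)` is estimated by integrating
along rays from the data. The integration gains a factor `1 / L` against the Lipschitz constant `K`,
so `S` is at most half of itself for large `L`, without any smallness of `r`. -/
theorem goursat_unique {m : ℕ} {κ : Type} [Fintype κ] (E : κ → Fin m → Prop)
    (f : κ → Fin m → (κ → ℝ) → ℝ) (hf : ∀ k i, ContDiff ℝ ∞ (f k i)) {r : ℝ} (hr : 0 < r)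
    (u u' : κ → (Fin m → ℝ) → ℝ)
    (hu : ∀ k, DifferentiableOn ℝ (u k) (box m r)) (hu' : ∀ k, DifferentiableOn ℝ (u' k) (box m r))
    (heq : ∀ k i, E k i → ∀ ξ ∈ box m r, partialDeriv r i (u k) ξ = f k i (fun l => u l ξ))
    (heq' : ∀ k i, E k i → ∀ ξ ∈ box m r, partialDeriv r i (u' k) ξ = f k i (fun l => u' l ξ))
    (hdata : ∀ k, ∀ ξ ∈ box m r, (∀ i, E k i → ξ i = 0) → u k ξ = u' k ξ) :
    ∀ k, ∀ ξ ∈ box m r, u k ξ = u' k ξ := by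
  classical
  have hcont : ContinuousOn (fun ξ k => u k ξ) (box m r) :=
    continuousOn_pi.2 fun k => (hu k).continuousOn
  have hcont' : ContinuousOn (fun ξ k => u' k ξ) (box m r) :=
    continuousOn_pi.2 fun k => (hu' k).continuousOn
  obtain ⟨M₁, hM₁⟩ := isCompact_box.exists_bound_of_continuousOn hcont
  obtain ⟨M₂, hM₂⟩ := isCompact_box.exists_bound_of_continuousOn hcont'
  choose K' hK' using fun p : κ × Fin m => exists_lipschitz_bound (hf p.1 p.2) (max M₁ M₂)
  set K := ∑ p, |K' p| with hKdef
  have hK0 : 0 ≤ K := Finset.sum_nonneg fun p _ => abs_nonneg _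
  have hK : ∀ k i, ∀ ξ ∈ box m r, |f k i (fun l => u l ξ) - f k i (fun l => u' l ξ)| ≤
      K * ‖fun l => u l ξ - u' l ξ‖ := fun k i ξ hξ => by
    refine (hK' (k, i) _ _ ((hM₁ ξ hξ).trans (le_max_left _ _))
      ((hM₂ ξ hξ).trans (le_max_right _ _))).trans ?_
    refine mul_le_mul_of_nonneg_right ((le_abs_self _).trans ?_) (norm_nonneg _)
    exact Finset.single_le_sum (f := fun p => |K' p|) (fun p _ => abs_nonneg _)
      (Finset.mem_univ (k, i))
  -- Chosen so that `K / L ≤ 1 / 2`; the added `1` keeps `L` positive when `K = 0`.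
  set L : ℝ := 2 * K + 1 with hL
  have hL0 : 0 < L := by positivity
  have hsum : Continuous fun ξ : Fin m → ℝ => ∑ i, ξ i := by fun_prop
  have hw : ContinuousOn (fun ξ : Fin m → ℝ => Real.exp (-(L * ∑ i, ξ i)) *
      ‖fun l => u l ξ - u' l ξ‖) (box m r) :=
    (Real.continuous_exp.comp (continuous_const.mul hsum).neg).continuousOn.mul
      (hcont.sub hcont').norm
  obtain ⟨ξ₀, hξ₀, hmax⟩ := isCompact_box.exists_isMaxOn ⟨0, zero_mem_box hr.le⟩ hw
  set S := Real.exp (-(L * ∑ i, ξ₀ i)) * ‖fun l => u l ξ₀ - u' l ξ₀‖ with hS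
  have hS0 : 0 ≤ S := by positivity
  have hZ : ∀ ξ ∈ box m r, ‖fun l => u l ξ - u' l ξ‖ ≤ S * Real.exp (L * ∑ i, ξ i) := by
    intro ξ hξ
    have h1 : Real.exp (-(L * ∑ i, ξ i)) * ‖fun l => u l ξ - u' l ξ‖ ≤ S := hmax hξ
    rw [Real.exp_neg, ← div_eq_inv_mul, div_le_iff₀ (Real.exp_pos _)] at h1
    exact h1
  have key : ∀ k, ∀ ξ ∈ box m r,
      |u k ξ - u' k ξ| ≤ K / L * S * Real.exp (L * ∑ i, ξ i) := by
    intro k ξ hξ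
    set q := ∑ i, evolPart E k ξ i with hq
    have hevol : ∀ i, 0 ≤ evolPart E k ξ i := by
      intro i
      simp only [evolPart]
      split_ifs
      · exact (mem_box.1 hξ i).1
      · exact le_rfl
    obtain ⟨A, hσ⟩ : ∃ A, ∀ t, ∑ i, ray E k t ξ i = A + t * q := by
      refine ⟨∑ i, ray E k 0 ξ i, fun t => ?_⟩
      rw [hq, Finset.mul_sum, ← Finset.sum_add_distrib]
      refine Finset.sum_congr rfl fun i _ => ?_
      simp only [ray, evolPart]
      split_ifs <;> ring
    have hder : ∀ t ∈ Icc (0 : ℝ) 1, HasDerivWithinAt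
        (fun t => u k (ray E k t ξ) - u' k (ray E k t ξ))
        (∑ i, evolPart E k ξ i * (f k i (fun l => u l (ray E k t ξ)) -
          f k i (fun l => u' l (ray E k t ξ)))) (Icc (0 : ℝ) 1) t := by
      intro t ht
      have hmem := ray_mem_box E k ht hξ
      have hmaps : MapsTo (fun t => ray E k t ξ) (Icc (0 : ℝ) 1) (box m r) :=
        fun s hs => ray_mem_box E k hs hξ
      have h1 := ((hu k _ hmem).hasFDerivWithinAt.comp_hasDerivWithinAt t
        (hasDerivAt_ray E k ξ t).hasDerivWithinAt hmaps).sub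
        ((hu' k _ hmem).hasFDerivWithinAt.comp_hasDerivWithinAt t
        (hasDerivAt_ray E k ξ t).hasDerivWithinAt hmaps)
      refine h1.congr_deriv ?_
      rw [clm_apply_eq_sum, clm_apply_eq_sum, ← Finset.sum_sub_distrib]
      refine Finset.sum_congr rfl fun i _ => ?_
      by_cases hi : E k i
      · rw [← heq k i hi _ hmem, ← heq' k i hi _ hmem, ← mul_sub]
        rfl
      · simp [evolPart, hi]
    have hB : ∀ t, HasDerivAt (fun t => K / L * S * Real.exp (L * ∑ i, ray E k t ξ i))
        (q * (K * (S * Real.exp (L * ∑ i, ray E k t ξ i)))) t := by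
      intro t
      simp only [hσ]
      have h1 : HasDerivAt (fun t => L * (A + t * q)) (L * q) t := by
        simpa using (((hasDerivAt_id t).mul_const q).const_add A).const_mul L
      refine (h1.exp.const_mul (K / L * S)).congr_deriv ?_
      field_simp
    -- The comparison function grows exactly as fast as the bound on the derivative of the
    -- difference, because `∑ ray E k t ξ i` is affine in `t` with slope `q`.
    have := image_norm_le_of_norm_deriv_right_le_deriv_boundary
      (f := fun t => u k (ray E k t ξ) - u' k (ray E k t ξ))
      (fun t ht => (hder t ht).continuousWithinAt)
      (fun t ht => (hder t ⟨ht.1, ht.2.le⟩).mono_of_mem_nhdsWithin (Icc_mem_nhdsGE_of_mem ht))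
      (a := 0) (b := 1) (B := fun t => K / L * S * Real.exp (L * ∑ i, ray E k t ξ i)) ?_ hB ?_
      (right_mem_Icc.2 zero_le_one)
    · simpa [ray_one] using this
    · have h0 : u k (ray E k 0 ξ) = u' k (ray E k 0 ξ) :=
        hdata k _ (ray_mem_box E k ⟨le_rfl, zero_le_one⟩ hξ) fun i hi => by simp [ray, hi]
      rw [h0, sub_self, norm_zero]
      positivity
    · intro t ht
      have hmem := ray_mem_box E k ⟨ht.1, ht.2.le⟩ hξ
      refine (norm_sum_le _ _).trans ?_
      rw [hq, Finset.sum_mul]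
      refine Finset.sum_le_sum fun i _ => ?_
      rw [norm_mul, Real.norm_of_nonneg (hevol i)]
      refine mul_le_mul_of_nonneg_left ?_ (hevol i)
      exact (hK k i _ hmem).trans (mul_le_mul_of_nonneg_left (hZ _ hmem) hK0)
  have hSz : S = 0 := by
    have h1 : ‖fun l => u l ξ₀ - u' l ξ₀‖ ≤ K / L * S * Real.exp (L * ∑ i, ξ₀ i) :=
      (pi_norm_le_iff_of_nonneg (by positivity)).2 fun k => key k ξ₀ hξ₀
    have h2 : S ≤ K / L * S := by
      rw [hS, Real.exp_neg, ← div_eq_inv_mul, div_le_iff₀ (Real.exp_pos _)]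
      rw [hS, Real.exp_neg, ← div_eq_inv_mul] at h1
      exact h1
    have h3 : K / L ≤ 1 / 2 := by
      rw [div_le_div_iff₀ hL0 two_pos]
      linarith
    nlinarith
  intro k ξ hξ
  have := key k ξ hξ
  rw [hSz, mul_zero, zero_mul, abs_nonpos_iff] at this
  linarith


/-! ### Partial derivatives on a cube -/

section PartialDeriv

variable {m : ℕ} {r : ℝ} {E : Type*} [NormedAddCommGroup E] [NormedSpace ℝ E]

lemma partialDeriv_of_differentiableAt (hr : 0 < r) {i : Fin m} {g : (Fin m → ℝ) → E}
    {ξ : Fin m → ℝ} (hg : DifferentiableAt ℝ g ξ) (hξ : ξ ∈ box m r) :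
    partialDeriv r i g ξ = fderiv ℝ g ξ (Pi.single i 1) := by
  rw [partialDeriv, hg.fderivWithin (uniqueDiffOn_box hr ξ hξ)]

lemma partialDeriv_congr {i : Fin m} {g h : (Fin m → ℝ) → E} (hgh : EqOn g h (box m r))
    {ξ : Fin m → ℝ} (hξ : ξ ∈ box m r) : partialDeriv r i g ξ = partialDeriv r i h ξ := by
  rw [partialDeriv, partialDeriv, fderivWithin_congr hgh (hgh hξ)]

lemma partialDeriv_restrict {s : ℝ} (hs : 0 < s) (hsr : s ≤ r) {i : Fin m} {g : (Fin m → ℝ) → E}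
    {ξ : Fin m → ℝ} (hg : DifferentiableOn ℝ g (box m r)) (hξ : ξ ∈ box m s) :
    partialDeriv s i g ξ = partialDeriv r i g ξ := by
  rw [partialDeriv, partialDeriv, fderivWithin_subset (box_mono hsr) (uniqueDiffOn_box hs ξ hξ)
    (hg ξ (box_mono hsr hξ))]

lemma contDiffOn_partialDeriv (hr : 0 < r) (i : Fin m) {g : (Fin m → ℝ) → E}
    (hg : ContDiffOn ℝ ∞ g (box m r)) : ContDiffOn ℝ ∞ (partialDeriv r i g) (box m r) :=
  (hg.fderivWithin (uniqueDiffOn_box hr) (by simp)).clm_apply contDiffOn_const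

lemma partialDeriv_add (hr : 0 < r) {i : Fin m} {g h : (Fin m → ℝ) → E} {ξ : Fin m → ℝ}
    (hg : DifferentiableOn ℝ g (box m r)) (hh : DifferentiableOn ℝ h (box m r))
    (hξ : ξ ∈ box m r) : partialDeriv r i (fun ζ => g ζ + h ζ) ξ =
      partialDeriv r i g ξ + partialDeriv r i h ξ := by
  rw [partialDeriv, fderivWithin_fun_add (uniqueDiffOn_box hr ξ hξ) (hg ξ hξ) (hh ξ hξ)]
  rfl

lemma partialDeriv_smul (hr : 0 < r) {i : Fin m} {g : (Fin m → ℝ) → ℝ} {h : (Fin m → ℝ) → E}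
    {ξ : Fin m → ℝ} (hg : DifferentiableOn ℝ g (box m r)) (hh : DifferentiableOn ℝ h (box m r))
    (hξ : ξ ∈ box m r) : partialDeriv r i (fun ζ => g ζ • h ζ) ξ =
      g ξ • partialDeriv r i h ξ + partialDeriv r i g ξ • h ξ := by
  rw [partialDeriv, fderivWithin_fun_smul (uniqueDiffOn_box hr ξ hξ) (hg ξ hξ) (hh ξ hξ)]
  rfl

lemma interior_box_nonempty (hr : 0 < r) : (interior (box m r)).Nonempty := by
  have : (Set.univ.pi fun _ : Fin m => Ioo (0 : ℝ) r) ⊆ interior (box m r) :=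
    interior_maximal (fun ξ hξ => mem_box.2 fun i =>
      ⟨(hξ i (mem_univ i)).1.le, (hξ i (mem_univ i)).2.le⟩)
      (isOpen_set_pi finite_univ fun _ _ => isOpen_Ioo)
  exact ⟨fun _ => r / 2, this fun i _ => ⟨by positivity, by linarith⟩⟩

/-- The second derivative within the cube is symmetric also on the faces, since every point of the
cube lies in the closure of the interior. -/
lemma partialDeriv_comm (hr : 0 < r) (i j : Fin m) {g : (Fin m → ℝ) → E}
    (hg : ContDiffOn ℝ ∞ g (box m r)) {ξ : Fin m → ℝ} (hξ : ξ ∈ box m r) :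
    partialDeriv r i (partialDeriv r j g) ξ = partialDeriv r j (partialDeriv r i g) ξ := by
  have hu := uniqueDiffOn_box (m := m) hr
  have h1 : ∀ a b : Fin m, partialDeriv r a (partialDeriv r b g) ξ =
      fderivWithin ℝ (fderivWithin ℝ g (box m r)) (box m r) ξ (Pi.single a 1) (Pi.single b 1) := by
    intro a b
    have h2 : DifferentiableWithinAt ℝ (fderivWithin ℝ g (box m r)) (box m r) ξ :=
      (hg.fderivWithin hu (m := ∞) (by simp)).differentiableOn (by simp) ξ hξ
    have h3 := h2.hasFDerivWithinAt.clm_apply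
      (hasFDerivWithinAt_const (Pi.single b 1 : Fin m → ℝ) ξ (box m r))
    have h4 : partialDeriv r a (partialDeriv r b g) ξ =
      fderivWithin ℝ (fun ζ => fderivWithin ℝ g (box m r) ζ (Pi.single b 1)) (box m r) ξ
        (Pi.single a 1) := rfl
    rw [h4, h3.fderivWithin (hu ξ hξ)]
    simp
  rw [h1, h1]
  have hcl : ξ ∈ closure (interior (box m r)) := by
    rw [convex_box.closure_interior_eq_closure_of_nonempty_interior (interior_box_nonempty hr)]
    exact subset_closure hξ
  exact ((hg ξ hξ).isSymmSndFDerivWithinAt (by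
    rw [minSmoothness_of_isRCLikeNormedField]
    exact WithTop.coe_le_coe.2 (le_top : (2 : ℕ∞) ≤ ⊤)) hu hcl hξ).eq _ _

lemma partialDeriv_apply {N : ℕ} (hr : 0 < r) {i : Fin m}
    {g : (Fin m → ℝ) → EuclideanSpace ℝ (Fin N)} {ξ : Fin m → ℝ}
    (hg : DifferentiableOn ℝ g (box m r)) (hξ : ξ ∈ box m r) (a : Fin N) :
    partialDeriv r i (fun ζ => g ζ a) ξ = partialDeriv r i g ξ a := by
  have h1 : HasFDerivWithinAt (fun ζ => g ζ a) _ (box m r) ξ :=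
    (EuclideanSpace.proj (𝕜 := ℝ) a).hasFDerivAt.comp_hasFDerivWithinAt ξ
      (hg ξ hξ).hasFDerivWithinAt
  rw [partialDeriv, h1.fderivWithin (uniqueDiffOn_box hr ξ hξ)]
  rfl

lemma hasDerivAt_single (j : Fin m) (t : ℝ) :
    HasDerivAt (fun s : ℝ => (Pi.single j s : Fin m → ℝ)) (Pi.single j 1) t := by
  rw [hasDerivAt_pi]
  intro i
  rcases eq_or_ne i j with rfl | h
  · simpa using hasDerivAt_id' t
  · simpa [h] using hasDerivAt_const t (0 : ℝ)

lemma partialDeriv_axis (hr : 0 < r) {g : (Fin m → ℝ) → E}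
    (hg : DifferentiableOn ℝ g (box m r)) {γ : ℝ → E} (hγ : Differentiable ℝ γ) (j : Fin m)
    (h : ∀ t ∈ Icc 0 r, g (Pi.single j t) = γ t) {t : ℝ} (ht : t ∈ Icc 0 r) :
    partialDeriv r j g (Pi.single j t) = deriv γ t := by
  have h1 : HasDerivWithinAt (fun t => g (Pi.single j t)) (partialDeriv r j g (Pi.single j t))
      (Icc 0 r) t :=
    (hg _ (single_mem_box j ht)).hasFDerivWithinAt.comp_hasDerivWithinAt t
      (hasDerivAt_single j t).hasDerivWithinAt fun s hs => single_mem_box j hs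
  have h2 : HasDerivWithinAt (fun t => g (Pi.single j t)) (deriv γ t) (Icc 0 r) t :=
    (hγ t).hasDerivAt.hasDerivWithinAt.congr h (h t ht)
  exact (uniqueDiffOn_Icc hr t ht).eq_deriv _ h1 h2

end PartialDeriv

/-! ### Conjugate nets as solutions of a Goursat problem -/

section Nets

variable {m N : ℕ} {r : ℝ}

/-- The unknowns of the first-order system that belong to a net with rotation coefficients. -/
def netUnknown (r : ℝ) (x : (Fin m → ℝ) → EuclideanSpace ℝ (Fin N))
    (c : Fin m → Fin m → (Fin m → ℝ) → ℝ) : Unknown m N → (Fin m → ℝ) → ℝ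
  | .pos a => fun ξ => x ξ a
  | .tan j a => fun ξ => partialDeriv r j x ξ a
  -- The diagonal coefficients are arbitrary functions; replacing them by zero makes every unknown
  -- smooth.
  | .rot k j => fun ξ => if k = j then 0 else c k j ξ

lemma contDiffOn_netUnknown (hr : 0 < r) {x : (Fin m → ℝ) → EuclideanSpace ℝ (Fin N)}
    {c : Fin m → Fin m → (Fin m → ℝ) → ℝ} (hx : IsConjugateNet r x c) (hc : IsCompatible r c)
    (k : Unknown m N) : ContDiffOn ℝ ∞ (netUnknown r x c k) (box m r) := by
  cases k with
  | pos a => exact (EuclideanSpace.proj (𝕜 := ℝ) a).contDiff.comp_contDiffOn hx.smooth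
  | tan j a =>
    exact (EuclideanSpace.proj (𝕜 := ℝ) a).contDiff.comp_contDiffOn
      (contDiffOn_partialDeriv hr j hx.smooth)
  | rot k j =>
    simp only [netUnknown]
    split_ifs with h
    · exact contDiffOn_const
    · exact hc.smooth k j h

lemma netUnknown_equations (hr : 0 < r) {x : (Fin m → ℝ) → EuclideanSpace ℝ (Fin N)}
    {c : Fin m → Fin m → (Fin m → ℝ) → ℝ} (hx : IsConjugateNet r x c) (hc : IsCompatible r c)
    (k : Unknown m N) (i : Fin m) (hi : evolves k i) (ξ : Fin m → ℝ) (hξ : ξ ∈ box m r) :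
    partialDeriv r i (netUnknown r x c k) ξ = rhs k i (fun l => netUnknown r x c l ξ) := by
  cases k with
  | pos a => exact partialDeriv_apply hr (hx.smooth.differentiableOn (by simp)) hξ a
  | tan j a =>
    have hij : i ≠ j := hi
    have h1 : partialDeriv r i (netUnknown r x c (.tan j a)) ξ =
        partialDeriv r i (partialDeriv r j x) ξ a :=
      partialDeriv_apply hr ((contDiffOn_partialDeriv hr j hx.smooth).differentiableOn (by simp))
        hξ a
    rw [h1, hx.conj i j hij ξ hξ]
    simp [rhs, netUnknown, hij, hij.symm]
  | rot k j =>
    obtain ⟨h1, h2, h3⟩ := hi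
    have h4 : netUnknown (N := N) r x c (.rot k j) = c k j := by
      funext ζ
      simp [netUnknown, h2.symm]
    rw [h4, hc.compat i j k h1 h2 h3 ξ hξ]
    simp [rhs, netUnknown, h1, h2, h3, h2.symm, h3.symm]

lemma eq_single_of_forall {j : Fin m} {ξ : Fin m → ℝ} (h : ∀ i, i ≠ j → ξ i = 0) :
    ξ = Pi.single j (ξ j) := by
  funext i
  rcases eq_or_ne i j with rfl | hij
  · simp
  · simp [hij, h i hij]

lemma netUnknown_data (hr : 0 < r) {X : Fin m → ℝ → EuclideanSpace ℝ (Fin N)}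
    {C : Fin m → Fin m → ℝ × ℝ → ℝ} (hX : ∀ i, ContDiff ℝ ∞ (X i)) (i₀ : Fin m)
    {x : (Fin m → ℝ) → EuclideanSpace ℝ (Fin N)} {c : Fin m → Fin m → (Fin m → ℝ) → ℝ}
    (hx : ContDiffOn ℝ ∞ x (box m r)) (hd : HasData r X C x c) (k : Unknown m N)
    (ξ : Fin m → ℝ) (hξ : ξ ∈ box m r) (h0 : ∀ i, evolves k i → ξ i = 0) :
    netUnknown r x c k ξ = goursatData X C i₀ k ξ := by
  cases k with
  | pos a =>
    have h1 : ξ = Pi.single i₀ 0 := by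
      rw [Pi.single_zero]
      exact funext fun i => h0 i trivial
    simp only [netUnknown, goursatData]
    rw [h1, hd.curves i₀ 0 ⟨le_rfl, hr.le⟩]
  | tan j a =>
    have h1 : ξ = Pi.single j (ξ j) := eq_single_of_forall h0
    simp only [netUnknown, goursatData]
    rw [h1, partialDeriv_axis hr (hx.differentiableOn (by simp))
      ((hX j).differentiable (by simp)) j (hd.curves j) (mem_box.1 hξ j)]
    simp
  | rot k j =>
    simp only [netUnknown, goursatData]
    split_ifs with h
    · rfl
    · exact hd.planes k j h ξ hξ fun i hik hij => h0 i ⟨hij, Ne.symm h, hik.symm⟩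

theorem sameNet_of_compatible (hm : 1 ≤ m) (hr : 0 < r) {X : Fin m → ℝ → EuclideanSpace ℝ (Fin N)}
    {C : Fin m → Fin m → ℝ × ℝ → ℝ} (hX : ∀ i, ContDiff ℝ ∞ (X i))
    {x x' : (Fin m → ℝ) → EuclideanSpace ℝ (Fin N)} {c c' : Fin m → Fin m → (Fin m → ℝ) → ℝ}
    (hx : IsConjugateNet r x c) (hc : IsCompatible r c) (hd : HasData r X C x c)
    (hx' : IsConjugateNet r x' c') (hc' : IsCompatible r c') (hd' : HasData r X C x' c') :
    SameNet r x' x c' c := by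
  have i₀ : Fin m := ⟨0, hm⟩
  have key := goursat_unique evolves rhs contDiff_rhs hr (netUnknown r x' c') (netUnknown r x c)
    (fun k => (contDiffOn_netUnknown hr hx' hc' k).differentiableOn (by simp))
    (fun k => (contDiffOn_netUnknown hr hx hc k).differentiableOn (by simp))
    (netUnknown_equations hr hx' hc') (netUnknown_equations hr hx hc)
    (fun k ξ hξ h0 => (netUnknown_data hr hX i₀ hx'.smooth hd' k ξ hξ h0).trans
      (netUnknown_data hr hX i₀ hx.smooth hd k ξ hξ h0).symm)
  refine ⟨fun ξ hξ => ?_, fun i j hij ξ hξ => ?_⟩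
  · ext a
    exact key (.pos a) ξ hξ
  · simpa [netUnknown, hij] using key (.rot i j) ξ hξ

/-! ### Compatibility from linear independence -/

/-- If the Gram determinant vanishes, so does the squared norm of `⟨v, v⟩ w - ⟨v, w⟩ v`, and this is
a linear relation between `v` and `w`. -/
lemma gram_ne_zero {F : Type*} [NormedAddCommGroup F] [InnerProductSpace ℝ F] {v w : F}
    (h : ∀ a b : ℝ, a • v + b • w = 0 → a = 0 ∧ b = 0) :
    inner ℝ v v * inner ℝ w w - inner ℝ v w * inner ℝ v w ≠ 0 := by
  intro h0
  have h1 : inner ℝ v v • w - inner ℝ v w • v = 0 := by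
    rw [← inner_self_eq_zero (𝕜 := ℝ)]
    simp only [inner_sub_left, inner_sub_right, inner_smul_left, inner_smul_right,
      RCLike.conj_to_real, real_inner_comm v w]
    linear_combination (inner ℝ v v) * h0
  have h2 := (h (-inner ℝ v w) (inner ℝ v v) (by rw [← h1]; module)).2
  rw [inner_self_eq_zero] at h2
  exact one_ne_zero (h 1 0 (by simp [h2])).1

lemma triple_coeff {F : Type*} [AddCommGroup F] [Module ℝ F] {u v w : F}
    (h : LinearIndependent ℝ ![u, v, w]) {a b c : ℝ} (h0 : a • u + b • v + c • w = 0) :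
    a = 0 ∧ b = 0 ∧ c = 0 := by
  rw [Fintype.linearIndependent_iff] at h
  have := h ![a, b, c] (by simpa [Fin.sum_univ_three] using h0)
  exact ⟨this 0, this 1, this 2⟩

/-- The conjugacy equation determines `c i j` by Cramer's rule with the Gram determinant of `∂ᵢ x`
and `∂ⱼ x` as denominator, whence smoothness. Compatibility is the coefficient of `∂ⱼ x` in `∂ᵢ∂ⱼ∂ₖ
x = ∂ⱼ∂ᵢ∂ₖ x`, which can be isolated because the three tangents are independent. -/
lemma isCompatible_of_linearIndependent (hr : 0 < r)
    {X : Fin m → ℝ → EuclideanSpace ℝ (Fin N)} {C : Fin m → Fin m → ℝ × ℝ → ℝ}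
    (hC : ∀ i j, i ≠ j → ContDiff ℝ ∞ (C i j))
    {x : (Fin m → ℝ) → EuclideanSpace ℝ (Fin N)} {c : Fin m → Fin m → (Fin m → ℝ) → ℝ}
    (hx : IsConjugateNet r x c) (hd : HasData r X C x c)
    (hind : ∀ ξ ∈ box m r, ∀ i j k, i ≠ j → j ≠ k → k ≠ i →
      LinearIndependent ℝ ![partialDeriv r i x ξ, partialDeriv r j x ξ, partialDeriv r k x ξ]) :
    IsCompatible r c := by
  have hw : ∀ i, ContDiffOn ℝ ∞ (partialDeriv r i x) (box m r) := fun i =>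
    contDiffOn_partialDeriv hr i hx.smooth
  have hsmooth : ∀ i j, i ≠ j → ContDiffOn ℝ ∞ (c i j) (box m r) := by
    intro i j hij
    by_cases hk : ∃ k, k ≠ i ∧ k ≠ j
    · obtain ⟨k, hki, hkj⟩ := hk
      have hG : ∀ ξ ∈ box m r, inner ℝ (partialDeriv r i x ξ) (partialDeriv r i x ξ) *
          inner ℝ (partialDeriv r j x ξ) (partialDeriv r j x ξ) -
          inner ℝ (partialDeriv r i x ξ) (partialDeriv r j x ξ) *
          inner ℝ (partialDeriv r i x ξ) (partialDeriv r j x ξ) ≠ 0 := fun ξ hξ =>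
        gram_ne_zero fun a b hab => by
          have := triple_coeff (hind ξ hξ i j k hij hkj.symm hki) (a := a) (b := b) (c := 0)
            (by simpa using hab)
          exact ⟨this.1, this.2.1⟩
      have hy := contDiffOn_partialDeriv hr i (hw j)
      have hnum := (((hw i).inner ℝ (hw i)).mul ((hw j).inner ℝ hy)).sub
        (((hw i).inner ℝ (hw j)).mul ((hw i).inner ℝ hy))
      have hden := (((hw i).inner ℝ (hw i)).mul ((hw j).inner ℝ (hw j))).sub
        (((hw i).inner ℝ (hw j)).mul ((hw i).inner ℝ (hw j)))
      refine (hnum.div hden hG).congr fun ξ hξ => ?_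
      rw [Pi.div_apply, eq_div_iff (hG ξ hξ), hx.conj i j hij ξ hξ]
      simp only [inner_add_right, inner_smul_right,
        real_inner_comm (partialDeriv r i x ξ) (partialDeriv r j x ξ)]
      ring
    -- Without a third direction independence gives nothing, but then `(i, j)` is the only
    -- coordinate plane and `c i j` is the given smooth function throughout.
    · push Not at hk
      have h1 : ContDiffOn ℝ ∞ (fun ξ : Fin m → ℝ => C i j (ξ i, ξ j)) (box m r) :=
        ((hC i j hij).comp ((contDiff_apply ℝ ℝ i).prodMk (contDiff_apply ℝ ℝ j))).contDiffOn
      exact h1.congr fun ξ hξ => hd.planes i j hij ξ hξ fun k hki hkj => absurd (hk k hki) hkj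
  refine ⟨hsmooth, fun i j k hij hjk hki ξ hξ => ?_⟩
  have hdo : ∀ {F : Type} [NormedAddCommGroup F] [NormedSpace ℝ F] {g : (Fin m → ℝ) → F},
      ContDiffOn ℝ ∞ g (box m r) → DifferentiableOn ℝ g (box m r) :=
    fun h => h.differentiableOn (by simp)
  have hthird : ∀ p q s, p ≠ q → q ≠ s → s ≠ p →
      partialDeriv r p (partialDeriv r q (partialDeriv r s x)) ξ =
      (c s q ξ • (c q p ξ • partialDeriv r p x ξ + c p q ξ • partialDeriv r q x ξ) +
        partialDeriv r p (c s q) ξ • partialDeriv r q x ξ) +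
      (c q s ξ • (c s p ξ • partialDeriv r p x ξ + c p s ξ • partialDeriv r s x ξ) +
        partialDeriv r p (c q s) ξ • partialDeriv r s x ξ) := by
    intro p q s hpq hqs hsp
    rw [partialDeriv_congr (fun ζ hζ => hx.conj q s hqs ζ hζ) hξ,
      partialDeriv_add hr ((hdo (hsmooth s q hqs.symm)).fun_smul (hdo (hw q)))
        ((hdo (hsmooth q s hqs)).fun_smul (hdo (hw s))) hξ,
      partialDeriv_smul hr (hdo (hsmooth s q hqs.symm)) (hdo (hw q)) hξ,
      partialDeriv_smul hr (hdo (hsmooth q s hqs)) (hdo (hw s)) hξ,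
      hx.conj p q hpq ξ hξ, hx.conj p s hsp.symm ξ hξ]
  have hcomm := partialDeriv_comm hr i j (hw k) hξ
  rw [hthird i j k hij hjk hki, hthird j i k hij.symm hki.symm hjk.symm, ← sub_eq_zero] at hcomm
  have := (triple_coeff (hind ξ hξ i j k hij hjk hki)
    (a := c k j ξ * c j i ξ + c j k ξ * c k i ξ - c k i ξ * c j i ξ - partialDeriv r j (c k i) ξ)
    (b := c k j ξ * c i j ξ + partialDeriv r i (c k j) ξ - c k i ξ * c i j ξ - c i k ξ * c k j ξ)
    (c := c j k ξ * c i k ξ + partialDeriv r i (c j k) ξ -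
      (c i k ξ * c j k ξ + partialDeriv r j (c i k) ξ)) (by
        rw [← hcomm]
        module)).2.1
  linear_combination this

end Nets


/-! ### Uniqueness for regular data without assuming compatibility -/

section Regular

variable {m N : ℕ} {r : ℝ}

lemma IsConjugateNet.restrict {s : ℝ} (hs : 0 < s) (hsr : s ≤ r)
    {x : (Fin m → ℝ) → EuclideanSpace ℝ (Fin N)} {c : Fin m → Fin m → (Fin m → ℝ) → ℝ}
    (hx : IsConjugateNet r x c) : IsConjugateNet s x c := by
  have hr := hs.trans_le hsr
  have h1 : ∀ j, ∀ ξ ∈ box m s, partialDeriv s j x ξ = partialDeriv r j x ξ := fun j ξ hξ =>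
    partialDeriv_restrict hs hsr (hx.smooth.differentiableOn (by simp)) hξ
  refine ⟨hx.smooth.mono (box_mono hsr), fun i j hij ξ hξ => ?_⟩
  rw [partialDeriv_congr (h1 j) hξ, partialDeriv_restrict hs hsr
    ((contDiffOn_partialDeriv hr j hx.smooth).differentiableOn (by simp)) hξ,
    h1 i ξ hξ, h1 j ξ hξ]
  exact hx.conj i j hij ξ (box_mono hsr hξ)

lemma IsCompatible.restrict {s : ℝ} (hs : 0 < s) (hsr : s ≤ r)
    {c : Fin m → Fin m → (Fin m → ℝ) → ℝ} (hc : IsCompatible r c) : IsCompatible s c := by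
  refine ⟨fun i j hij => (hc.smooth i j hij).mono (box_mono hsr),
    fun i j k hij hjk hki ξ hξ => ?_⟩
  rw [partialDeriv_restrict hs hsr ((hc.smooth k j hjk.symm).differentiableOn (by simp)) hξ]
  exact hc.compat i j k hij hjk hki ξ (box_mono hsr hξ)

lemma HasData.restrict {s : ℝ} (hsr : s ≤ r) {X : Fin m → ℝ → EuclideanSpace ℝ (Fin N)}
    {C : Fin m → Fin m → ℝ × ℝ → ℝ} {x : (Fin m → ℝ) → EuclideanSpace ℝ (Fin N)}
    {c : Fin m → Fin m → (Fin m → ℝ) → ℝ} (hd : HasData r X C x c) : HasData s X C x c :=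
  ⟨fun i t ht => hd.curves i t ⟨ht.1, ht.2.trans hsr⟩,
    fun i j hij ξ hξ h => hd.planes i j hij ξ (box_mono hsr hξ) h⟩

lemma isOpen_independent_triples :
    IsOpen {w : Fin m → EuclideanSpace ℝ (Fin N) | ∀ i j k, i ≠ j → j ≠ k → k ≠ i →
      LinearIndependent ℝ ![w i, w j, w k]} := by
  simp only [ofPred_forall]
  refine isOpen_iInter_of_finite fun i => isOpen_iInter_of_finite fun j =>
    isOpen_iInter_of_finite fun k => isOpen_iInter_of_finite fun _ =>
    isOpen_iInter_of_finite fun _ => isOpen_iInter_of_finite fun _ => ?_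
  have h1 : Continuous fun w : Fin m → EuclideanSpace ℝ (Fin N) => ![w i, w j, w k] := by
    refine continuous_pi fun a => ?_
    fin_cases a
    · exact continuous_apply i
    · exact continuous_apply j
    · exact continuous_apply k
  exact (isOpen_setOfPred_linearIndependent (𝕜 := ℝ) (E := EuclideanSpace ℝ (Fin N))
    (ι := Fin 3)).preimage h1

/-- A compact cube has a thickening inside `V`, and cutting off each coordinate at `s` moves the
points of a slightly larger cube by less than its width. -/
lemma exists_box_subset_of_open {s : ℝ} (hs : 0 ≤ s) {V : Set (Fin m → ℝ)} (hV : IsOpen V)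
    (h : box m s ⊆ V) : ∃ δ : ℝ, 0 < δ ∧ ∀ t, t < s + δ → box m t ⊆ V := by
  obtain ⟨δ, hδ, hsub⟩ := isCompact_box.exists_thickening_subset_open hV h
  refine ⟨δ, hδ, fun t ht ξ hξ => hsub ?_⟩
  rw [mem_box] at hξ
  rw [Metric.mem_thickening_iff]
  refine ⟨fun i => min (ξ i) s, mem_box.2 fun i => ⟨le_min (hξ i).1 hs, min_le_right _ _⟩, ?_⟩
  rw [dist_pi_lt_iff hδ]
  intro i
  rw [Real.dist_eq, abs_lt]
  rcases le_total (ξ i) s with h1 | h1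
  · rw [min_eq_left h1, sub_self]
    exact ⟨by linarith, hδ⟩
  · rw [min_eq_right h1]
    have := (hξ i).2
    exact ⟨by linarith, by linarith⟩

/-- On a cube where `x'` agrees with `x` its tangents agree as well and are independent.
Independence is open, so it holds for `x'` on a slightly larger cube; there `c'` is compatible and
uniqueness applies. The sizes of the cubes of agreement form a closed set, so they fill the whole
interval. -/
theorem sameNet_of_linearIndependent (hm : 1 ≤ m) (hr : 0 < r)
    {X : Fin m → ℝ → EuclideanSpace ℝ (Fin N)}
    {C : Fin m → Fin m → ℝ × ℝ → ℝ} (hX : ∀ i, ContDiff ℝ ∞ (X i))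
    (hC : ∀ i j, i ≠ j → ContDiff ℝ ∞ (C i j))
    {x x' : (Fin m → ℝ) → EuclideanSpace ℝ (Fin N)} {c c' : Fin m → Fin m → (Fin m → ℝ) → ℝ}
    (hx : IsConjugateNet r x c) (hc : IsCompatible r c) (hd : HasData r X C x c)
    (hind : ∀ ξ ∈ box m r, ∀ i j k, i ≠ j → j ≠ k → k ≠ i →
      LinearIndependent ℝ ![partialDeriv r i x ξ, partialDeriv r j x ξ, partialDeriv r k x ξ])
    (hx' : IsConjugateNet r x' c') (hd' : HasData r X C x' c') :
    SameNet r x' x c' c := by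
  have hxd : DifferentiableOn ℝ x (box m r) := hx.smooth.differentiableOn (by simp)
  have hxd' : DifferentiableOn ℝ x' (box m r) := hx'.smooth.differentiableOn (by simp)
  have hext : ∀ s, 0 < s → s ≤ r → (∀ ξ ∈ box m s, ∀ i j k, i ≠ j → j ≠ k → k ≠ i →
      LinearIndependent ℝ
        ![partialDeriv r i x' ξ, partialDeriv r j x' ξ, partialDeriv r k x' ξ]) →
      SameNet s x' x c' c := by
    intro s hs hsr hi
    have hc' : IsCompatible s c' := isCompatible_of_linearIndependent hs hC
      (hx'.restrict hs hsr) (hd'.restrict hsr) fun ξ hξ i j k hij hjk hki => by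
        rw [partialDeriv_restrict hs hsr hxd' hξ, partialDeriv_restrict hs hsr hxd' hξ,
          partialDeriv_restrict hs hsr hxd' hξ]
        exact hi ξ hξ i j k hij hjk hki
    exact sameNet_of_compatible hm hs hX (hx.restrict hs hsr) (hc.restrict hs hsr)
      (hd.restrict hsr) (hx'.restrict hs hsr) hc' (hd'.restrict hsr)
  set A : Set ℝ := {s | ∀ ξ ∈ box m s, x' ξ = x ξ} with hA
  have hder : ∀ s ∈ Icc 0 r, s ∈ A → ∀ i, ∀ ξ ∈ box m s,
      partialDeriv r i x' ξ = partialDeriv r i x ξ := by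
    intro s hs hsA i ξ hξ
    -- The cube of size zero is a point and carries no derivatives; at the origin the tangents are
    -- read off from the common curves instead.
    rcases hs.1.eq_or_lt with rfl | hs0
    · have h0 : ξ = Pi.single i 0 := by
        rw [Pi.single_zero]
        funext j
        exact le_antisymm (mem_box.1 hξ j).2 (mem_box.1 hξ j).1
      have hX' := (hX i).differentiable (by simp)
      rw [h0, partialDeriv_axis hr hxd' hX' i (hd'.curves i) ⟨le_rfl, hr.le⟩,
        partialDeriv_axis hr hxd hX' i (hd.curves i) ⟨le_rfl, hr.le⟩]
    · rw [← partialDeriv_restrict hs0 hs.2 hxd' hξ, ← partialDeriv_restrict hs0 hs.2 hxd hξ]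
      exact partialDeriv_congr hsA hξ
  -- Parametrising all cubes by the unit cube exhibits `A` as an intersection of conditions that are
  -- closed in `s`.
  have hmemA : ∀ s ∈ Icc 0 r, s ∈ A ↔ ∀ η ∈ box m 1, x' (s • η) = x (s • η) := by
    intro s hs
    have hsm : ∀ η ∈ box m 1, s • η ∈ box m s := fun η hη => mem_box.2 fun i =>
      ⟨mul_nonneg hs.1 (mem_box.1 hη i).1, mul_le_of_le_one_right hs.1 (mem_box.1 hη i).2⟩
    refine ⟨fun h η hη => h _ (hsm η hη), fun h ξ hξ => ?_⟩
    rcases hs.1.eq_or_lt with rfl | hs0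
    · have h0 : ξ = 0 := funext fun j => le_antisymm (mem_box.1 hξ j).2 (mem_box.1 hξ j).1
      have := h 0 (zero_mem_box zero_le_one)
      rwa [smul_zero, ← h0] at this
    · have := h (s⁻¹ • ξ) (mem_box.2 fun i =>
        ⟨mul_nonneg (inv_nonneg.2 hs.1) (mem_box.1 hξ i).1, by
          rw [Pi.smul_apply, smul_eq_mul, inv_mul_le_iff₀ hs0, mul_one]
          exact (mem_box.1 hξ i).2⟩)
      rwa [smul_smul, mul_inv_cancel₀ hs0.ne', one_smul] at this
  have hclosed : IsClosed (A ∩ Icc 0 r) := by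
    have h1 : A ∩ Icc 0 r = Icc 0 r ∩ ⋂ η ∈ box m 1,
        (Icc 0 r ∩ (fun s : ℝ => x' (s • η) - x (s • η)) ⁻¹' {0}) := by
      ext s
      simp only [mem_inter_iff, mem_iInter, mem_preimage, mem_singleton_iff, sub_eq_zero]
      constructor
      · rintro ⟨h, hs⟩
        exact ⟨hs, fun η hη => ⟨hs, (hmemA s hs).1 h η hη⟩⟩
      · rintro ⟨hs, h⟩
        exact ⟨(hmemA s hs).2 fun η hη => (h η hη).2, hs⟩
    rw [h1]
    refine isClosed_Icc.inter (isClosed_biInter fun η hη => ?_)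
    refine ContinuousOn.preimage_isClosed_of_isClosed ?_ isClosed_Icc isClosed_singleton
    have hmaps : MapsTo (fun s : ℝ => s • η) (Icc 0 r) (box m r) := fun s hs =>
      box_mono hs.2 (mem_box.2 fun i =>
        ⟨mul_nonneg hs.1 (mem_box.1 hη i).1, mul_le_of_le_one_right hs.1 (mem_box.1 hη i).2⟩)
    have hcs : ContinuousOn (fun s : ℝ => s • η) (Icc 0 r) := by fun_prop
    exact (hxd'.continuousOn.comp hcs hmaps).sub (hxd.continuousOn.comp hcs hmaps)
  have h0A : (0 : ℝ) ∈ A := by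
    intro ξ hξ
    have h0 : ξ = Pi.single (⟨0, hm⟩ : Fin m) 0 := by
      rw [Pi.single_zero]
      funext j
      exact le_antisymm (mem_box.1 hξ j).2 (mem_box.1 hξ j).1
    rw [h0, hd.curves _ 0 ⟨le_rfl, hr.le⟩, hd'.curves _ 0 ⟨le_rfl, hr.le⟩]
  have hall : Icc 0 r ⊆ A := by
    refine hclosed.Icc_subset_of_forall_mem_nhdsWithin h0A fun s ⟨hsA, hs⟩ => ?_
    have hsI : s ∈ Icc 0 r := ⟨hs.1, hs.2.le⟩
    have hW : ContinuousOn (fun ξ i => partialDeriv r i x' ξ) (box m r) :=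
      continuousOn_pi.2 fun i => (contDiffOn_partialDeriv hr i hx'.smooth).continuousOn
    obtain ⟨V, hV, hVeq⟩ := continuousOn_iff'.1 hW _ isOpen_independent_triples
    have hbV : box m s ⊆ V := by
      intro ξ hξ
      have hξr := box_mono hs.2.le hξ
      have : ξ ∈ V ∩ box m r := by
        rw [← hVeq]
        refine ⟨fun i j k hij hjk hki => ?_, hξr⟩
        simp only [hder s hsI hsA _ ξ hξ]
        exact hind ξ hξr i j k hij hjk hki
      exact this.1
    obtain ⟨δ, hδ, hδV⟩ := exists_box_subset_of_open hs.1 hV hbV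
    have hmem : Ioo s (min r (s + δ)) ∈ 𝓝[>] s :=
      Ioo_mem_nhdsGT (lt_min hs.2 (by linarith))
    filter_upwards [hmem] with t ht
    have htr : t ≤ r := ht.2.le.trans (min_le_left _ _)
    refine (hext t (hs.1.trans_lt ht.1) htr fun ξ hξ => ?_).1
    have : ξ ∈ V ∩ box m r :=
      ⟨hδV t (ht.2.trans_le (min_le_right _ _)) hξ, box_mono htr hξ⟩
    rw [← hVeq] at this
    exact this.1
  refine hext r hr le_rfl fun ξ hξ i j k hij hjk hki => ?_
  simp only [hder r ⟨hr.le, le_rfl⟩ (hall ⟨hr.le, le_rfl⟩) _ ξ hξ]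
  exact hind ξ hξ i j k hij hjk hki

end Regular

/-! ### The net of a solution of the first-order system -/

section Solution

variable {m N : ℕ}

/-- The position part of a solution of the first-order system. -/
def positionOf {A : Type*} (u : Unknown m N → A → ℝ) (ξ : A) : EuclideanSpace ℝ (Fin N) :=
  WithLp.toLp 2 fun a => u (.pos a) ξ

/-- The tangent vectors in a solution of the first-order system. -/
def tangentOf {A : Type*} (u : Unknown m N → A → ℝ) (j : Fin m) (ξ : A) :
    EuclideanSpace ℝ (Fin N) :=
  WithLp.toLp 2 fun a => u (.tan j a) ξ

variable {ρ r : ℝ} {u : Unknown m N → (Fin m → ℝ) → ℝ}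

lemma norm_lt_of_mem_box (hr : 0 < r) (hrρ : r < ρ) {ξ : Fin m → ℝ} (hξ : ξ ∈ box m r) :
    ‖ξ‖ < ρ := by
  refine lt_of_le_of_lt ((pi_norm_le_iff_of_nonneg hr.le).2 fun i => ?_) hrρ
  rw [Real.norm_of_nonneg (mem_box.1 hξ i).1]
  exact (mem_box.1 hξ i).2

lemma contDiff_positionOf (hu : ∀ k, ContDiff ℝ ∞ (u k)) : ContDiff ℝ ∞ (positionOf u) :=
  (contDiff_euclidean (𝕜 := ℝ)).2 fun a => hu (.pos a)

lemma contDiff_tangentOf (hu : ∀ k, ContDiff ℝ ∞ (u k)) (j : Fin m) :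
    ContDiff ℝ ∞ (tangentOf u j) :=
  (contDiff_euclidean (𝕜 := ℝ)).2 fun a => hu (.tan j a)

lemma partialDeriv_positionOf (hu : ∀ k, ContDiff ℝ ∞ (u k))
    (heq : ∀ k i, evolves k i → ∀ ξ, ‖ξ‖ < ρ →
      fderiv ℝ (u k) ξ (Pi.single i 1) = rhs k i (fun l => u l ξ))
    (hr : 0 < r) (hrρ : r < ρ) (j : Fin m) {ξ : Fin m → ℝ} (hξ : ξ ∈ box m r) :
    partialDeriv r j (positionOf u) ξ = tangentOf u j ξ := by
  ext a
  rw [← partialDeriv_apply hr ((contDiff_positionOf hu).differentiable (by simp)).differentiableOn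
    hξ]
  exact (partialDeriv_of_differentiableAt hr ((hu (.pos a)).differentiable (by simp) ξ) hξ).trans
    (heq (.pos a) j trivial ξ (norm_lt_of_mem_box hr hrρ hξ))

lemma isConjugateNet_positionOf (hu : ∀ k, ContDiff ℝ ∞ (u k))
    (heq : ∀ k i, evolves k i → ∀ ξ, ‖ξ‖ < ρ →
      fderiv ℝ (u k) ξ (Pi.single i 1) = rhs k i (fun l => u l ξ))
    (hr : 0 < r) (hrρ : r < ρ) :
    IsConjugateNet r (positionOf u) fun i j => u (.rot i j) := by
  refine ⟨(contDiff_positionOf hu).contDiffOn, fun i j hij ξ hξ => ?_⟩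
  have h1 : ∀ j, EqOn (partialDeriv r j (positionOf u)) (tangentOf u j) (box m r) := fun j ξ hξ =>
    partialDeriv_positionOf hu heq hr hrρ j hξ
  rw [partialDeriv_congr (h1 j) hξ, h1 i hξ, h1 j hξ]
  ext a
  rw [← partialDeriv_apply hr ((contDiff_tangentOf hu j).differentiable (by simp)).differentiableOn
    hξ]
  refine (partialDeriv_of_differentiableAt hr ((hu (.tan j a)).differentiable (by simp) ξ)
    hξ).trans ((heq (.tan j a) i hij ξ (norm_lt_of_mem_box hr hrρ hξ)).trans ?_)
  simp [rhs, hij, tangentOf]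

lemma isCompatible_of_solution (hu : ∀ k, ContDiff ℝ ∞ (u k))
    (heq : ∀ k i, evolves k i → ∀ ξ, ‖ξ‖ < ρ →
      fderiv ℝ (u k) ξ (Pi.single i 1) = rhs k i (fun l => u l ξ))
    (hr : 0 < r) (hrρ : r < ρ) :
    IsCompatible r fun i j => u (.rot i j) := by
  refine ⟨fun i j _ => (hu _).contDiffOn, fun i j k hij hjk hki ξ hξ => ?_⟩
  rw [partialDeriv_of_differentiableAt hr ((hu _).differentiable (by simp) ξ) hξ,
    heq (.rot k j) i ⟨hij, hjk, hki⟩ ξ (norm_lt_of_mem_box hr hrρ hξ)]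
  exact if_pos ⟨hij, hjk, hki⟩

/-- The Goursat data fix the position only at the origin and the tangent `∂ᵢ x` along the axis. Both
curves have the same derivative and the same starting point. -/
lemma positionOf_axis {X : Fin m → ℝ → EuclideanSpace ℝ (Fin N)} {C : Fin m → Fin m → ℝ × ℝ → ℝ}
    {i₀ : Fin m} (hX : ∀ i, ContDiff ℝ ∞ (X i)) (hX0 : ∀ i j, X i 0 = X j 0)
    (hu : ∀ k, ContDiff ℝ ∞ (u k))
    (heq : ∀ k i, evolves k i → ∀ ξ, ‖ξ‖ < ρ →
      fderiv ℝ (u k) ξ (Pi.single i 1) = rhs k i (fun l => u l ξ))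
    (hdata : ∀ k ξ, ‖ξ‖ < ρ → (∀ i, evolves k i → ξ i = 0) → u k ξ = goursatData X C i₀ k ξ)
    (i : Fin m) {t : ℝ} (ht0 : 0 ≤ t) (htρ : t < ρ) : positionOf u (Pi.single i t) = X i t := by
  have hn : ∀ s : ℝ, s ∈ Icc 0 t → ‖(Pi.single i s : Fin m → ℝ)‖ < ρ := fun s hs => by
    rw [Pi.norm_single, Real.norm_of_nonneg hs.1]
    exact hs.2.trans_lt htρ
  have h1 : ∀ s ∈ Icc 0 t, HasDerivWithinAt (fun s => positionOf u (Pi.single i s) - X i s) 0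
      (Icc 0 t) s := by
    intro s hs
    have h2 : HasDerivAt (fun s => positionOf u (Pi.single i s))
        (fderiv ℝ (positionOf u) (Pi.single i s) (Pi.single i 1)) s :=
      ((contDiff_positionOf hu).differentiable (by simp) _).hasFDerivAt.comp_hasDerivAt s
        (hasDerivAt_single i s)
    have h3 := h2.sub ((hX i).differentiable (by simp) s).hasDerivAt
    refine (h3.congr_deriv ?_).hasDerivWithinAt
    rw [sub_eq_zero]
    ext a
    have h4 : HasFDerivAt (fun ζ => positionOf u ζ a)
        ((EuclideanSpace.proj a).comp (fderiv ℝ (positionOf u) (Pi.single i s))) (Pi.single i s) :=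
      (EuclideanSpace.proj (𝕜 := ℝ) a).hasFDerivAt.comp _
        ((contDiff_positionOf hu).differentiable (by simp) _).hasFDerivAt
    have h5 : fderiv ℝ (u (.pos a)) (Pi.single i s) (Pi.single i 1) =
        fderiv ℝ (positionOf u) (Pi.single i s) (Pi.single i 1) a := by
      have : u (.pos a) = fun ζ => positionOf u ζ a := rfl
      rw [this, h4.fderiv]
      rfl
    rw [← h5, heq (.pos a) i trivial _ (hn s hs)]
    have h6 := hdata (.tan i a) (Pi.single i s) (hn s hs) fun j hj =>
      by simp [show j ≠ i from hj]
    simpa [rhs, goursatData] using h6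
  have h7 := constant_of_has_deriv_right_zero (fun s hs => (h1 s hs).continuousWithinAt)
    (fun s hs => (h1 s ⟨hs.1, hs.2.le⟩).mono_of_mem_nhdsWithin (Icc_mem_nhdsGE_of_mem hs))
    t ⟨ht0, le_rfl⟩
  have h8 : positionOf u (Pi.single i 0) = X i 0 := by
    ext a
    have := hdata (.pos a) (Pi.single i 0) (hn 0 ⟨le_rfl, ht0⟩) fun j _ => by simp
    simpa [goursatData, positionOf, hX0 i i₀] using this
  rw [h8, sub_self, sub_eq_zero] at h7
  exact h7

lemma hasData_of_solution {X : Fin m → ℝ → EuclideanSpace ℝ (Fin N)}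
    {C : Fin m → Fin m → ℝ × ℝ → ℝ} {i₀ : Fin m} (hX : ∀ i, ContDiff ℝ ∞ (X i))
    (hX0 : ∀ i j, X i 0 = X j 0) (hu : ∀ k, ContDiff ℝ ∞ (u k))
    (heq : ∀ k i, evolves k i → ∀ ξ, ‖ξ‖ < ρ →
      fderiv ℝ (u k) ξ (Pi.single i 1) = rhs k i (fun l => u l ξ))
    (hdata : ∀ k ξ, ‖ξ‖ < ρ → (∀ i, evolves k i → ξ i = 0) → u k ξ = goursatData X C i₀ k ξ)
    (hr : 0 < r) (hrρ : r < ρ) :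
    HasData r X C (positionOf u) fun i j => u (.rot i j) := by
  refine ⟨fun i t ht => positionOf_axis hX hX0 hu heq hdata i ht.1 (ht.2.trans_lt hrρ),
    fun i j hij ξ hξ h => ?_⟩
  have := hdata (.rot i j) ξ (norm_lt_of_mem_box hr hrρ hξ) fun l hl => h l hl.2.2.symm hl.1
  simpa [goursatData, hij] using this

end Solution


/-! ### Explicit evolution of discrete rotation coefficients

In the variables `b k j = c k j / (1 + ε c j k)` the discrete compatibility equations become an
explicit evolution. The following functions express it for `p = ε b`. -/

/-- The value of `p k j` after a step in direction `i`, from `p k j`, `p i j`, `p k i`, `p i k`. -/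
def stepRot (pkj pij pki pik : ℝ) : ℝ :=
  (1 + pik) * (pkj + pij * pki) / ((1 - pki * pik) * (1 + pij))

/-- The rotation coefficient `ε c i j` from `p i j` and `p j i`. -/
def coefRot (p q : ℝ) : ℝ := (p + p * q) / (1 - p * q)

section Algebra

variable {pij pji pik pki pjk pkj pil pkl pjl : ℝ}

/-- The numerator is the determinant of the 3 × 3 matrix with ones on the diagonal and the entries
`-p` off it. Its invariance under permutations of `i, j, k` is what makes the compatibility and
consistency identities tractable. -/
lemma one_sub_stepRot_mul (h1 : 1 - pki * pik ≠ 0) (h2 : 1 + pij ≠ 0) (h3 : 1 - pji * pij ≠ 0)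
    (h4 : 1 + pik ≠ 0) :
    1 - stepRot pkj pij pki pik * stepRot pjk pik pji pij =
      (1 - pki * pik - pji * pij - pkj * pjk - pij * pki * pjk - pkj * pik * pji) /
        ((1 - pki * pik) * (1 - pji * pij)) := by
  have h1' : 1 - pik * pki ≠ 0 := by rwa [mul_comm]
  have h3' : 1 - pij * pji ≠ 0 := by rwa [mul_comm]
  unfold stepRot
  field_simp
  ring

lemma one_add_stepRot (h3 : 1 - pji * pij ≠ 0) (h4 : 1 + pik ≠ 0) :
    1 + stepRot pjk pik pji pij =
      (1 + pik + pjk - pij * pji + pij * pjk + pik * pji) / ((1 - pji * pij) * (1 + pik)) := by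
  have h3' : 1 - pij * pji ≠ 0 := by rwa [mul_comm]
  unfold stepRot
  field_simp
  ring

lemma coefRot_stepRot (h1 : 1 - pki * pik ≠ 0) (h2 : 1 + pij ≠ 0) (h3 : 1 - pji * pij ≠ 0)
    (h4 : 1 + pik ≠ 0) :
    coefRot (stepRot pkj pij pki pik) (stepRot pjk pik pji pij) =
      (pkj + pij * pki) * (1 + pik + pjk - pij * pji + pij * pjk + pik * pji) /
        ((1 + pij) *
          (1 - pki * pik - pji * pij - pkj * pjk - pij * pki * pjk - pkj * pik * pji)) := by
  have h1' : 1 - pik * pki ≠ 0 := by rwa [mul_comm]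
  have h3' : 1 - pij * pji ≠ 0 := by rwa [mul_comm]
  have h5 : coefRot (stepRot pkj pij pki pik) (stepRot pjk pik pji pij) =
      stepRot pkj pij pki pik * (1 + stepRot pjk pik pji pij) /
        (1 - stepRot pkj pij pki pik * stepRot pjk pik pji pij) := by
    unfold coefRot
    ring
  rw [h5, one_sub_stepRot_mul h1 h2 h3 h4, one_add_stepRot h3 h4]
  unfold stepRot
  field_simp

/-- Four-dimensional consistency of the evolution. -/
lemma stepRot_consistent (h1 : 1 - pki * pik ≠ 0) (h2 : 1 + pij ≠ 0) (h3 : 1 + pil ≠ 0)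
    (h4 : 1 - pji * pij ≠ 0) (h5 : 1 + pik ≠ 0) (h6 : 1 + pji ≠ 0) (h7 : 1 + pjk ≠ 0)
    (h8 : 1 + pjl ≠ 0) (h9 : 1 - pkj * pjk ≠ 0)
    (k1 : 1 - pki * pik - pji * pij - pkj * pjk - pij * pki * pjk - pkj * pik * pji ≠ 0)
    (k2 : 1 + pil + pjl - pij * pji + pij * pjl + pil * pji ≠ 0) :
    stepRot (stepRot pkl pil pki pik) (stepRot pjl pil pji pij) (stepRot pkj pij pki pik)
      (stepRot pjk pik pji pij) =
    stepRot (stepRot pkl pjl pkj pjk) (stepRot pil pjl pij pji) (stepRot pki pji pkj pjk)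
      (stepRot pik pjk pij pji) := by
  have h1' : 1 - pik * pki ≠ 0 := by rwa [mul_comm]
  have h4' : 1 - pij * pji ≠ 0 := by rwa [mul_comm]
  have h9' : 1 - pjk * pkj ≠ 0 := by rwa [mul_comm]
  have k1' : 1 - pkj * pjk - pij * pji - pki * pik - pji * pkj * pik - pki * pjk * pij ≠ 0 :=
    fun h => k1 (by linarith)
  have k2' : 1 + pjl + pil - pji * pij + pji * pil + pjl * pij ≠ 0 := fun h => k2 (by linarith)
  -- The denominators of the outer step are brought to closed form first, so that only the factors
  -- assumed nonzero have to be cleared.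
  rw [stepRot, one_add_stepRot h4 h5, one_sub_stepRot_mul h1 h2 h4 h5, one_add_stepRot h4 h3]
  rw [stepRot.eq_1 (stepRot pkl pjl pkj pjk), one_add_stepRot h4' h7,
    one_sub_stepRot_mul h9 h6 h4' h7, one_add_stepRot h4' h8]
  unfold stepRot
  field_simp
  ring

/-- The compatibility equations. -/
lemma coefRot_compatible (h1 : 1 - pki * pik ≠ 0) (h2 : 1 + pij ≠ 0)
    (h4 : 1 - pji * pij ≠ 0) (h5 : 1 + pik ≠ 0) (h6 : 1 + pji ≠ 0) (h7 : 1 + pjk ≠ 0)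
    (h9 : 1 - pkj * pjk ≠ 0)
    (k1 : 1 - pki * pik - pji * pij - pkj * pjk - pij * pki * pjk - pkj * pik * pji ≠ 0) :
    coefRot (stepRot pkj pij pki pik) (stepRot pjk pik pji pij) - coefRot pkj pjk =
      coefRot (stepRot pik pjk pij pji) (stepRot pki pji pkj pjk) * coefRot pkj pjk +
      coefRot (stepRot pki pji pkj pjk) (stepRot pik pjk pij pji) * coefRot pij pji -
      coefRot (stepRot pkj pij pki pik) (stepRot pjk pik pji pij) * coefRot pij pji := by
  have h1' : 1 - pik * pki ≠ 0 := by rwa [mul_comm]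
  have h4' : 1 - pij * pji ≠ 0 := by rwa [mul_comm]
  have h9' : 1 - pjk * pkj ≠ 0 := by rwa [mul_comm]
  rw [coefRot_stepRot h1 h2 h4 h5, coefRot_stepRot h4' h7 h9 h6, coefRot_stepRot h9 h6 h4' h7]
  -- The three shifted coefficients share one determinant up to a permutation of the indices. It is
  -- treated as an atom `D` while fractions are cleared and expanded only for the final identity.
  rw [show 1 - pkj * pjk - pij * pji - pki * pik - pji * pkj * pik - pki * pjk * pij =
    1 - pki * pik - pji * pij - pkj * pjk - pij * pki * pjk - pkj * pik * pji by ring]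
  rw [show 1 - pij * pji - pkj * pjk - pik * pki - pjk * pij * pki - pik * pji * pkj =
    1 - pki * pik - pji * pij - pkj * pjk - pij * pki * pjk - pkj * pik * pji by ring]
  obtain ⟨D, hD⟩ : ∃ D, D =
    1 - pki * pik - pji * pij - pkj * pjk - pij * pki * pjk - pkj * pik * pji := ⟨_, rfl⟩
  rw [← hD] at k1 ⊢
  unfold coefRot
  field_simp
  rw [hD]
  ring

end Algebra

section Small

lemma abs_mul_le_of_small {x y a b : ℝ} (hx : |x| ≤ a) (hy : |y| ≤ b) : |x * y| ≤ a * b := by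
  rw [abs_mul]
  exact mul_le_mul hx hy (abs_nonneg _) ((abs_nonneg _).trans hx)

variable {p q s t u v : ℝ}

lemma one_add_ne_zero_of_small (hp : |p| ≤ 1 / 10) : 1 + p ≠ 0 := by
  have := (abs_le.1 hp).1
  intro h
  linarith

lemma one_sub_mul_ne_zero_of_small (hp : |p| ≤ 1 / 10) (hq : |q| ≤ 1 / 10) : 1 - p * q ≠ 0 := by
  have := (abs_le.1 (abs_mul_le_of_small hp hq)).2
  intro h
  linarith

lemma det_ne_zero_of_small (hp : |p| ≤ 1 / 10) (hq : |q| ≤ 1 / 10) (hs : |s| ≤ 1 / 10)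
    (ht : |t| ≤ 1 / 10) (hu : |u| ≤ 1 / 10) (hv : |v| ≤ 1 / 10) :
    1 - p * q - s * t - u * v - t * p * v - u * q * s ≠ 0 := by
  have h1 := (abs_le.1 (abs_mul_le_of_small hp hq)).2
  have h2 := (abs_le.1 (abs_mul_le_of_small hs ht)).2
  have h3 := (abs_le.1 (abs_mul_le_of_small hu hv)).2
  have h4 := (abs_le.1 (abs_mul_le_of_small (abs_mul_le_of_small ht hp) hv)).2
  have h5 := (abs_le.1 (abs_mul_le_of_small (abs_mul_le_of_small hu hq) hs)).2
  intro h
  linarith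

lemma gauge_ne_zero_of_small (hp : |p| ≤ 1 / 10) (hq : |q| ≤ 1 / 10) (hs : |s| ≤ 1 / 10)
    (ht : |t| ≤ 1 / 10) : 1 + p + q - s * t + s * q + p * t ≠ 0 := by
  have h1 := (abs_le.1 (abs_mul_le_of_small hs ht)).2
  have h2 := (abs_le.1 (abs_mul_le_of_small hs hq)).1
  have h3 := (abs_le.1 (abs_mul_le_of_small hp ht)).1
  have := (abs_le.1 hp).1
  have := (abs_le.1 hq).1
  intro h
  linarith

end Small

/-! ### The discrete first-order system -/

section Discrete

variable {m N : ℕ}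

/-- The rotation coefficient `c i j` in the state `v`. -/
def latticeRot (ε : ℝ) (v : Unknown m N → ℝ) (i j : Fin m) : ℝ :=
  ε⁻¹ * coefRot (ε * v (.rot i j)) (ε * v (.rot j i))

/-- One step of the discrete system. -/
def latticeStep (ε : ℝ) : Unknown m N → Fin m → (Unknown m N → ℝ) → ℝ
  | .pos a, i => fun v => v (.pos a) + ε * v (.tan i a)
  | .tan j a, i => fun v => v (.tan j a) +
      ε * (latticeRot ε v j i * v (.tan i a) + latticeRot ε v i j * v (.tan j a))
  | .rot k j, i => fun v =>
      ε⁻¹ * stepRot (ε * v (.rot k j)) (ε * v (.rot i j)) (ε * v (.rot k i)) (ε * v (.rot i k))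

lemma mul_latticeRot {ε : ℝ} (hε : ε ≠ 0) (v : Unknown m N → ℝ) (i j : Fin m) :
    ε * latticeRot ε v i j = coefRot (ε * v (.rot i j)) (ε * v (.rot j i)) := by
  rw [latticeRot, mul_inv_cancel_left₀ hε]

lemma mul_step_rot {ε : ℝ} (hε : ε ≠ 0) {i : Fin m} {v w : Unknown m N → ℝ}
    (hw : ∀ l, evolves l i → w l = latticeStep ε l i v) {k j : Fin m} (hd : Distinct i j k) :
    ε * w (.rot k j) =
      stepRot (ε * v (.rot k j)) (ε * v (.rot i j)) (ε * v (.rot k i)) (ε * v (.rot i k)) := by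
  rw [hw (.rot k j) hd, latticeStep, mul_inv_cancel_left₀ hε]

/-- This is `coefRot_compatible` divided by `ε`. The rotation unknowns needed from `vi` and `vj` all
evolve in the direction concerned, so nothing has to be known about the other entries. -/
lemma latticeRot_compatible {ε : ℝ} (hε : ε ≠ 0) {i j k : Fin m} (hd : Distinct i j k)
    {v vi vj : Unknown m N → ℝ} (hv : ∀ l, |ε * v l| ≤ 1 / 10)
    (hi : ∀ l, evolves l i → vi l = latticeStep ε l i v)
    (hj : ∀ l, evolves l j → vj l = latticeStep ε l j v) :
    latticeRot ε vi k j - latticeRot ε v k j =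
      ε * (latticeRot ε vj i k * latticeRot ε v k j + latticeRot ε vj k i * latticeRot ε v i j -
        latticeRot ε vi k j * latticeRot ε v i j) := by
  obtain ⟨hij, hjk, hki⟩ := hd
  have h := coefRot_compatible (pij := ε * v (.rot i j)) (pji := ε * v (.rot j i))
    (pik := ε * v (.rot i k)) (pki := ε * v (.rot k i)) (pjk := ε * v (.rot j k))
    (pkj := ε * v (.rot k j)) (one_sub_mul_ne_zero_of_small (hv _) (hv _))
    (one_add_ne_zero_of_small (hv _)) (one_sub_mul_ne_zero_of_small (hv _) (hv _))
    (one_add_ne_zero_of_small (hv _)) (one_add_ne_zero_of_small (hv _))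
    (one_add_ne_zero_of_small (hv _)) (one_sub_mul_ne_zero_of_small (hv _) (hv _))
    (det_ne_zero_of_small (hv _) (hv _) (hv _) (hv _) (hv _) (hv _))
  rw [← mul_step_rot hε hi ⟨hij, hjk, hki⟩, ← mul_step_rot hε hi ⟨hki.symm, hjk.symm, hij.symm⟩,
    ← mul_step_rot hε hj ⟨hjk, hki, hij⟩, ← mul_step_rot hε hj ⟨hij.symm, hki.symm, hjk.symm⟩,
    ← mul_latticeRot hε, ← mul_latticeRot hε, ← mul_latticeRot hε, ← mul_latticeRot hε,
    ← mul_latticeRot hε] at h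
  have h2 : ε * (latticeRot ε vi k j - latticeRot ε v k j) =
      ε * (ε * (latticeRot ε vj i k * latticeRot ε v k j +
        latticeRot ε vj k i * latticeRot ε v i j - latticeRot ε vi k j * latticeRot ε v i j)) := by
    linear_combination h
  exact mul_left_cancel₀ hε h2

/-- For tangents this reduces to the compatibility equations of the rotation coefficients, and for
the rotation unknowns to `stepRot_consistent`. -/
lemma latticeStep_consistent {ε : ℝ} (hε : ε ≠ 0) (k : Unknown m N) (i j : Fin m)
    (hi : evolves k i) (hj : evolves k j) (hij : i ≠ j) (v vi vj : Unknown m N → ℝ)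
    (hv : ∀ l, |ε * v l| ≤ 1 / 10)
    (hvi : ∀ l, evolves l i → vi l = latticeStep ε l i v)
    (hvj : ∀ l, evolves l j → vj l = latticeStep ε l j v) :
    latticeStep ε k j vi = latticeStep ε k i vj := by
  have hji := hij.symm
  cases k with
  | pos a =>
    have h1 := hvi (.tan j a) hij
    have h2 := hvj (.tan i a) hji
    have h3 := hvi (.pos a) trivial
    have h4 := hvj (.pos a) trivial
    simp only [latticeStep] at h1 h2 h3 h4 ⊢
    rw [h1, h2, h3, h4]
    ring
  | tan l a =>
    have hil : i ≠ l := hi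
    have hjl : j ≠ l := hj
    have h1 := hvi (.tan j a) hij
    have h2 := hvj (.tan i a) hji
    have h3 := hvi (.tan l a) hil
    have h4 := hvj (.tan l a) hjl
    simp only [latticeStep] at h1 h2 h3 h4 ⊢
    rw [h1, h2, h3, h4]
    have c1 := latticeRot_compatible hε ⟨hji, hil, hjl.symm⟩ hv hvj hvi
    have c2 := latticeRot_compatible hε ⟨hij, hjl, hil.symm⟩ hv hvi hvj
    -- The state shifted in direction `l` is auxiliary: its coefficients enter `c3` and `c4` through
    -- the same expression, which cancels in the difference.
    have c3 := latticeRot_compatible hε (vj := fun k => latticeStep ε k l v)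
      ⟨hil, hjl.symm, hji⟩ hv hvi fun _ _ => rfl
    have c4 := latticeRot_compatible hε (vj := fun k => latticeStep ε k l v)
      ⟨hjl, hil.symm, hij⟩ hv hvj fun _ _ => rfl
    linear_combination (-ε * v (.tan i a)) * c1 + (ε * v (.tan j a)) * c2 +
      (ε * v (.tan l a)) * (c3 - c4)
  | rot k l =>
    obtain ⟨hil, hlk, hki⟩ := hi
    obtain ⟨hjl, -, hkj⟩ := hj
    have h := stepRot_consistent (pij := ε * v (.rot i j)) (pji := ε * v (.rot j i))
      (pik := ε * v (.rot i k)) (pki := ε * v (.rot k i)) (pjk := ε * v (.rot j k))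
      (pkj := ε * v (.rot k j)) (pil := ε * v (.rot i l)) (pkl := ε * v (.rot k l))
      (pjl := ε * v (.rot j l)) (one_sub_mul_ne_zero_of_small (hv _) (hv _))
      (one_add_ne_zero_of_small (hv _)) (one_add_ne_zero_of_small (hv _))
      (one_sub_mul_ne_zero_of_small (hv _) (hv _))
      (one_add_ne_zero_of_small (hv _)) (one_add_ne_zero_of_small (hv _))
      (one_add_ne_zero_of_small (hv _)) (one_add_ne_zero_of_small (hv _))
      (one_sub_mul_ne_zero_of_small (hv _) (hv _))
      (det_ne_zero_of_small (hv _) (hv _) (hv _) (hv _) (hv _) (hv _))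
      (gauge_ne_zero_of_small (hv _) (hv _) (hv _) (hv _))
    rw [← mul_step_rot hε hvi ⟨hil, hlk, hki⟩, ← mul_step_rot hε hvi ⟨hil, hjl.symm, hji⟩,
      ← mul_step_rot hε hvi ⟨hij, hkj.symm, hki⟩, ← mul_step_rot hε hvi ⟨hki.symm, hkj, hji⟩,
      ← mul_step_rot hε hvj ⟨hjl, hlk, hkj⟩, ← mul_step_rot hε hvj ⟨hjl, hil.symm, hij⟩,
      ← mul_step_rot hε hvj ⟨hji, hki.symm, hkj⟩, ← mul_step_rot hε hvj ⟨hkj.symm, hki, hij⟩] at h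
    simp only [latticeStep]
    rw [h]

/-- The first-order correction in `ε` of the discrete system. -/
def latticeCorr (ε : ℝ) : Unknown m N → Fin m → (Unknown m N → ℝ) → ℝ
  | .pos _, _ => fun _ => 0
  | .tan j a, i => fun v =>
      v (.rot j i) * v (.rot i j) * (1 + ε * v (.rot j i)) *
        (1 - ε * v (.rot j i) * (ε * v (.rot i j)))⁻¹ * v (.tan i a) +
      v (.rot i j) * v (.rot j i) * (1 + ε * v (.rot i j)) *
        (1 - ε * v (.rot j i) * (ε * v (.rot i j)))⁻¹ * v (.tan j a)
  | .rot k j, i => fun v =>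
      (v (.rot i k) * v (.rot i j) * v (.rot k i) + v (.rot k j) * v (.rot k i) * v (.rot i k) +
        ε * (v (.rot k j) * v (.rot k i) * v (.rot i k) * v (.rot i j)) -
        (v (.rot i k) * v (.rot k j) + v (.rot k i) * v (.rot i j) - v (.rot k j) * v (.rot i j)) *
        (v (.rot i j) - ε * (v (.rot k i) * v (.rot i k)) -
          ε * ε * (v (.rot k i) * v (.rot i k) * v (.rot i j)))) *
      ((1 - ε * v (.rot k i) * (ε * v (.rot i k)))⁻¹ * (1 + ε * v (.rot i j))⁻¹)

/-- The explicit step is an Euler step of the continuous system with a remainder of order `ε²`. The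
factor `latticeCorr` contains no division by `ε`, so it stays bounded as `ε` tends to zero. -/
lemma latticeStep_eq {ε : ℝ} (hε : ε ≠ 0) (k : Unknown m N) (i : Fin m) (hi : evolves k i)
    (v : Unknown m N → ℝ) (hv : ∀ l, |ε * v l| ≤ 1 / 10) :
    latticeStep ε k i v = v k + ε * (rhs k i v + ε * latticeCorr ε k i v) := by
  cases k with
  | pos a => simp [latticeStep, rhs, latticeCorr]
  | tan j a =>
    have h1 := one_sub_mul_ne_zero_of_small (hv (.rot j i)) (hv (.rot i j))
    have h2 : 1 - ε * v (.rot i j) * (ε * v (.rot j i)) ≠ 0 := by rwa [mul_comm]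
    simp only [latticeStep, rhs, latticeCorr, if_neg (show i ≠ j from hi), latticeRot, coefRot]
    rw [mul_comm (ε * v (.rot i j)) (ε * v (.rot j i))]
    generalize v (.rot i j) = b at *
    generalize v (.rot j i) = b' at *
    obtain ⟨D, hD⟩ : ∃ D, D = 1 - ε * b' * (ε * b) := ⟨_, rfl⟩
    rw [← hD] at h1 ⊢
    field_simp
    rw [hD]
    ring
  | rot k j =>
    have h1 := one_sub_mul_ne_zero_of_small (hv (.rot k i)) (hv (.rot i k))
    have h2 := one_add_ne_zero_of_small (hv (.rot i j))
    simp only [latticeStep, rhs, latticeCorr, if_pos (show Distinct i j k from hi), stepRot]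
    generalize v (.rot i j) = b at *
    generalize v (.rot k i) = b₁ at *
    generalize v (.rot i k) = b₂ at *
    generalize v (.rot k j) = b₃ at *
    obtain ⟨D, hD⟩ : ∃ D, D = 1 - ε * b₁ * (ε * b₂) := ⟨_, rfl⟩
    obtain ⟨D', hD'⟩ : ∃ D, D = 1 + ε * b := ⟨_, rfl⟩
    rw [← hD] at h1 ⊢
    rw [← hD'] at h2 ⊢
    field_simp
    rw [hD, hD']
    ring

/-- The change of variables is inverted exactly, so the discrete coefficients take the prescribed
values and not merely approximations of them. -/
lemma latticeRot_of_data {ε c c' : ℝ} (hε : ε ≠ 0) (h1 : |ε * c| ≤ 1 / 10) (h2 : |ε * c'| ≤ 1 / 10) :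
    ε⁻¹ * coefRot (ε * (c / (1 + ε * c'))) (ε * (c' / (1 + ε * c))) = c := by
  have h3 := one_add_ne_zero_of_small h1
  have h4 := one_add_ne_zero_of_small h2
  have h5 : 1 + ε * c + ε * c' ≠ 0 := by
    have := (abs_le.1 h1).1
    have := (abs_le.1 h2).1
    intro h
    linarith
  have h6 : 1 - ε * (c / (1 + ε * c')) * (ε * (c' / (1 + ε * c))) =
      (1 + ε * c + ε * c') / ((1 + ε * c) * (1 + ε * c')) := by
    field_simp
    ring
  rw [coefRot, h6]
  field_simp

end Discrete


/-! ### Solutions of consistent discrete evolution equations -/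

section Lattice

variable {m : ℕ}

/-- The `ℓ¹`-norm of a lattice point. -/
def degree (n : Fin m → ℕ) : ℕ := ∑ i, n i

lemma degree_shift (i : Fin m) (n : Fin m → ℕ) : degree (shift i n) = degree n + 1 := by
  simp [degree, shift, Finset.sum_add_distrib]

lemma shift_comm (i j : Fin m) (n : Fin m → ℕ) : shift i (shift j n) = shift j (shift i n) := by
  unfold shift
  abel

lemma shift_injective (i : Fin m) : Function.Injective (shift i) :=
  add_left_injective _

lemma shift_apply_self (i : Fin m) (n : Fin m → ℕ) : shift i n i = n i + 1 := by
  simp [shift]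

lemma shift_apply_of_ne {i j : Fin m} (h : j ≠ i) (n : Fin m → ℕ) : shift i n j = n j := by
  simp [shift, h]

lemma exists_eq_shift {i : Fin m} {n : Fin m → ℕ} (h : 0 < n i) : ∃ n', n = shift i n' := by
  refine ⟨n - Pi.single i 1, ?_⟩
  funext j
  by_cases hj : j = i
  · subst hj
    simp [shift]
    omega
  · simp [shift, hj]

open Classical in
/-- A solution of depth `d` of the evolution equations `u k (shift i n) = F k i (u n)`, where `k`
evolves in the directions `i` with `E k i` and takes the values `U k` where it does not evolve. -/
def evolution {κ : Type*} (E : κ → Fin m → Prop) (F : κ → Fin m → (κ → ℝ) → ℝ)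
    (U : κ → (Fin m → ℕ) → ℝ) : ℕ → (Fin m → ℕ) → κ → ℝ
  | 0 => fun n k => U k n
  | d + 1 => fun n k =>
      if h : ∃ p : Fin m × (Fin m → ℕ), E k p.1 ∧ n = shift p.1 p.2 then
        F k h.choose.1 (evolution E F U d h.choose.2)
      else U k n

/-- The recursion reaches each point through one arbitrarily chosen predecessor, and consistency
shows that the choice does not matter. As consistency is available only for states bounded by `M`,
the bound, which grows by `g` per step, is proved in the same induction on the degree. -/
theorem exists_lattice_solution {κ : Type*} (E : κ → Fin m → Prop)
    (F : κ → Fin m → (κ → ℝ) → ℝ) (U : κ → (Fin m → ℕ) → ℝ) (D : ℕ) (M M₀ g : ℝ) (hg : 0 ≤ g)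
    (hF : ∀ k i v, E k i → (∀ l, |v l| ≤ M) → |F k i v| ≤ |v k| + g)
    (hU : ∀ k n, degree n ≤ D → |U k n| ≤ M₀) (hM : M₀ + g * D ≤ M)
    (hcons : ∀ k i j, E k i → E k j → i ≠ j → ∀ v vi vj : κ → ℝ, (∀ l, |v l| ≤ M) →
      (∀ l, E l i → vi l = F l i v) → (∀ l, E l j → vj l = F l j v) → F k j vi = F k i vj) :
    ∃ u : κ → (Fin m → ℕ) → ℝ, (∀ k n, degree n ≤ D → |u k n| ≤ M) ∧
      (∀ k n, (∀ i, E k i → n i = 0) → u k n = U k n) ∧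
      ∀ k i n, E k i → degree n + 1 ≤ D → u k (shift i n) = F k i fun l => u l n := by
  set u : κ → (Fin m → ℕ) → ℝ := fun k n => evolution E F U (degree n) n k with hu
  have hdata : ∀ k n, (∀ i, E k i → n i = 0) → u k n = U k n := by
    intro k n h
    simp only [hu]
    cases degree n with
    | zero => rfl
    | succ d =>
      refine dif_neg ?_
      rintro ⟨⟨i, n'⟩, hi, rfl⟩
      have := h i hi
      rw [shift_apply_self] at this
      omega
  have hstep : ∀ k i n, E k i → ∃ i' n', E k i' ∧ shift i n = shift i' n' ∧
      u k (shift i n) = F k i' fun l => u l n' := by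
    intro k i n hi
    have h : ∃ p : Fin m × (Fin m → ℕ), E k p.1 ∧ shift i n = shift p.1 p.2 := ⟨(i, n), hi, rfl⟩
    refine ⟨h.choose.1, h.choose.2, h.choose_spec.1, h.choose_spec.2, ?_⟩
    have hd : degree h.choose.2 = degree n := by
      have := congrArg degree h.choose_spec.2
      rw [degree_shift, degree_shift] at this
      omega
    simp only [hu, hd]
    rw [degree_shift]
    exact dif_pos h
  have main : ∀ d ≤ D, ∀ n, degree n = d → (∀ k, |u k n| ≤ M₀ + g * d) ∧
      ∀ k i n', E k i → n = shift i n' → u k n = F k i fun l => u l n' := by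
    intro d
    induction d using Nat.strong_induction_on with
    | _ d ih =>
      intro hd n hn
      have hle : ∀ e ≤ D, M₀ + g * e ≤ M := fun e he => by
        have : (e : ℝ) ≤ D := by exact_mod_cast he
        nlinarith
      have heq : ∀ k i n', E k i → n = shift i n' → u k n = F k i fun l => u l n' := by
        rintro k i n' hi rfl
        obtain ⟨i', p, hi', hp, h⟩ := hstep k i n' hi
        rw [degree_shift] at hn
        by_cases hii : i = i'
        · subst hii
          rw [h, shift_injective i hp]
        -- Two predecessors in different directions have a common predecessor `q`, at which
        -- consistency is applied to the two intermediate states.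
        · have h0 : 0 < n' i' := by
            have := congrFun hp i'
            rw [shift_apply_self, shift_apply_of_ne (Ne.symm hii)] at this
            omega
          obtain ⟨q, rfl⟩ := exists_eq_shift h0
          rw [shift_comm] at hp
          have hp := shift_injective _ hp
          subst hp
          rw [degree_shift] at hn
          have hq := ih (degree q) (by omega) (by omega) q rfl
          have hi1 := ih (degree q + 1) (by omega) (by omega) (shift i q) (degree_shift _ _)
          have hi2 := ih (degree q + 1) (by omega) (by omega) (shift i' q) (degree_shift _ _)
          rw [h]
          exact hcons k i i' hi hi' hii (fun l => u l q) _ _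
            (fun l => (hq.1 l).trans (hle _ (by omega)))
            (fun l hl => hi1.2 l i q hl rfl) (fun l hl => hi2.2 l i' q hl rfl)
      refine ⟨fun k => ?_, heq⟩
      by_cases h : ∀ i, E k i → n i = 0
      · rw [hdata k n h]
        have := hU k n (by omega)
        have : 0 ≤ g * d := by positivity
        linarith
      · push Not at h
        obtain ⟨i, hi, h⟩ := h
        obtain ⟨n', rfl⟩ := exists_eq_shift (Nat.pos_of_ne_zero h)
        rw [degree_shift] at hn
        rw [heq k i n' hi rfl]
        have h1 := ih (degree n') (by omega) (by omega) n' rfl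
        have h2 := hF k i (fun l => u l n') hi fun l => (h1.1 l).trans (hle _ (by omega))
        have h3 := h1.1 k
        rw [← hn]
        push_cast
        linarith
  refine ⟨u, fun k n h => ((main _ h n rfl).1 k).trans ?_, hdata, fun k i n hi h =>
    (main (degree n + 1) h _ (degree_shift _ _)).2 k i n hi rfl⟩
  have : (degree n : ℝ) ≤ D := by exact_mod_cast h
  nlinarith

end Lattice


/-! ### Families of lattice functions with uniformly bounded difference quotients -/

section Tame

variable {m : ℕ} {ε₁ ρ : ℝ} {φ u u' a b : ℝ → (Fin m → ℕ) → ℝ} {s ℓ : ℕ}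

/-- The family `u` is bounded by a multiple of `φ` at the lattice points that can be shifted `s`
times within the simplex of size `ρ`. -/
def BoundedBy (ε₁ ρ : ℝ) (φ : ℝ → (Fin m → ℕ) → ℝ) (s : ℕ) (u : ℝ → (Fin m → ℕ) → ℝ) : Prop :=
  ∃ K : ℝ, 0 ≤ K ∧ ∀ ε n, 0 < ε → ε < ε₁ → ε * (degree n + s : ℕ) ≤ ρ → |u ε n| ≤ K * φ ε n

/-- The difference quotients of order less than `ℓ` of the family `u` are bounded, and those of
order `ℓ` are bounded by a multiple of `φ`. -/
def Tame (ε₁ ρ : ℝ) (φ : ℝ → (Fin m → ℕ) → ℝ) : ℕ → ℕ → (ℝ → (Fin m → ℕ) → ℝ) → Prop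
  | 0, s, u => BoundedBy ε₁ ρ φ s u
  | ℓ + 1, s, u => BoundedBy ε₁ ρ (fun _ _ => 1) s u ∧
      ∀ i, Tame ε₁ ρ φ ℓ (s + 1) fun ε => diff ε i (u ε)

lemma diff_add (ε : ℝ) (i : Fin m) (a b : (Fin m → ℕ) → ℝ) (n : Fin m → ℕ) :
    diff ε i (fun n => a n + b n) n = diff ε i a n + diff ε i b n := by
  simp only [diff, smul_eq_mul]
  ring

lemma diff_neg (ε : ℝ) (i : Fin m) (a : (Fin m → ℕ) → ℝ) (n : Fin m → ℕ) :
    diff ε i (fun n => -a n) n = -diff ε i a n := by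
  simp only [diff, smul_eq_mul]
  ring

lemma diff_mul (ε : ℝ) (i : Fin m) (a b : (Fin m → ℕ) → ℝ) (n : Fin m → ℕ) :
    diff ε i (fun n => a n * b n) n = diff ε i a n * b n + a (shift i n) * diff ε i b n := by
  simp only [diff, smul_eq_mul]
  ring

lemma diff_const (ε : ℝ) (i : Fin m) (c : ℝ) (n : Fin m → ℕ) :
    diff ε i (fun _ => c) n = 0 := by
  simp [diff]

lemma domain_of_le {ε : ℝ} {k l : ℕ} (hε : 0 < ε) (h : ε * (l : ℕ) ≤ ρ) (hkl : k ≤ l) :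
    ε * (k : ℕ) ≤ ρ :=
  le_trans (mul_le_mul_of_nonneg_left (by exact_mod_cast hkl) hε.le) h

lemma BoundedBy.congr (h : ∀ ε n, 0 < ε → ε < ε₁ → ε * (degree n + s : ℕ) ≤ ρ → u' ε n = u ε n)
    (hu : BoundedBy ε₁ ρ φ s u) : BoundedBy ε₁ ρ φ s u' := by
  obtain ⟨K, hK, H⟩ := hu
  exact ⟨K, hK, fun ε n h1 h2 h3 => by rw [h ε n h1 h2 h3]; exact H ε n h1 h2 h3⟩

lemma BoundedBy.succ (hu : BoundedBy ε₁ ρ φ s u) : BoundedBy ε₁ ρ φ (s + 1) u := by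
  obtain ⟨K, hK, H⟩ := hu
  exact ⟨K, hK, fun ε n h1 h2 h3 => H ε n h1 h2 (domain_of_le h1 h3 (by omega))⟩

lemma BoundedBy.weight (hφ : ∀ ε n, 1 ≤ φ ε n) (hu : BoundedBy ε₁ ρ (fun _ _ => 1) s u) :
    BoundedBy ε₁ ρ φ s u := by
  obtain ⟨K, hK, H⟩ := hu
  exact ⟨K, hK, fun ε n h1 h2 h3 => (H ε n h1 h2 h3).trans
    (mul_le_mul_of_nonneg_left (hφ ε n) hK)⟩

lemma BoundedBy.add (ha : BoundedBy ε₁ ρ φ s a) (hb : BoundedBy ε₁ ρ φ s b) :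
    BoundedBy ε₁ ρ φ s fun ε n => a ε n + b ε n := by
  obtain ⟨K, hK, H⟩ := ha
  obtain ⟨K', hK', H'⟩ := hb
  refine ⟨K + K', by positivity, fun ε n h1 h2 h3 => ?_⟩
  have := H ε n h1 h2 h3
  have := H' ε n h1 h2 h3
  have := abs_add_le (a ε n) (b ε n)
  linarith

lemma BoundedBy.neg (ha : BoundedBy ε₁ ρ φ s a) : BoundedBy ε₁ ρ φ s fun ε n => -a ε n := by
  obtain ⟨K, hK, H⟩ := ha
  exact ⟨K, hK, fun ε n h1 h2 h3 => by rw [abs_neg]; exact H ε n h1 h2 h3⟩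

lemma BoundedBy.mul (ha : BoundedBy ε₁ ρ (fun _ _ => 1) s a) (hb : BoundedBy ε₁ ρ φ s b) :
    BoundedBy ε₁ ρ φ s fun ε n => a ε n * b ε n := by
  obtain ⟨K, hK, H⟩ := ha
  obtain ⟨K', hK', H'⟩ := hb
  refine ⟨K * K', by positivity, fun ε n h1 h2 h3 => ?_⟩
  have h4 := H ε n h1 h2 h3
  rw [mul_one] at h4
  rw [mul_assoc]
  exact abs_mul_le_of_small h4 (H' ε n h1 h2 h3)

lemma BoundedBy.shifted (i : Fin m) (ha : BoundedBy ε₁ ρ (fun _ _ => 1) s a) :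
    BoundedBy ε₁ ρ (fun _ _ => 1) (s + 1) fun ε n => a ε (shift i n) := by
  obtain ⟨K, hK, H⟩ := ha
  refine ⟨K, hK, fun ε n h1 h2 h3 => H ε (shift i n) h1 h2 ?_⟩
  rw [degree_shift]
  exact domain_of_le h1 h3 (by omega)

lemma boundedBy_const (c : ℝ) : BoundedBy ε₁ ρ (fun _ _ => 1) s fun _ (_ : Fin m → ℕ) => c :=
  ⟨|c|, abs_nonneg c, fun _ _ _ _ _ => by simp⟩

lemma boundedBy_step : BoundedBy ε₁ ρ (fun _ _ => 1) s fun ε (_ : Fin m → ℕ) => ε :=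
  ⟨|ε₁|, abs_nonneg _, fun ε _ h1 h2 _ => by
    rw [mul_one, abs_of_pos h1]
    exact h2.le.trans (le_abs_self _)⟩

lemma Tame.congr (h : ∀ ε n, 0 < ε → ε < ε₁ → ε * (degree n + s : ℕ) ≤ ρ → u' ε n = u ε n)
    (hu : Tame ε₁ ρ φ ℓ s u) : Tame ε₁ ρ φ ℓ s u' := by
  induction ℓ generalizing s u u' with
  | zero => exact BoundedBy.congr h hu
  | succ ℓ ih =>
    refine ⟨hu.1.congr h, fun i => ih (fun ε n h1 h2 h3 => ?_) (hu.2 i)⟩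
    rw [diff, diff, h ε n h1 h2 (domain_of_le h1 h3 (by omega)), h ε (shift i n) h1 h2]
    rw [degree_shift]
    exact domain_of_le h1 h3 (by omega)

lemma Tame.succ (hu : Tame ε₁ ρ φ ℓ s u) : Tame ε₁ ρ φ ℓ (s + 1) u := by
  induction ℓ generalizing s u with
  | zero => exact BoundedBy.succ hu
  | succ ℓ ih => exact ⟨hu.1.succ, fun i => ih (hu.2 i)⟩

lemma Tame.weight (hφ : ∀ ε n, 1 ≤ φ ε n) (hu : Tame ε₁ ρ (fun _ _ => 1) ℓ s u) :
    Tame ε₁ ρ φ ℓ s u := by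
  induction ℓ generalizing s u with
  | zero => exact BoundedBy.weight hφ hu
  | succ ℓ ih => exact ⟨hu.1, fun i => ih (hu.2 i)⟩

lemma Tame.lower (hu : Tame ε₁ ρ φ (ℓ + 1) s u) : Tame ε₁ ρ (fun _ _ => 1) ℓ s u := by
  induction ℓ generalizing s u with
  | zero => exact hu.1
  | succ ℓ ih => exact ⟨hu.1, fun i => ih (hu.2 i)⟩

lemma Tame.bounded (hu : Tame ε₁ ρ (fun _ _ => 1) ℓ s u) :
    BoundedBy ε₁ ρ (fun _ _ => 1) s u := by
  cases ℓ with
  | zero => exact hu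
  | succ ℓ => exact hu.1

lemma Tame.add (ha : Tame ε₁ ρ φ ℓ s a) (hb : Tame ε₁ ρ φ ℓ s b) :
    Tame ε₁ ρ φ ℓ s fun ε n => a ε n + b ε n := by
  induction ℓ generalizing s a b with
  | zero => exact BoundedBy.add ha hb
  | succ ℓ ih =>
    exact ⟨ha.1.add hb.1, fun i => (ih (ha.2 i) (hb.2 i)).congr fun ε n _ _ _ => diff_add ..⟩

lemma Tame.neg (ha : Tame ε₁ ρ φ ℓ s a) : Tame ε₁ ρ φ ℓ s fun ε n => -a ε n := by
  induction ℓ generalizing s a with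
  | zero => exact BoundedBy.neg ha
  | succ ℓ ih => exact ⟨ha.1.neg, fun i => (ih (ha.2 i)).congr fun ε n _ _ _ => diff_neg ..⟩

/-- Only the constant weight is allowed, since a general weight at a shifted point is not comparable
with its value at the original one. -/
lemma Tame.shifted (i : Fin m) (ha : Tame ε₁ ρ (fun _ _ => 1) ℓ s a) :
    Tame ε₁ ρ (fun _ _ => 1) ℓ (s + 1) fun ε n => a ε (shift i n) := by
  induction ℓ generalizing s a with
  | zero => exact BoundedBy.shifted i ha
  | succ ℓ ih =>
    refine ⟨ha.1.shifted i, fun j => (ih (ha.2 j)).congr fun ε n _ _ _ => ?_⟩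
    rw [diff, diff, shift_comm]

lemma tame_zero (hφ : ∀ ε n, 1 ≤ φ ε n) :
    Tame ε₁ ρ φ ℓ s fun _ (_ : Fin m → ℕ) => 0 := by
  induction ℓ generalizing s with
  | zero => exact (boundedBy_const 0).weight hφ
  | succ ℓ ih =>
    exact ⟨boundedBy_const 0, fun i => ih.congr fun ε n _ _ _ => diff_const ..⟩

lemma tame_const (hφ : ∀ ε n, 1 ≤ φ ε n) (c : ℝ) :
    Tame ε₁ ρ φ ℓ s fun _ (_ : Fin m → ℕ) => c := by
  cases ℓ with
  | zero => exact (boundedBy_const c).weight hφ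
  | succ ℓ =>
    exact ⟨boundedBy_const c, fun i => (tame_zero hφ).congr fun ε n _ _ _ => diff_const ..⟩

lemma tame_step (hφ : ∀ ε n, 1 ≤ φ ε n) :
    Tame ε₁ ρ φ ℓ s fun ε (_ : Fin m → ℕ) => ε := by
  cases ℓ with
  | zero => exact boundedBy_step.weight hφ
  | succ ℓ =>
    exact ⟨boundedBy_step, fun i => (tame_zero hφ).congr fun ε n _ _ _ => diff_const ..⟩

/-- By the Leibniz rule the weighted top-order quotients of `b` are multiplied only by values of
`a`, shifted or not, and these are bounded. The terms that differentiate `a` contain lower-order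
quotients of `b` and need no weight. -/
lemma Tame.mul_of_lower (hφ : ∀ ε n, 1 ≤ φ ε n) (ha : Tame ε₁ ρ (fun _ _ => 1) ℓ s a)
    (hb : Tame ε₁ ρ φ ℓ s b) : Tame ε₁ ρ φ ℓ s fun ε n => a ε n * b ε n := by
  have h1 : ∀ (ℓ s : ℕ) (a b : ℝ → (Fin m → ℕ) → ℝ), Tame ε₁ ρ (fun _ _ => 1) ℓ s a →
      Tame ε₁ ρ (fun _ _ => 1) ℓ s b →
      Tame ε₁ ρ (fun _ _ => 1) ℓ s fun ε n => a ε n * b ε n := by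
    intro ℓ
    induction ℓ with
    | zero => exact fun s a b ha hb => BoundedBy.mul ha hb
    | succ ℓ ih =>
      exact fun s a b ha hb => ⟨ha.1.mul hb.1, fun i =>
        ((ih _ _ _ (ha.2 i) hb.lower.succ).add (ih _ _ _ (ha.lower.shifted i) (hb.2 i))).congr
          fun ε n _ _ _ => diff_mul ..⟩
  induction ℓ generalizing s a b with
  | zero => exact BoundedBy.mul ha hb
  | succ ℓ ih =>
    exact ⟨ha.1.mul hb.1, fun i => (((h1 _ _ _ _ (ha.2 i) hb.lower.succ).weight hφ).add
      (ih (ha.lower.shifted i) (hb.2 i))).congr fun ε n _ _ _ => diff_mul ..⟩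

/-- No two top-order quotients are ever multiplied, so the weight enters linearly; this is why the
Gronwall argument closes for a nonlinear system. The separate bound on `a` serves order zero, where
`Tame` gives only the weighted one. -/
lemma Tame.mul (hφ : ∀ ε n, 1 ≤ φ ε n) (ha : Tame ε₁ ρ φ ℓ s a)
    (ha' : BoundedBy ε₁ ρ (fun _ _ => 1) s a) (hb : Tame ε₁ ρ φ ℓ s b) :
    Tame ε₁ ρ φ ℓ s fun ε n => a ε n * b ε n := by
  cases ℓ with
  | zero => exact BoundedBy.mul ha' hb
  | succ ℓ =>
    exact ⟨ha.1.mul hb.1, fun i => (((hb.lower.succ.mul_of_lower hφ (ha.2 i)).congr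
      fun ε n _ _ _ => mul_comm ..).add ((ha.lower.shifted i).mul_of_lower hφ (hb.2 i))).congr
        fun ε n _ _ _ => diff_mul ..⟩

lemma BoundedBy.inv {c : ℝ} (hc : 0 < c)
    (h : ∀ ε n, 0 < ε → ε < ε₁ → ε * (degree n + s : ℕ) ≤ ρ → c ≤ |a ε n|) :
    BoundedBy ε₁ ρ (fun _ _ => 1) s fun ε n => (a ε n)⁻¹ := by
  refine ⟨c⁻¹, by positivity, fun ε n h1 h2 h3 => ?_⟩
  rw [abs_inv, mul_one]
  exact inv_anti₀ hc (h ε n h1 h2 h3)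

/-- The rule `δᵢ (1 / a) = -δᵢ a / (a · τᵢ a)` reduces each order to the unweighted bounds of the
order below, which are therefore established first. -/
lemma Tame.inv (hφ : ∀ ε n, 1 ≤ φ ε n) {c : ℝ} (hc : 0 < c)
    (h : ∀ ε n, 0 < ε → ε < ε₁ → ε * (degree n + s : ℕ) ≤ ρ → c ≤ |a ε n|)
    (ha : Tame ε₁ ρ φ ℓ s a) : Tame ε₁ ρ φ ℓ s fun ε n => (a ε n)⁻¹ := by
  have key : ∀ {ψ : ℝ → (Fin m → ℕ) → ℝ} {ℓ s : ℕ}, (∀ ε n, 1 ≤ ψ ε n) →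
      (∀ ε n, 0 < ε → ε < ε₁ → ε * (degree n + s : ℕ) ≤ ρ → c ≤ |a ε n|) →
      Tame ε₁ ρ ψ (ℓ + 1) s a →
      Tame ε₁ ρ (fun _ _ => 1) ℓ s (fun ε n => (a ε n)⁻¹) →
      Tame ε₁ ρ ψ (ℓ + 1) s fun ε n => (a ε n)⁻¹ := by
    intro ψ ℓ s hψ h ha hi
    refine ⟨BoundedBy.inv hc h, fun i => ((hi.succ.mul_of_lower hψ
      ((hi.shifted i).mul_of_lower hψ (ha.2 i))).neg).congr fun ε n h1 h2 h3 => ?_⟩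
    have h4 : a ε n ≠ 0 :=
      abs_pos.1 (hc.trans_le (h ε n h1 h2 (domain_of_le h1 h3 (by omega))))
    have h5 : a ε (shift i n) ≠ 0 := by
      refine abs_pos.1 (hc.trans_le (h ε _ h1 h2 ?_))
      rw [degree_shift]
      exact domain_of_le h1 h3 (by omega)
    simp only [diff, smul_eq_mul]
    field_simp
    ring
  have h1 : ∀ (ℓ s : ℕ), (∀ ε n, 0 < ε → ε < ε₁ → ε * (degree n + s : ℕ) ≤ ρ → c ≤ |a ε n|) →
      Tame ε₁ ρ (fun _ _ => 1) ℓ s a → Tame ε₁ ρ (fun _ _ => 1) ℓ s fun ε n => (a ε n)⁻¹ := by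
    intro ℓ
    induction ℓ with
    | zero => exact fun s h _ => BoundedBy.inv hc h
    | succ ℓ ih => exact fun s h ha => key (fun _ _ => le_rfl) h ha (ih s h ha.lower)
  cases ℓ with
  | zero => exact (BoundedBy.inv hc h).weight hφ
  | succ ℓ => exact key hφ h ha (h1 ℓ s h ha.lower)

/-- The iterated difference quotient along a list of directions. -/
def listDiff (ε : ℝ) : List (Fin m) → ((Fin m → ℕ) → ℝ) → (Fin m → ℕ) → ℝ
  | [], u => u
  | i :: L, u => listDiff ε L (diff ε i u)

lemma tame_iff : Tame ε₁ ρ φ ℓ s u ↔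
    (∀ L : List (Fin m), L.length < ℓ →
      BoundedBy ε₁ ρ (fun _ _ => 1) (s + L.length) fun ε => listDiff ε L (u ε)) ∧
    ∀ L : List (Fin m), L.length = ℓ →
      BoundedBy ε₁ ρ φ (s + L.length) fun ε => listDiff ε L (u ε) := by
  induction ℓ generalizing s u with
  | zero =>
    refine ⟨fun h => ⟨fun L hL => by omega, fun L hL => ?_⟩, fun h => h.2 [] rfl⟩
    rw [List.length_eq_zero_iff] at hL
    subst hL
    exact h
  | succ ℓ ih =>
    have e : ∀ k : ℕ, s + (k + 1) = s + 1 + k := fun k => by omega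
    constructor
    · rintro ⟨h1, h2⟩
      refine ⟨fun L hL => ?_, fun L hL => ?_⟩
      · cases L with
        | nil => exact h1
        | cons i L =>
          rw [List.length_cons, e]
          exact (ih.1 (h2 i)).1 L (by simpa using hL)
      · cases L with
        | nil => simp at hL
        | cons i L =>
          rw [List.length_cons, e]
          exact (ih.1 (h2 i)).2 L (by simpa using hL)
    · rintro ⟨h1, h2⟩
      refine ⟨h1 [] (by simp), fun i => ih.2 ⟨fun L hL => ?_, fun L hL => ?_⟩⟩
      · have := h1 (i :: L) (by simpa using hL)
        rwa [List.length_cons, e] at this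
      · have := h2 (i :: L) (by simpa using hL)
        rwa [List.length_cons, e] at this

end Tame


/-! ### Regularity of solutions of discrete evolution equations -/

section Regularity

variable {m : ℕ} {ε₁ ρ : ℝ}

lemma BoundedBy.uniform {ι : Type*} [Finite ι] {φ : ℝ → (Fin m → ℕ) → ℝ} (hφ : ∀ ε n, 0 ≤ φ ε n)
    {s : ℕ} {u : ι → ℝ → (Fin m → ℕ) → ℝ} (h : ∀ j, BoundedBy ε₁ ρ φ s (u j)) :
    ∃ K : ℝ, 0 ≤ K ∧ ∀ j ε n, 0 < ε → ε < ε₁ → ε * (degree n + s : ℕ) ≤ ρ →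
      |u j ε n| ≤ K * φ ε n := by
  choose K hK H using h
  have := Fintype.ofFinite ι
  refine ⟨∑ j, K j, Finset.sum_nonneg fun j _ => hK j, fun j ε n h1 h2 h3 =>
    (H j ε n h1 h2 h3).trans (mul_le_mul_of_nonneg_right ?_ (hφ ε n))⟩
  exact Finset.single_le_sum (f := K) (fun j _ => hK j) (Finset.mem_univ j)

lemma diff_comm (ε : ℝ) (i j : Fin m) (u : (Fin m → ℕ) → ℝ) :
    diff ε i (diff ε j u) = diff ε j (diff ε i u) := by
  funext n
  simp only [diff, smul_eq_mul, shift_comm i j]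
  ring

lemma listDiff_diff (ε : ℝ) (i : Fin m) (L : List (Fin m)) (u : (Fin m → ℕ) → ℝ) :
    listDiff ε L (diff ε i u) = diff ε i (listDiff ε L u) := by
  induction L generalizing u with
  | nil => rfl
  | cons j L ih => rw [listDiff, listDiff, diff_comm, ih]

lemma listDiff_perm (ε : ℝ) {L L' : List (Fin m)} (h : L.Perm L') (u : (Fin m → ℕ) → ℝ) :
    listDiff ε L u = listDiff ε L' u := by
  induction h generalizing u with
  | nil => rfl
  | cons i _ ih => exact ih _
  | swap i j L =>
    simp only [listDiff]
    rw [diff_comm]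
  | trans _ _ ih1 ih2 => rw [ih1, ih2]

/-- The set `D d` consists of points from which `d` more shifts are allowed. Closure is required
only for directions in `L`, so agreement on a coordinate subspace suffices when `L` is tangent to
it. -/
lemma listDiff_congr (ε : ℝ) (L : List (Fin m)) {D : ℕ → Set (Fin m → ℕ)}
    (hD : ∀ d, ∀ n ∈ D (d + 1), n ∈ D d ∧ ∀ i ∈ L, shift i n ∈ D d) {u u' : (Fin m → ℕ) → ℝ}
    (h : ∀ n ∈ D 0, u n = u' n) {n : Fin m → ℕ} (hn : n ∈ D L.length) :
    listDiff ε L u n = listDiff ε L u' n := by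
  induction L generalizing u u' D with
  | nil => exact h n hn
  | cons i L ih =>
    refine ih (D := fun d => D (d + 1)) (fun d n hn => ⟨(hD _ n hn).1, fun j hj =>
      (hD _ n hn).2 j (List.mem_cons_of_mem _ hj)⟩) (fun n hn => ?_) hn
    rw [diff, diff, h n (hD 0 n hn).1, h _ ((hD 0 n hn).2 i List.mem_cons_self)]

lemma shift_eq_add_diff {ε : ℝ} (hε : ε ≠ 0) (i : Fin m) (u : (Fin m → ℕ) → ℝ) (n : Fin m → ℕ) :
    u (shift i n) = u n + ε * diff ε i u n := by
  rw [diff, smul_eq_mul, mul_inv_cancel_left₀ hε]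
  ring

variable {κ : Type*} [Fintype κ]

/-- The solutions of a system `δᵢ yₖ = gₖᵢ` have bounded difference quotients of all orders if
their data have and if the right-hand sides inherit bounds from the solutions. -/
theorem tame_of_evolution (E : κ → Fin m → Prop) (y Y : κ → ℝ → (Fin m → ℕ) → ℝ)
    (g : κ → Fin m → ℝ → (Fin m → ℕ) → ℝ)
    (heq : ∀ k i ε n, E k i → 0 < ε → ε < ε₁ → ε * (degree n + 1 : ℕ) ≤ ρ →
      diff ε i (y k ε) n = g k i ε n)
    (hY : ∀ k ℓ, Tame ε₁ ρ (fun _ _ => 1) ℓ 0 (Y k))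
    (hdata : ∀ k ε n, 0 < ε → ε < ε₁ → ε * (degree n : ℕ) ≤ ρ → (∀ i, E k i → n i = 0) →
      y k ε n = Y k ε n)
    (hg : ∀ ℓ φ, (∀ ε n, 1 ≤ φ ε n) → (∀ k, Tame ε₁ ρ φ ℓ 0 (y k)) →
      ∀ k i, E k i → Tame ε₁ ρ φ ℓ 0 (g k i)) (ℓ : ℕ) (k : κ) :
    Tame ε₁ ρ (fun _ _ => 1) ℓ 0 (y k) := by
  classical
  induction ℓ using Nat.strong_induction_on generalizing k with
  | _ ℓ ih =>
  have hlow : ∀ k (L : List (Fin m)), L.length < ℓ →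
      BoundedBy ε₁ ρ (fun _ _ => 1) (0 + L.length) fun ε => listDiff ε L (y k ε) :=
    fun k L hL => (tame_iff.1 (ih L.length hL k)).2 L rfl
  suffices htop : ∃ K : ℝ, 0 ≤ K ∧ ∀ ε n, 0 < ε → ε < ε₁ → ε * (degree n + ℓ : ℕ) ≤ ρ →
      ∀ k (L : List.Vector (Fin m) ℓ), |listDiff ε L.1 (y k ε) n| ≤ K by
    obtain ⟨K, hK, H⟩ := htop
    refine tame_iff.2 ⟨hlow k, fun L hL => ⟨K, hK, fun ε n h1 h2 h3 => ?_⟩⟩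
    rw [mul_one]
    rw [zero_add, hL] at h3
    exact H ε n h1 h2 h3 k ⟨L, hL⟩
  -- The weight is the total size of the order `ℓ` quotients of the solution, so the assumption on
  -- `g` bounds the top-order quotients of `g` linearly by those of `y` at the same point.
  set φ : ℝ → (Fin m → ℕ) → ℝ := fun ε n =>
    1 + ∑ k, ∑ L : List.Vector (Fin m) ℓ, |listDiff ε L.1 (y k ε) n| with hφdef
  have hφ : ∀ ε n, 1 ≤ φ ε n := fun ε n => le_add_of_nonneg_right (by positivity)
  have hy : ∀ k, Tame ε₁ ρ φ ℓ 0 (y k) := by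
    refine fun k => tame_iff.2 ⟨hlow k, fun L hL => ⟨1, zero_le_one, fun ε n h1 h2 h3 => ?_⟩⟩
    have h4 : |listDiff ε L (y k ε) n| ≤
        ∑ L : List.Vector (Fin m) ℓ, |listDiff ε L.1 (y k ε) n| :=
      Finset.single_le_sum (f := fun L : List.Vector (Fin m) ℓ => |listDiff ε L.1 (y k ε) n|)
        (fun _ _ => abs_nonneg _) (Finset.mem_univ ⟨L, hL⟩)
    have h5 := Finset.single_le_sum (f := fun k =>
      ∑ L : List.Vector (Fin m) ℓ, |listDiff ε L.1 (y k ε) n|)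
        (fun _ _ => by positivity) (Finset.mem_univ k)
    simp only [hφdef]
    linarith
  obtain ⟨K, hK, HK⟩ := BoundedBy.uniform (ι := {p : κ × Fin m // E p.1 p.2} ×
    List.Vector (Fin m) ℓ) (s := ℓ) (u := fun p ε => listDiff ε p.2.1 (g p.1.1.1 p.1.1.2 ε))
    (fun ε n => zero_le_one.trans (hφ ε n)) fun p => by
      have := (tame_iff.1 (hg ℓ φ hφ hy p.1.1.1 p.1.1.2 p.1.2)).2 p.2.1 p.2.2
      rwa [zero_add, p.2.2] at this
  -- Quotients containing an evolution direction of their unknown: that direction is moved to the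
  -- front and the equation replaces it by `g`, whose quotients of order `ℓ - 1` are bounded by
  -- induction.
  obtain ⟨K₁, hK₁, HK₁⟩ := BoundedBy.uniform (ε₁ := ε₁) (ρ := ρ) (φ := fun _ _ => 1)
    (ι := {p : κ × List.Vector (Fin m) ℓ // ∃ i ∈ p.2.1, E p.1 i}) (s := ℓ)
    (u := fun p ε => listDiff ε p.1.2.1 (y p.1.1 ε)) (fun ε n => zero_le_one) fun p => by
      obtain ⟨⟨k, L, hL⟩, i, hi, hki⟩ := p
      have hperm := List.perm_cons_erase hi
      have hlen : (L.erase i).length + 1 = ℓ := by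
        rw [← hL, hperm.length_eq, List.length_cons]
      have h1 : Tame ε₁ ρ (fun _ _ => 1) (L.erase i).length 1 fun ε => diff ε i (y k ε) := by
        refine Tame.congr (fun ε n h1 h2 h3 => heq k i ε n hki h1 h2 h3) (Tame.succ ?_)
        exact hg _ _ (fun _ _ => le_rfl) (fun k => ih _ (by omega) k) k i hki
      have h2 := (tame_iff.1 h1).2 (L.erase i) rfl
      rw [add_comm, hlen] at h2
      refine h2.congr fun ε n _ _ _ => ?_
      exact congrFun (listDiff_perm ε hperm (y k ε)) n
  obtain ⟨K₂, hK₂, HK₂⟩ := BoundedBy.uniform (ε₁ := ε₁) (ρ := ρ) (φ := fun _ _ => 1)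
    (ι := κ × List.Vector (Fin m) ℓ) (s := ℓ)
    (u := fun p ε => listDiff ε p.2.1 (Y p.1 ε)) (fun ε n => zero_le_one) fun p => by
      have := (tame_iff.1 (hY p.1 ℓ)).2 p.2.1 p.2.2
      rwa [zero_add, p.2.2] at this
  obtain ⟨c, hc⟩ : ∃ c : ℝ, c = Fintype.card κ * Fintype.card (List.Vector (Fin m) ℓ) := ⟨_, rfl⟩
  have hc0 : 0 ≤ c := by rw [hc]; positivity
  obtain ⟨A, hA⟩ : ∃ A : ℝ, A = 1 + K₁ + K₂ := ⟨_, rfl⟩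
  obtain ⟨B, hB⟩ : ∃ B : ℝ, B = K * (1 + c) := ⟨_, rfl⟩
  have hB0 : 0 ≤ B := by rw [hB]; positivity
  have hA1 : 1 ≤ A := by linarith
  -- Discrete Gronwall estimate for the remaining quotients, none of whose directions is an
  -- evolution direction. On the data subspace they are quotients of the data; elsewhere one step of
  -- the evolution costs a factor `1 + ε * B`. The summand `1` of the weight is absorbed because `A
  -- ≥ 1`.
  have main : ∀ ε, 0 < ε → ε < ε₁ → ∀ d n, degree n = d → ε * (degree n + ℓ : ℕ) ≤ ρ →
      ∀ k (L : List.Vector (Fin m) ℓ), |listDiff ε L.1 (y k ε) n| ≤ A * (1 + ε * B) ^ d := by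
    intro ε h1 h2 d
    have hq1 : 1 ≤ 1 + ε * B := le_add_of_nonneg_right (by positivity)
    have hAq : ∀ d, A ≤ A * (1 + ε * B) ^ d := fun d =>
      le_mul_of_one_le_right (by linarith) (one_le_pow₀ hq1)
    induction d using Nat.strong_induction_on with
    | _ d ihd =>
      intro n hn h3 k L
      by_cases hL : ∃ i ∈ L.1, E k i
      · refine (HK₁ ⟨(k, L), hL⟩ ε n h1 h2 h3).trans (le_trans ?_ (hAq _))
        linarith
      push Not at hL
      by_cases hE : ∀ i, E k i → n i = 0
      · have h4 : listDiff ε L.1 (y k ε) n = listDiff ε L.1 (Y k ε) n := by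
          refine listDiff_congr ε L.1
            (D := fun d => {n | ε * (degree n + d : ℕ) ≤ ρ ∧ ∀ i, E k i → n i = 0})
            (fun d n hn => ⟨⟨domain_of_le h1 hn.1 (by omega), hn.2⟩, fun i hi => ⟨?_, ?_⟩⟩)
            (fun n hn => hdata k ε n h1 h2 hn.1 hn.2) ⟨by rwa [L.2], hE⟩
          · rw [degree_shift]
            exact domain_of_le h1 hn.1 (by omega)
          · intro j hj
            have hij : j ≠ i := by
              rintro rfl
              exact hL j hi hj
            rw [shift_apply_of_ne hij]
            exact hn.2 j hj
        rw [h4]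
        refine (HK₂ (k, L) ε n h1 h2 h3).trans (le_trans ?_ (hAq _))
        linarith
      push Not at hE
      obtain ⟨i, hi, h0⟩ := hE
      obtain ⟨n', rfl⟩ := exists_eq_shift (Nat.pos_of_ne_zero h0)
      rw [degree_shift] at hn h3
      subst hn
      have h3' : ε * (degree n' + ℓ : ℕ) ≤ ρ := domain_of_le h1 h3 (by omega)
      have h4 : diff ε i (listDiff ε L.1 (y k ε)) n' = listDiff ε L.1 (g k i ε) n' := by
        rw [← listDiff_diff]
        refine listDiff_congr ε L.1 (D := fun d => {n | ε * (degree n + 1 + d : ℕ) ≤ ρ})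
          (fun d n hn => ⟨domain_of_le h1 hn (by omega), fun i hi => ?_⟩)
          (fun n hn => heq k i ε n hi h1 h2 hn) ?_
        · rw [Set.mem_ofPred_eq, degree_shift]
          exact domain_of_le h1 hn (by omega)
        · rw [Set.mem_ofPred_eq, L.2]
          exact h3
      have h5 := HK (⟨(k, i), hi⟩, L) ε n' h1 h2 h3'
      have h6 : φ ε n' ≤ 1 + c * (A * (1 + ε * B) ^ degree n') := by
        have : ∑ k, ∑ L : List.Vector (Fin m) ℓ, |listDiff ε L.1 (y k ε) n'| ≤
            ∑ k : κ, ∑ L : List.Vector (Fin m) ℓ, A * (1 + ε * B) ^ degree n' :=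
          Finset.sum_le_sum fun k _ => Finset.sum_le_sum fun L _ => ihd _ (Nat.lt_succ_self _) n' rfl h3' k L
        rw [Finset.sum_const, Finset.sum_const, Finset.card_univ, Finset.card_univ,
          nsmul_eq_mul, nsmul_eq_mul, ← mul_assoc, ← hc] at this
        simp only [hφdef]
        linarith
      rw [shift_eq_add_diff h1.ne' i (listDiff ε L.1 (y k ε)), h4]
      have h7 := ihd _ (Nat.lt_succ_self _) n' rfl h3' k L
      have h8 := abs_add_le (listDiff ε L.1 (y k ε) n') (ε * listDiff ε L.1 (g k i ε) n')
      rw [abs_mul, abs_of_pos h1] at h8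
      have h9 : ε * |listDiff ε L.1 (g k i ε) n'| ≤
          ε * (K * (1 + c * (A * (1 + ε * B) ^ degree n'))) :=
        mul_le_mul_of_nonneg_left (h5.trans (mul_le_mul_of_nonneg_left h6 hK)) h1.le
      have h10 : ε * K * 1 ≤ ε * K * (A * (1 + ε * B) ^ degree n') :=
        mul_le_mul_of_nonneg_left (hA1.trans (hAq _)) (by positivity)
      rw [pow_succ]
      have h11 : A * ((1 + ε * B) ^ degree n' * (1 + ε * B)) = A * (1 + ε * B) ^ degree n' +
          ε * K * (A * (1 + ε * B) ^ degree n') + ε * K * c * (A * (1 + ε * B) ^ degree n') := by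
        nth_rw 2 [hB]
        ring
      rw [h11]
      linarith
  refine ⟨A * Real.exp (B * ρ), by positivity, fun ε n h1 h2 h3 k L =>
    (main ε h1 h2 _ n rfl h3 k L).trans (mul_le_mul_of_nonneg_left ?_ (by linarith))⟩
  -- The number of steps is at most `ρ / ε`, so the accumulated factor is bounded independently of
  -- `ε`.
  have h4 : (1 + ε * B) ^ degree n ≤ Real.exp (ε * B) ^ degree n := by
    refine pow_le_pow_left₀ (by positivity) ?_ _
    have := Real.add_one_le_exp (ε * B)
    linarith
  refine h4.trans ?_
  rw [← Real.exp_nat_mul]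
  refine Real.exp_le_exp.2 ?_
  have h5 : ε * (degree n : ℕ) ≤ ρ := domain_of_le h1 h3 (by omega)
  calc (degree n : ℝ) * (ε * B) = B * (ε * degree n) := by ring
    _ ≤ B * ρ := mul_le_mul_of_nonneg_left h5 hB0

end Regularity


/-! ### Lattice restrictions of smooth functions -/

section Restriction

variable {m : ℕ} {ε₁ ρ : ℝ}

/-- The partial derivative of a function on the whole space. -/
def dirDeriv (i : Fin m) (f : (Fin m → ℝ) → ℝ) (ξ : Fin m → ℝ) : ℝ :=
  fderiv ℝ f ξ (Pi.single i 1)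

/-- The iterated partial derivative along a list of directions. -/
def listDeriv : List (Fin m) → ((Fin m → ℝ) → ℝ) → (Fin m → ℝ) → ℝ
  | [], f => f
  | i :: L, f => listDeriv L (dirDeriv i f)

/-- The difference quotient of a function on the whole space. -/
def slopeAlong (ε : ℝ) (i : Fin m) (f : (Fin m → ℝ) → ℝ) (ξ : Fin m → ℝ) : ℝ :=
  ε⁻¹ * (f (ξ + Pi.single i ε) - f ξ)

/-- The first-order error of the difference quotient. -/
def slopeError (ε : ℝ) (i : Fin m) (f : (Fin m → ℝ) → ℝ) (ξ : Fin m → ℝ) : ℝ :=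
  ε⁻¹ * (slopeAlong ε i f ξ - dirDeriv i f ξ)

variable {f : (Fin m → ℝ) → ℝ} (i j : Fin m) (L : List (Fin m)) {ε : ℝ}

lemma contDiff_dirDeriv (hf : ContDiff ℝ ∞ f) : ContDiff ℝ ∞ (dirDeriv i f) :=
  (hf.fderiv_right (m := ∞) (by simp)).clm_apply contDiff_const

lemma contDiff_translate (hf : ContDiff ℝ ∞ f) (v : Fin m → ℝ) :
    ContDiff ℝ ∞ fun ξ => f (ξ + v) :=
  hf.comp (contDiff_id.add contDiff_const)

lemma contDiff_slopeAlong (hf : ContDiff ℝ ∞ f) : ContDiff ℝ ∞ (slopeAlong ε i f) :=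
  contDiff_const.mul ((contDiff_translate hf _).sub hf)

lemma contDiff_slopeError (hf : ContDiff ℝ ∞ f) : ContDiff ℝ ∞ (slopeError ε i f) :=
  contDiff_const.mul ((contDiff_slopeAlong i hf).sub (contDiff_dirDeriv i hf))

lemma dirDeriv_comm (hf : ContDiff ℝ ∞ f) :
    dirDeriv i (dirDeriv j f) = dirDeriv j (dirDeriv i f) := by
  funext ξ
  have hsymm := hf.contDiffAt (x := ξ) |>.isSymmSndFDerivAt (by
    rw [minSmoothness_of_isRCLikeNormedField]
    exact WithTop.coe_le_coe.2 (le_top : (2 : ℕ∞) ≤ ⊤))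
  have h : ∀ a b : Fin m, dirDeriv a (dirDeriv b f) ξ =
      fderiv ℝ (fderiv ℝ f) ξ (Pi.single a 1) (Pi.single b 1) := by
    intro a b
    have h1 : DifferentiableAt ℝ (fderiv ℝ f) ξ :=
      (hf.fderiv_right (m := ∞) (by simp)).differentiable (by simp) ξ
    have h2 := (h1.hasFDerivAt.clm_apply (hasFDerivAt_const (Pi.single b (1 : ℝ)) ξ)).fderiv
    have h3 : dirDeriv b f = fun η => fderiv ℝ f η (Pi.single b 1) := rfl
    rw [dirDeriv, h3, h2]
    simp
  rw [h, h, hsymm.eq]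

lemma dirDeriv_translate (v ξ : Fin m → ℝ) :
    dirDeriv i (fun ξ => f (ξ + v)) ξ = dirDeriv i f (ξ + v) := by
  rw [dirDeriv, dirDeriv, fderiv_comp_add_right]

lemma dirDeriv_slopeAlong (hf : ContDiff ℝ ∞ f) :
    dirDeriv j (slopeAlong ε i f) = slopeAlong ε i (dirDeriv j f) := by
  funext ξ
  have h1 := ((contDiff_translate hf (Pi.single i ε)).differentiable (by simp) ξ)
  have h2 := hf.differentiable (by simp) ξ
  have h3 := ((h1.hasFDerivAt.sub h2.hasFDerivAt).const_mul ε⁻¹).fderiv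
  rw [slopeAlong, ← dirDeriv_translate]
  have h4 : slopeAlong ε i f =
      fun ξ => ε⁻¹ * ((fun ξ => f (ξ + Pi.single i ε)) - f : (Fin m → ℝ) → ℝ) ξ := rfl
  rw [dirDeriv, h4, h3]
  simp [dirDeriv]

lemma dirDeriv_slopeError (hf : ContDiff ℝ ∞ f) :
    dirDeriv j (slopeError ε i f) = slopeError ε i (dirDeriv j f) := by
  funext ξ
  have h1 := ((contDiff_slopeAlong (ε := ε) i hf).differentiable (by simp) ξ)
  have h2 := (contDiff_dirDeriv i hf).differentiable (by simp) ξ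
  have h3 := ((h1.hasFDerivAt.sub h2.hasFDerivAt).const_mul ε⁻¹).fderiv
  rw [slopeError, ← dirDeriv_slopeAlong i j hf, dirDeriv_comm i j hf]
  have h4 : slopeError ε i f = fun ξ => ε⁻¹ * (slopeAlong ε i f - dirDeriv i f) ξ := rfl
  rw [dirDeriv, h4, h3]
  simp [dirDeriv]

lemma contDiff_listDeriv (hf : ContDiff ℝ ∞ f) : ContDiff ℝ ∞ (listDeriv L f) := by
  induction L generalizing f with
  | nil => exact hf
  | cons i L ih => exact ih (contDiff_dirDeriv i hf)

lemma listDeriv_dirDeriv (hf : ContDiff ℝ ∞ f) :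
    listDeriv L (dirDeriv i f) = dirDeriv i (listDeriv L f) := by
  induction L generalizing f with
  | nil => rfl
  | cons j L ih => rw [listDeriv, listDeriv, dirDeriv_comm j i hf, ih (contDiff_dirDeriv j hf)]

lemma listDeriv_slopeAlong (hf : ContDiff ℝ ∞ f) :
    listDeriv L (slopeAlong ε i f) = slopeAlong ε i (listDeriv L f) := by
  induction L generalizing f with
  | nil => rfl
  | cons j L ih =>
    rw [listDeriv, listDeriv, dirDeriv_slopeAlong i j hf, ih (contDiff_dirDeriv j hf)]

lemma listDeriv_slopeError (hf : ContDiff ℝ ∞ f) :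
    listDeriv L (slopeError ε i f) = slopeError ε i (listDeriv L f) := by
  induction L generalizing f with
  | nil => rfl
  | cons j L ih =>
    rw [listDeriv, listDeriv, dirDeriv_slopeError i j hf, ih (contDiff_dirDeriv j hf)]

lemma exists_slopeAlong_eq (hf : ContDiff ℝ ∞ f) (hε : 0 < ε) (ξ : Fin m → ℝ) :
    ∃ θ ∈ Ioo 0 ε, slopeAlong ε i f ξ = dirDeriv i f (ξ + Pi.single i θ) := by
  have h1 : ∀ t : ℝ, HasDerivAt (fun s : ℝ => f (ξ + Pi.single i s))
      (dirDeriv i f (ξ + Pi.single i t)) t := fun t =>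
    (hf.differentiable (by simp) (ξ + Pi.single i t)).hasFDerivAt.comp_hasDerivAt t
      ((hasDerivAt_single i t).const_add ξ)
  obtain ⟨θ, hθ, h2⟩ := exists_hasDerivAt_eq_slope (fun s : ℝ => f (ξ + Pi.single i s)) _ hε
    (fun t _ => (h1 t).continuousAt.continuousWithinAt) fun t _ => h1 t
  refine ⟨θ, hθ, ?_⟩
  rw [h2, slopeAlong, Pi.single_zero, add_zero, sub_zero, div_eq_inv_mul]

lemma abs_slopeAlong_le (hf : ContDiff ℝ ∞ f) (hε : 0 < ε) {K : ℝ}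
    (hK : ∀ ξ, |dirDeriv i f ξ| ≤ K) (ξ : Fin m → ℝ) : |slopeAlong ε i f ξ| ≤ K := by
  obtain ⟨θ, -, h⟩ := exists_slopeAlong_eq i hf hε ξ
  rw [h]
  exact hK _

/-- By the mean value theorem the slope is a first derivative at distance `θ < ε`, and its deviation
from the derivative at `ξ` is `θ` times another slope, bounded by the second derivative. -/
lemma abs_slopeError_le (hf : ContDiff ℝ ∞ f) (hε : 0 < ε) {K : ℝ}
    (hK : ∀ ξ, |dirDeriv i (dirDeriv i f) ξ| ≤ K) (ξ : Fin m → ℝ) : |slopeError ε i f ξ| ≤ K := by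
  obtain ⟨θ, hθ, h⟩ := exists_slopeAlong_eq i hf hε ξ
  have h1 := abs_slopeAlong_le i (contDiff_dirDeriv i hf) hθ.1 hK ξ
  have h2 : dirDeriv i f (ξ + Pi.single i θ) - dirDeriv i f ξ =
      θ * slopeAlong θ i (dirDeriv i f) ξ := by
    rw [slopeAlong, mul_inv_cancel_left₀ hθ.1.ne']
  rw [slopeError, h, h2, abs_mul, abs_mul, abs_inv, abs_of_pos hε, abs_of_pos hθ.1, ← mul_assoc]
  have h3 : ε⁻¹ * θ ≤ 1 := by
    rw [inv_mul_le_iff₀ hε, mul_one]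
    exact hθ.2.le
  exact (mul_le_of_le_one_left (abs_nonneg _) h3).trans h1

/-- A family of smooth functions whose partial derivatives are uniformly bounded. -/
def UniformlySmooth (ε₁ : ℝ) (w : ℝ → (Fin m → ℝ) → ℝ) : Prop :=
  (∀ ε, 0 < ε → ε < ε₁ → ContDiff ℝ ∞ (w ε)) ∧
    ∀ L, ∃ K : ℝ, ∀ ε ξ, 0 < ε → ε < ε₁ → |listDeriv L (w ε) ξ| ≤ K

lemma uniformlySmooth_of_hasCompactSupport (hf : ContDiff ℝ ∞ f) (hs : HasCompactSupport f) :
    UniformlySmooth ε₁ fun _ => f := by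
  refine ⟨fun _ _ _ => hf, fun L => ?_⟩
  have h : HasCompactSupport (listDeriv L f) := by
    clear hf
    induction L generalizing f with
    | nil => exact hs
    | cons i L ih => exact ih (hs.fderiv_apply ℝ _)
  obtain ⟨K, hK⟩ := (contDiff_listDeriv L hf).continuous.bounded_above_of_compact_support h
  exact ⟨K, fun _ ξ _ _ => hK ξ⟩

lemma UniformlySmooth.slopeAlong {w : ℝ → (Fin m → ℝ) → ℝ} (hw : UniformlySmooth ε₁ w) :
    UniformlySmooth ε₁ fun ε => slopeAlong ε i (w ε) := by
  refine ⟨fun ε h1 h2 => contDiff_slopeAlong i (hw.1 ε h1 h2), fun L => ?_⟩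
  obtain ⟨K, hK⟩ := hw.2 (i :: L)
  refine ⟨K, fun ε ξ h1 h2 => ?_⟩
  rw [listDeriv_slopeAlong i L (hw.1 ε h1 h2)]
  refine abs_slopeAlong_le i (contDiff_listDeriv L (hw.1 ε h1 h2)) h1 (fun ξ => ?_) ξ
  rw [← listDeriv_dirDeriv i L (hw.1 ε h1 h2)]
  exact hK ε ξ h1 h2

/-- The first-order error commutes with partial derivatives, so every derivative of it is the error
of a derivative and loses two orders. -/
lemma UniformlySmooth.slopeError {w : ℝ → (Fin m → ℝ) → ℝ} (hw : UniformlySmooth ε₁ w) :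
    UniformlySmooth ε₁ fun ε => slopeError ε i (w ε) := by
  refine ⟨fun ε h1 h2 => contDiff_slopeError i (hw.1 ε h1 h2), fun L => ?_⟩
  obtain ⟨K, hK⟩ := hw.2 (i :: i :: L)
  refine ⟨K, fun ε ξ h1 h2 => ?_⟩
  rw [listDeriv_slopeError i L (hw.1 ε h1 h2)]
  refine abs_slopeError_le i (contDiff_listDeriv L (hw.1 ε h1 h2)) h1 (fun ξ => ?_) ξ
  rw [← listDeriv_dirDeriv i L (hw.1 ε h1 h2),
    ← listDeriv_dirDeriv i L (contDiff_dirDeriv i (hw.1 ε h1 h2))]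
  exact hK ε ξ h1 h2

/-- The point of `(ε ℤ)^m` with the integer coordinates `n`. -/
def latticePoint (ε : ℝ) (n : Fin m → ℕ) : Fin m → ℝ := fun i => ε * (n i : ℝ)

lemma latticePoint_shift (n : Fin m → ℕ) :
    latticePoint ε (shift i n) = latticePoint ε n + Pi.single i ε := by
  funext j
  by_cases h : j = i
  · subst h
    simp [latticePoint, shift, mul_add]
  · simp [latticePoint, shift, h]

lemma norm_latticePoint_le (hε : 0 < ε) (n : Fin m → ℕ) :
    ‖latticePoint ε n‖ ≤ ε * (degree n : ℕ) := by
  refine (pi_norm_le_iff_of_nonneg (by positivity)).2 fun i => ?_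
  rw [latticePoint, Real.norm_of_nonneg (by positivity)]
  refine mul_le_mul_of_nonneg_left ?_ hε.le
  exact_mod_cast Finset.single_le_sum (f := n) (fun _ _ => Nat.zero_le _) (Finset.mem_univ i)

lemma diff_latticePoint (n : Fin m → ℕ) :
    diff ε i (fun n => f (latticePoint ε n)) n = slopeAlong ε i f (latticePoint ε n) := by
  simp only [diff, slopeAlong, latticePoint_shift, smul_eq_mul]

/-- Difference quotients of a lattice restriction are lattice restrictions of slopes, and uniformly
smooth families are closed under taking slopes. -/
lemma UniformlySmooth.tame {w : ℝ → (Fin m → ℝ) → ℝ} (hw : UniformlySmooth ε₁ w) (ℓ s : ℕ) :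
    Tame ε₁ ρ (fun _ _ => 1) ℓ s fun ε n => w ε (latticePoint ε n) := by
  have hb : ∀ w : ℝ → (Fin m → ℝ) → ℝ, UniformlySmooth ε₁ w → ∀ s,
      BoundedBy ε₁ ρ (fun _ _ => 1) s fun ε n => w ε (latticePoint ε n) := by
    intro w hw s
    obtain ⟨K, hK⟩ := hw.2 []
    refine ⟨|K|, abs_nonneg _, fun ε n h1 h2 _ => ?_⟩
    rw [mul_one]
    exact (hK ε _ h1 h2).trans (le_abs_self K)
  induction ℓ generalizing s w with
  | zero => exact hb w hw s
  | succ ℓ ih =>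
    exact ⟨hb w hw s, fun i => (ih (hw.slopeAlong i) (s + 1)).congr
      fun ε n _ _ _ => diff_latticePoint i n⟩

end Restriction


/-! ### The discrete solutions approximating a smooth solution -/

section TameBounded

variable {m : ℕ} {ε₁ ρ : ℝ} {φ a b : ℝ → (Fin m → ℕ) → ℝ} {s ℓ : ℕ}

/-- Bounded tame families form an algebra. -/
def TameBounded (ε₁ ρ : ℝ) (φ : ℝ → (Fin m → ℕ) → ℝ) (ℓ s : ℕ)
    (u : ℝ → (Fin m → ℕ) → ℝ) : Prop :=
  Tame ε₁ ρ φ ℓ s u ∧ BoundedBy ε₁ ρ (fun _ _ => 1) s u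

lemma TameBounded.add (ha : TameBounded ε₁ ρ φ ℓ s a) (hb : TameBounded ε₁ ρ φ ℓ s b) :
    TameBounded ε₁ ρ φ ℓ s fun ε n => a ε n + b ε n :=
  ⟨ha.1.add hb.1, ha.2.add hb.2⟩

lemma TameBounded.sub (ha : TameBounded ε₁ ρ φ ℓ s a) (hb : TameBounded ε₁ ρ φ ℓ s b) :
    TameBounded ε₁ ρ φ ℓ s fun ε n => a ε n - b ε n := by
  simp only [sub_eq_add_neg]
  exact ⟨ha.1.add hb.1.neg, ha.2.add hb.2.neg⟩

lemma TameBounded.mul (hφ : ∀ ε n, 1 ≤ φ ε n) (ha : TameBounded ε₁ ρ φ ℓ s a)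
    (hb : TameBounded ε₁ ρ φ ℓ s b) : TameBounded ε₁ ρ φ ℓ s fun ε n => a ε n * b ε n :=
  ⟨ha.1.mul hφ ha.2 hb.1, ha.2.mul hb.2⟩

lemma TameBounded.inv (hφ : ∀ ε n, 1 ≤ φ ε n) {c : ℝ} (hc : 0 < c)
    (h : ∀ ε n, 0 < ε → ε < ε₁ → ε * (degree n + s : ℕ) ≤ ρ → c ≤ |a ε n|)
    (ha : TameBounded ε₁ ρ φ ℓ s a) : TameBounded ε₁ ρ φ ℓ s fun ε n => (a ε n)⁻¹ :=
  ⟨ha.1.inv hφ hc h, BoundedBy.inv hc h⟩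

lemma tameBounded_const (hφ : ∀ ε n, 1 ≤ φ ε n) (c : ℝ) :
    TameBounded ε₁ ρ φ ℓ s fun _ (_ : Fin m → ℕ) => c :=
  ⟨tame_const hφ c, boundedBy_const c⟩

lemma tameBounded_step (hφ : ∀ ε n, 1 ≤ φ ε n) :
    TameBounded ε₁ ρ φ ℓ s fun ε (_ : Fin m → ℕ) => ε :=
  ⟨tame_step hφ, boundedBy_step⟩

end TameBounded

section Approximation

variable {m N : ℕ}

lemma half_le_abs_one_add {p : ℝ} (hp : |p| ≤ 1 / 10) : 1 / 2 ≤ |1 + p| := by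
  have := (abs_le.1 hp).1
  exact le_trans (by linarith) (le_abs_self _)

lemma half_le_abs_one_sub_mul {p q : ℝ} (hp : |p| ≤ 1 / 10) (hq : |q| ≤ 1 / 10) :
    1 / 2 ≤ |1 - p * q| := by
  have := (abs_le.1 (abs_mul_le_of_small hp hq)).2
  exact le_trans (by linarith) (le_abs_self _)

/-- The correction is built from `ε` and the unknowns by sums, products and inverses of denominators
that are at least `1 / 2`, all of which preserve the class. -/
lemma TameBounded.latticeCorr {ε₁ ρ : ℝ} {φ : ℝ → (Fin m → ℕ) → ℝ} {ℓ : ℕ}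
    (hφ : ∀ ε n, 1 ≤ φ ε n) {u : ℝ → Unknown m N → (Fin m → ℕ) → ℝ}
    (hu : ∀ k, TameBounded ε₁ ρ φ ℓ 0 fun ε n => u ε k n)
    (hsmall : ∀ ε k n, 0 < ε → ε < ε₁ → ε * (degree n : ℕ) ≤ ρ → |ε * u ε k n| ≤ 1 / 10)
    (k : Unknown m N) (i : Fin m) :
    TameBounded ε₁ ρ φ ℓ 0 fun ε n => latticeCorr ε k i fun l => u ε l n := by
  have hε : TameBounded ε₁ ρ φ ℓ 0 fun ε (_ : Fin m → ℕ) => ε := tameBounded_step hφ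
  have h1 : TameBounded ε₁ ρ φ ℓ 0 fun _ (_ : Fin m → ℕ) => (1 : ℝ) := tameBounded_const hφ 1
  have hmul := fun k => hε.mul hφ (hu k)
  have hinv : ∀ k l, TameBounded ε₁ ρ φ ℓ 0 fun ε n =>
      (1 - ε * u ε k n * (ε * u ε l n))⁻¹ := fun k l =>
    (h1.sub ((hmul k).mul hφ (hmul l))).inv hφ one_half_pos fun ε n p1 p2 p3 =>
      half_le_abs_one_sub_mul (hsmall ε k n p1 p2 p3) (hsmall ε l n p1 p2 p3)
  have hinv' : ∀ k, TameBounded ε₁ ρ φ ℓ 0 fun ε n => (1 + ε * u ε k n)⁻¹ := fun k =>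
    (h1.add (hmul k)).inv hφ one_half_pos fun ε n p1 p2 p3 =>
      half_le_abs_one_add (hsmall ε k n p1 p2 p3)
  cases k with
  | pos a => exact tameBounded_const hφ 0
  | tan j a =>
    exact (((((hu _).mul hφ (hu _)).mul hφ (h1.add (hmul _))).mul hφ (hinv _ _)).mul hφ
      (hu _)).add (((((hu _).mul hφ (hu _)).mul hφ (h1.add (hmul _))).mul hφ (hinv _ _)).mul hφ
      (hu _))
  | rot k j =>
    exact ((((((hu _).mul hφ (hu _)).mul hφ (hu _)).add (((hu _).mul hφ (hu _)).mul hφ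
      (hu _))).add (hε.mul hφ ((((hu _).mul hφ (hu _)).mul hφ (hu _)).mul hφ (hu _)))).sub
      (((((hu _).mul hφ (hu _)).add ((hu _).mul hφ (hu _))).sub ((hu _).mul hφ (hu _))).mul hφ
      (((hu _).sub (hε.mul hφ ((hu _).mul hφ (hu _)))).sub ((hε.mul hφ hε).mul hφ
      (((hu _).mul hφ (hu _)).mul hφ (hu _)))))).mul hφ ((hinv _ _).mul hφ (hinv' _))

/-- The right-hand sides are at most quadratic: `u u' - v v' = ε (u y' + v' y)` cancels the factor
`ε⁻¹` and leaves expressions linear in `y` with bounded coefficients. -/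
lemma Tame.rhs_sub {ε₁ ρ : ℝ} {φ : ℝ → (Fin m → ℕ) → ℝ} {ℓ : ℕ}
    (hφ : ∀ ε n, 1 ≤ φ ε n) {u v y : ℝ → Unknown m N → (Fin m → ℕ) → ℝ}
    (hu : ∀ k, TameBounded ε₁ ρ φ ℓ 0 fun ε n => u ε k n)
    (hv : ∀ k, TameBounded ε₁ ρ φ ℓ 0 fun ε n => v ε k n)
    (hy : ∀ k, Tame ε₁ ρ φ ℓ 0 fun ε n => y ε k n)
    (huv : ∀ ε k n, 0 < ε → u ε k n = v ε k n + ε * y ε k n)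
    (k : Unknown m N) (i : Fin m) (hi : evolves k i) :
    Tame ε₁ ρ φ ℓ 0 fun ε n =>
      ε⁻¹ * (rhs k i (fun l => u ε l n) - rhs k i (fun l => v ε l n)) := by
  have hprod : ∀ k l, Tame ε₁ ρ φ ℓ 0 fun ε n => u ε k n * y ε l n + v ε l n * y ε k n :=
    fun k l => ((hu k).1.mul hφ (hu k).2 (hy l)).add ((hv l).1.mul hφ (hv l).2 (hy k))
  cases k with
  | pos a =>
    refine (hy (.tan i a)).congr fun ε n h1 _ _ => ?_
    simp only [rhs]
    rw [huv ε _ n h1, add_sub_cancel_left, inv_mul_cancel_left₀ h1.ne']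
  | tan j a =>
    refine ((hprod (.rot j i) (.tan i a)).add (hprod (.rot i j) (.tan j a))).congr
      fun ε n h1 _ _ => ?_
    simp only [rhs, if_neg (show i ≠ j from hi), huv ε _ n h1]
    field_simp
    ring
  | rot k j =>
    refine (((hprod (.rot i k) (.rot k j)).add (hprod (.rot k i) (.rot i j))).add
      (hprod (.rot k j) (.rot i j)).neg).congr fun ε n h1 _ _ => ?_
    simp only [rhs, if_pos (show Distinct i j k from hi), huv ε _ n h1]
    field_simp
    ring

lemma continuousOn_latticeCorr (k : Unknown m N) (i : Fin m) :
    ContinuousOn (fun p : ℝ × (Unknown m N → ℝ) => latticeCorr p.1 k i p.2)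
      {p | ∀ l, |p.1 * p.2 l| ≤ 1 / 10} := by
  have hinv : ∀ k l, ContinuousOn (fun p : ℝ × (Unknown m N → ℝ) =>
      (1 - p.1 * p.2 k * (p.1 * p.2 l))⁻¹) {p | ∀ l, |p.1 * p.2 l| ≤ 1 / 10} := fun k l =>
    ContinuousOn.inv₀ (by fun_prop) fun p hp => one_sub_mul_ne_zero_of_small (hp k) (hp l)
  have hinv' : ∀ k, ContinuousOn (fun p : ℝ × (Unknown m N → ℝ) =>
      (1 + p.1 * p.2 k)⁻¹) {p | ∀ l, |p.1 * p.2 l| ≤ 1 / 10} := fun k =>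
    ContinuousOn.inv₀ (by fun_prop) fun p hp => one_add_ne_zero_of_small (hp k)
  cases k with
  | pos a => exact continuousOn_const
  | tan j a =>
    exact ((ContinuousOn.mul (by fun_prop) (hinv _ _)).mul (by fun_prop)).add
      ((ContinuousOn.mul (by fun_prop) (hinv _ _)).mul (by fun_prop))
  | rot k j => exact ContinuousOn.mul (by fun_prop) ((hinv _ _).mul (hinv' _))

/-- The increment divided by `ε` extends continuously to `ε = 0` by `latticeStep_eq`, so compactness
of the set of bounded states gives a constant independent of `ε`. -/
lemma exists_latticeStep_bound {M ε₀ : ℝ} (hε₀ : ε₀ * M ≤ 1 / 10) :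
    ∃ G : ℝ, 0 ≤ G ∧ ∀ (k : Unknown m N) (i : Fin m) (ε : ℝ) (v : Unknown m N → ℝ),
      evolves k i → 0 < ε → ε ≤ ε₀ → (∀ l, |v l| ≤ M) → |latticeStep ε k i v| ≤ |v k| + ε * G := by
  set S : Set (ℝ × (Unknown m N → ℝ)) := Icc 0 ε₀ ×ˢ Set.pi univ fun _ => Icc (-M) M with hS
  have hSc : IsCompact S := isCompact_Icc.prod (isCompact_univ_pi fun _ => isCompact_Icc)
  have hsmall : ∀ p ∈ S, ∀ l, |p.1 * p.2 l| ≤ 1 / 10 := by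
    rintro ⟨ε, v⟩ ⟨h1, h2⟩ l
    refine (abs_mul_le_of_small (a := ε₀) (b := M) ?_ (abs_le.2 (h2 l trivial))).trans hε₀
    rw [abs_of_nonneg h1.1]
    exact h1.2
  have hcont : ∀ q : Unknown m N × Fin m, ContinuousOn (fun p : ℝ × (Unknown m N → ℝ) =>
      rhs q.1 q.2 p.2 + p.1 * latticeCorr p.1 q.1 q.2 p.2) S := fun q =>
    ((contDiff_rhs q.1 q.2).continuous.comp continuous_snd).continuousOn.add
      (continuousOn_fst.mul ((continuousOn_latticeCorr q.1 q.2).mono hsmall))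
  choose G hG using fun q => hSc.exists_bound_of_continuousOn (hcont q)
  refine ⟨∑ q, |G q|, by positivity, fun k i ε v hk h1 h2 hv => ?_⟩
  have hmem : (ε, v) ∈ S := ⟨⟨h1.le, h2⟩, fun l _ => abs_le.1 (hv l)⟩
  rw [latticeStep_eq h1.ne' k i hk v (hsmall _ hmem)]
  refine (abs_add_le _ _).trans (add_le_add_right ?_ _)
  rw [abs_mul, abs_of_pos h1]
  refine mul_le_mul_of_nonneg_left ((hG (k, i) _ hmem).trans ((le_abs_self _).trans ?_)) h1.le
  exact Finset.single_le_sum (f := fun q => |G q|) (fun _ _ => abs_nonneg _)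
    (Finset.mem_univ (k, i))

/-- The data of the discrete system obtained from a smooth solution `v`. -/
def latticeData (v : Unknown m N → (Fin m → ℝ) → ℝ) (ε : ℝ) :
    Unknown m N → (Fin m → ℕ) → ℝ
  | .pos a => fun n => v (.pos a) (latticePoint ε n)
  | .tan j a => fun n => slopeAlong ε j (v (.pos a)) (latticePoint ε n)
  | .rot k j => fun n =>
      v (.rot k j) (latticePoint ε n) / (1 + ε * v (.rot j k) (latticePoint ε n))

/-- Slopes of positions are bounded by first derivatives; the transformed coefficients have
denominators at least `1 / 2`, which is the origin of the factor `2`. -/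
lemma exists_latticeData_bound {v : Unknown m N → (Fin m → ℝ) → ℝ}
    (hv : ∀ k, ContDiff ℝ ∞ (v k)) (hcs : ∀ k, HasCompactSupport (v k)) :
    ∃ M₀ : ℝ, 0 < M₀ ∧ (∀ k ξ, |v k ξ| ≤ M₀) ∧
      ∀ ε k n, 0 < ε → ε * M₀ ≤ 1 / 10 → |latticeData v ε k n| ≤ 2 * M₀ := by
  choose A hA using fun k => (hv k).continuous.bounded_above_of_compact_support (hcs k)
  choose B hB using fun q : Unknown m N × Fin m =>
    (contDiff_dirDeriv q.2 (hv q.1)).continuous.bounded_above_of_compact_support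
      ((hcs q.1).fderiv_apply ℝ _)
  set M₀ : ℝ := 1 + ∑ k, |A k| + ∑ q, |B q| with hM
  have hAs : 0 ≤ ∑ k, |A k| := by positivity
  have hBs : 0 ≤ ∑ q, |B q| := by positivity
  have h1 : ∀ k ξ, |v k ξ| ≤ M₀ := fun k ξ => by
    have := Finset.single_le_sum (f := fun k => |A k|) (fun _ _ => abs_nonneg _) (Finset.mem_univ k)
    have h2 : |v k ξ| ≤ A k := hA k ξ
    have := le_abs_self (A k)
    linarith
  refine ⟨M₀, by positivity, h1, fun ε k n hε hεM => ?_⟩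
  have hM0 : 0 < M₀ := by positivity
  cases k with
  | pos a => exact (h1 _ _).trans (by linarith)
  | tan j a =>
    refine (abs_slopeAlong_le (K := M₀) j (hv (.pos a)) hε (fun ξ => ?_) _).trans (by linarith)
    have := Finset.single_le_sum (f := fun q => |B q|) (fun _ _ => abs_nonneg _)
      (Finset.mem_univ (Unknown.pos a, j))
    have h2 : |dirDeriv j (v (.pos a)) ξ| ≤ B (.pos a, j) := hB (.pos a, j) ξ
    have := le_abs_self (B (.pos a, j))
    linarith
  | rot k j =>
    simp only [latticeData]
    have h2 : 1 / 2 ≤ |1 + ε * v (.rot j k) (latticePoint ε n)| := by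
      refine half_le_abs_one_add ((abs_mul_le_of_small (a := ε) ?_ (h1 _ _)).trans hεM)
      rw [abs_of_pos hε]
    rw [abs_div, div_le_iff₀ (by linarith)]
    refine (h1 _ _).trans ?_
    nlinarith

/-- A smooth solution of the continuous system is approximated to first order, together with its
difference quotients, by solutions of the discrete systems. -/
theorem exists_discrete_approximation {v : Unknown m N → (Fin m → ℝ) → ℝ} {ρ₀ : ℝ} (hρ₀ : 0 < ρ₀)
    (hv : ∀ k, ContDiff ℝ ∞ (v k)) (hcs : ∀ k, HasCompactSupport (v k))
    (heqv : ∀ k i, evolves k i → ∀ ξ, ‖ξ‖ < ρ₀ →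
      fderiv ℝ (v k) ξ (Pi.single i 1) = rhs k i (fun l => v l ξ)) :
    ∃ ρ ε₁ M : ℝ, 0 < ρ ∧ ρ < ρ₀ ∧ 0 < ε₁ ∧ 0 < M ∧ ε₁ * M ≤ 1 / 10 ∧ (∀ k ξ, |v k ξ| ≤ M) ∧
      ∃ u : ℝ → Unknown m N → (Fin m → ℕ) → ℝ,
        (∀ ε k n, 0 < ε → ε < ε₁ → ε * (degree n : ℕ) ≤ ρ → |u ε k n| ≤ M) ∧
        (∀ ε k n, 0 < ε → ε < ε₁ → (∀ i, evolves k i → n i = 0) →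
          u ε k n = latticeData v ε k n) ∧
        (∀ ε k i n, evolves k i → 0 < ε → ε < ε₁ → ε * (degree n + 1 : ℕ) ≤ ρ →
          u ε k (shift i n) = latticeStep ε k i fun l => u ε l n) ∧
        ∀ ℓ k, Tame ε₁ ρ (fun _ _ => 1) ℓ 0
          fun ε n => ε⁻¹ * (u ε k n - v k (latticePoint ε n)) := by
  obtain ⟨M₀, hM₀, hvM, hUM⟩ := exists_latticeData_bound hv hcs
  -- The data are bounded by `2 * M₀`; the extra `1` is the room for growth during the evolution.
  -- The choice of `ε₁` then makes `ε` times every state small enough for the algebra.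
  obtain ⟨M, hM⟩ : ∃ M, M = 2 * M₀ + 1 := ⟨_, rfl⟩
  have hM0 : 0 < M := by linarith
  obtain ⟨ε₁, hε₁⟩ : ∃ ε₁, ε₁ = 1 / (10 * M) := ⟨_, rfl⟩
  have hε₁0 : 0 < ε₁ := by rw [hε₁]; positivity
  have hε₁M : ε₁ * M = 1 / 10 := by rw [hε₁]; field_simp
  obtain ⟨G, hG0, hG⟩ := exists_latticeStep_bound (m := m) (N := N) hε₁M.le
  -- At most `ρ / ε` steps of growth `ε * G` occur, and `G * ρ ≤ 1` keeps their total within the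
  -- allowed room.
  obtain ⟨ρ, hρ⟩ : ∃ ρ, ρ = min (ρ₀ / 2) (1 / (G + 1)) := ⟨_, rfl⟩
  have hρ0 : 0 < ρ := by rw [hρ]; positivity
  have hρρ : ρ < ρ₀ := (hρ.le.trans (min_le_left _ _)).trans_lt (by linarith)
  have hGρ : G * ρ ≤ 1 := by
    have h1 : ρ ≤ 1 / (G + 1) := hρ.le.trans (min_le_right _ _)
    rw [le_div_iff₀ (by positivity)] at h1
    linarith
  have hex : ∀ ε : ℝ, ∃ u : Unknown m N → (Fin m → ℕ) → ℝ, 0 < ε → ε < ε₁ →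
      (∀ k n, ε * (degree n : ℕ) ≤ ρ → |u k n| ≤ M) ∧
      (∀ k n, (∀ i, evolves k i → n i = 0) → u k n = latticeData v ε k n) ∧
      ∀ k i n, evolves k i → ε * (degree n + 1 : ℕ) ≤ ρ →
        u k (shift i n) = latticeStep ε k i fun l => u l n := by
    intro ε
    by_cases hε : 0 < ε ∧ ε < ε₁
    swap
    · exact ⟨fun _ _ => 0, fun h1 h2 => absurd ⟨h1, h2⟩ hε⟩
    obtain ⟨h1, h2⟩ := hε
    have hfl : ∀ d : ℕ, d ≤ ⌊ρ / ε⌋₊ ↔ ε * (d : ℕ) ≤ ρ := fun d => by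
      rw [Nat.le_floor_iff (by positivity), le_div_iff₀' h1]
    have hεM : ε * M₀ ≤ 1 / 10 := by
      rw [← hε₁M]
      exact mul_le_mul h2.le (by linarith) hM₀.le hε₁0.le
    obtain ⟨u, hu1, hu2, hu3⟩ := exists_lattice_solution evolves (latticeStep ε)
      (latticeData (N := N) v ε) ⌊ρ / ε⌋₊ M (2 * M₀) (ε * G) (by positivity)
      (fun k i v hk hvb => hG k i ε v hk h1 h2.le hvb) (fun k n _ => hUM ε k n h1 hεM) (by
        have h3 := (hfl _).1 le_rfl
        have h4 : G * (ε * (⌊ρ / ε⌋₊ : ℝ)) ≤ G * ρ := mul_le_mul_of_nonneg_left h3 hG0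
        rw [hM]
        linarith)
      (fun k i j hi hj hij v vi vj hvb hvi hvj =>
        latticeStep_consistent h1.ne' k i j hi hj hij v vi vj (fun l => by
          rw [← hε₁M]
          exact abs_mul_le_of_small (by rw [abs_of_pos h1]; exact h2.le) (hvb l)) hvi hvj)
    exact ⟨u, fun _ _ => ⟨fun k n h => hu1 k n ((hfl _).2 h), hu2,
      fun k i n hk h => hu3 k i n hk ((hfl _).2 h)⟩⟩
  choose u hu using hex
  have hsmall : ∀ ε k n, 0 < ε → ε < ε₁ → ε * (degree n : ℕ) ≤ ρ → |ε * u ε k n| ≤ 1 / 10 := by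
    intro ε k n h1 h2 h3
    rw [← hε₁M]
    exact abs_mul_le_of_small (by rw [abs_of_pos h1]; exact h2.le) ((hu ε h1 h2).1 k n h3)
  have hvM' : ∀ k ξ, |v k ξ| ≤ M := fun k ξ => (hvM k ξ).trans (by linarith)
  have hsm : ∀ k, UniformlySmooth ε₁ fun _ => v k := fun k =>
    uniformlySmooth_of_hasCompactSupport (hv k) (hcs k)
  refine ⟨ρ, ε₁, M, hρ0, hρρ, hε₁0, hM0, hε₁M.le, hvM', u,
    fun ε k n h1 h2 => (hu ε h1 h2).1 k n, fun ε k n h1 h2 => (hu ε h1 h2).2.1 k n,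
    fun ε k i n hk h1 h2 => (hu ε h1 h2).2.2 k i n hk, ?_⟩
  have hball : ∀ ε (n : Fin m → ℕ), 0 < ε → ε * (degree n : ℕ) ≤ ρ → ‖latticePoint ε n‖ < ρ₀ :=
    fun ε n h1 h2 => ((norm_latticePoint_le h1 n).trans h2).trans_lt hρρ
  refine tame_of_evolution evolves (fun k ε n => ε⁻¹ * (u ε k n - v k (latticePoint ε n)))
    (fun k => match k with
      | .pos _ => fun _ _ => 0
      | .tan j a => fun ε n => slopeError ε j (v (.pos a)) (latticePoint ε n)
      | .rot k j => fun ε n => -(v (.rot k j) (latticePoint ε n) *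
          v (.rot j k) (latticePoint ε n) * (1 + ε * v (.rot j k) (latticePoint ε n))⁻¹))
    -- The difference quotient of the scaled error: the discrete step contributes `rhs` at `u` plus
    -- `ε` times the correction, and the slope of `v` is `rhs` at `v` plus `ε` times the slope
    -- error.
    (fun k i ε n => ε⁻¹ * (rhs k i (fun l => u ε l n) - rhs k i (fun l => v l (latticePoint ε n))) +
      latticeCorr ε k i (fun l => u ε l n) + -slopeError ε i (v k) (latticePoint ε n))
    ?_ ?_ ?_ ?_
  · intro k i ε n hk h1 h2 h3
    have h4 : ε * (degree n : ℕ) ≤ ρ := domain_of_le h1 h3 (by omega)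
    have h5 := (hu ε h1 h2).2.2 k i n hk h3
    rw [latticeStep_eq h1.ne' k i hk _ fun l => hsmall ε l n h1 h2 h4] at h5
    have h6 := heqv k i hk _ (hball ε n h1 h4)
    rw [← h6, slopeError, dirDeriv, ← diff_latticePoint]
    simp only [diff, smul_eq_mul]
    rw [h5]
    have := h1.ne'
    field_simp
    ring
  · intro k ℓ
    have hφ : ∀ (ε : ℝ) (n : Fin m → ℕ), (1 : ℝ) ≤ 1 := fun _ _ => le_rfl
    cases k with
    | pos a => exact tame_zero hφ
    | tan j a => exact ((hsm (.pos a)).slopeError j).tame ℓ 0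
    | rot k j =>
      have h1 := fun k => (hsm k).tame (ρ := ρ) ℓ 0
      refine ((((h1 (.rot k j)).mul_of_lower hφ (h1 (.rot j k))).mul_of_lower hφ
        (((tame_const hφ 1).add ((tame_step hφ).mul_of_lower hφ (h1 (.rot j k)))).inv hφ
          one_half_pos fun ε n p1 p2 _ => half_le_abs_one_add ?_))).neg
      rw [← hε₁M]
      exact abs_mul_le_of_small (by rw [abs_of_pos p1]; exact p2.le) (hvM' _ _)
  · intro k ε n h1 h2 h3 hn
    have h4 := (hu ε h1 h2).2.1 k n hn
    cases k with
    | pos a => simp [h4, latticeData]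
    | tan j a =>
      have h6 := heqv (.pos a) j trivial _ (hball ε n h1 h3)
      simp only [h4, latticeData, slopeError, dirDeriv, h6, rhs]
    | rot k j =>
      have h5 : 1 + ε * v (.rot j k) (latticePoint ε n) ≠ 0 := by
        refine one_add_ne_zero_of_small ?_
        rw [← hε₁M]
        exact abs_mul_le_of_small (by rw [abs_of_pos h1]; exact h2.le) (hvM' _ _)
      simp only [h4, latticeData]
      have := h1.ne'
      field_simp
      ring
  · intro ℓ φ hφ hy k i hk
    have hvt : ∀ k, TameBounded ε₁ ρ φ ℓ 0 fun ε n => v k (latticePoint ε n) := fun k =>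
      ⟨((hsm k).tame ℓ 0).weight hφ, ((hsm k).tame ℓ 0).bounded⟩
    have huv : ∀ ε k n, 0 < ε → u ε k n =
        v k (latticePoint ε n) + ε * (ε⁻¹ * (u ε k n - v k (latticePoint ε n))) := by
      intro ε k n h1
      rw [mul_inv_cancel_left₀ h1.ne']
      ring
    have hut : ∀ k, TameBounded ε₁ ρ φ ℓ 0 fun ε n => u ε k n := fun k => by
      refine ⟨((hvt k).1.add ((tame_step hφ).mul hφ boundedBy_step (hy k))).congr
        fun ε n h1 _ _ => huv ε k n h1, M, hM0.le, fun ε n h1 h2 h3 => ?_⟩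
      rw [mul_one]
      exact (hu ε h1 h2).1 k n h3
    exact ((Tame.rhs_sub hφ hut hvt hy huv k i hk).add
      (TameBounded.latticeCorr hφ hut hsmall k i).1).add
      ((((hsm k).slopeError i).tame ℓ 0).weight hφ).neg

end Approximation


/-! ### Uniqueness of discrete nets -/

section DiscreteUniqueness

variable {m N : ℕ} {ε r : ℝ}

lemma mem_latticeBox_of_shift (hε : 0 < ε) {i : Fin m} {n : Fin m → ℕ}
    (h : shift i n ∈ latticeBox m ε r) : n ∈ latticeBox m ε r := by
  refine fun j => le_trans (mul_le_mul_of_nonneg_left ?_ hε.le) (h j)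
  have : n j ≤ shift i n j := Nat.le_add_right _ _
  exact_mod_cast this

section Vector

variable {F : Type*} [NormedAddCommGroup F] [NormedSpace ℝ F]

lemma shift_eq_add_smul_diff (hε : ε ≠ 0) (i : Fin m) (u : (Fin m → ℕ) → F) (n : Fin m → ℕ) :
    u (shift i n) = u n + ε • diff ε i u n := by
  rw [diff, smul_inv_smul₀ hε, add_sub_cancel]

lemma diff_diff_shift_sub (i j : Fin m) (u : (Fin m → ℕ) → F) (n : Fin m → ℕ) :
    diff ε j u (shift i n) - diff ε j u n = diff ε i u (shift j n) - diff ε i u n := by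
  simp only [diff, shift_comm i j]
  module

end Vector

/-- The linear system for the differences of two solutions of the compatibility equations. -/
lemma eq_zero_of_near_identity {cij cji cik cki cjk ckj dij dji dik dki djk dkj : ℝ}
    (h1 : |ε * cij| ≤ 1 / 9) (h2 : |ε * cji| ≤ 1 / 9) (h3 : |ε * cik| ≤ 1 / 9)
    (h4 : |ε * cki| ≤ 1 / 9) (h5 : |ε * cjk| ≤ 1 / 9) (h6 : |ε * ckj| ≤ 1 / 9)
    (e1 : dkj * (1 + ε * cij) = ε * (dik * ckj + dki * cij))
    (e2 : djk * (1 + ε * cik) = ε * (dij * cjk + dji * cik))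
    (e3 : dki * (1 + ε * cji) = ε * (djk * cki + dkj * cji))
    (e4 : dik * (1 + ε * cjk) = ε * (dji * cik + dij * cjk))
    (e5 : dij * (1 + ε * ckj) = ε * (dki * cij + dik * ckj))
    (e6 : dji * (1 + ε * cki) = ε * (dkj * cji + djk * cki)) : dkj = 0 := by
  have key : ∀ {d a b p q : ℝ}, |ε * p| ≤ 1 / 9 → |ε * q| ≤ 1 / 9 →
      d * (1 + ε * p) = ε * (a * q + b * p) → |d| * (8 / 9) ≤ 1 / 9 * |a| + 1 / 9 * |b| := by
    intro d a b p q hp hq h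
    have h7 : 8 / 9 ≤ |1 + ε * p| := by
      have := (abs_le.1 hp).1
      exact le_trans (by linarith) (le_abs_self _)
    calc |d| * (8 / 9) ≤ |d| * |1 + ε * p| := mul_le_mul_of_nonneg_left h7 (abs_nonneg _)
      _ = |ε * q * a + ε * p * b| := by
        rw [← abs_mul, h]
        congr 1
        ring
      _ ≤ |ε * q * a| + |ε * p * b| := abs_add_le _ _
      _ ≤ 1 / 9 * |a| + 1 / 9 * |b| :=
        add_le_add (abs_mul_le_of_small hq le_rfl) (abs_mul_le_of_small hp le_rfl)
  have k1 := key h1 h6 e1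
  have k2 := key h3 h5 e2
  have k3 := key h2 h4 e3
  have k4 := key h5 h3 e4
  have k5 := key h6 h1 e5
  have k6 := key h4 h2 e6
  -- Each unknown occurs in exactly two right-hand sides, so adding the six estimates bounds `8 / 9`
  -- of the sum of absolute values by `2 / 9` of it.
  refine abs_nonpos_iff.1 ?_
  linarith [abs_nonneg dij, abs_nonneg dji, abs_nonneg dik, abs_nonneg dki, abs_nonneg djk,
    abs_nonneg dkj]

/-- The compatibility equation of a discrete conjugate net holds at elementary hexahedra with
linearly independent edges. -/
lemma discrete_compat_of_linearIndependent (hε : 0 < ε)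
    {x : (Fin m → ℕ) → EuclideanSpace ℝ (Fin N)} {c : Fin m → Fin m → (Fin m → ℕ) → ℝ}
    (hx : IsDiscreteConjugateNet ε r x c) {i j k : Fin m} (hij : i ≠ j) (hjk : j ≠ k) (hki : k ≠ i)
    {n : Fin m → ℕ} (hn : shift i (shift j (shift k n)) ∈ latticeBox m ε r)
    (hind : LinearIndependent ℝ ![diff ε i x n, diff ε j x n, diff ε k x n]) :
    diff ε i (c k j) n =
      c i k (shift j n) * c k j n + c k i (shift j n) * c i j n - c k j (shift i n) * c i j n := by
  have m1 : shift j (shift k (shift i n)) ∈ latticeBox m ε r := by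
    rwa [shift_comm k i, shift_comm j i]
  have m2 : shift i (shift k (shift j n)) ∈ latticeBox m ε r := by rwa [shift_comm k j]
  have m3 : shift j (shift k n) ∈ latticeBox m ε r := mem_latticeBox_of_shift hε hn
  have m4 : shift i (shift k n) ∈ latticeBox m ε r := by
    rw [shift_comm i j] at hn
    exact mem_latticeBox_of_shift hε hn
  have m5 : shift i (shift j n) ∈ latticeBox m ε r := by
    rw [shift_comm j k, shift_comm i k] at hn
    exact mem_latticeBox_of_shift hε hn
  -- The discrete counterpart of comparing mixed third derivatives: both sides are expanded in the
  -- three edges at `n`, and the coefficient of the edge in direction `j` is read off.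
  have h := diff_diff_shift_sub (ε := ε) i j (diff ε k x) n
  rw [hx j k hjk _ m1, hx j k hjk _ m3, hx i k hki.symm _ m2, hx i k hki.symm _ m4,
    shift_eq_add_smul_diff hε.ne' i (diff ε j x), shift_eq_add_smul_diff hε.ne' i (diff ε k x),
    shift_eq_add_smul_diff hε.ne' j (diff ε i x), shift_eq_add_smul_diff hε.ne' j (diff ε k x),
    hx i j hij _ m5, hx i k hki.symm _ m4, hx j i hij.symm _ (by rwa [shift_comm]),
    hx j k hjk _ m3] at h
  have h2 := (triple_coeff hind (a := c k j (shift i n) * (ε * c j i n) +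
      c j k (shift i n) * (ε * c k i n) - (c k i (shift j n) * (1 + ε * c j i n) - c k i n))
    (b := c k j (shift i n) * (1 + ε * c i j n) - c k j n -
      (c k i (shift j n) * (ε * c i j n) + c i k (shift j n) * (ε * c k j n)))
    (c := c j k (shift i n) * (1 + ε * c i k n) - c j k n -
      (c i k (shift j n) * (1 + ε * c j k n) - c i k n)) (by
        rw [← sub_eq_zero] at h
        rw [← h]
        module)).2.1
  rw [diff, smul_eq_mul, inv_mul_eq_iff_eq_mul₀ hε.ne']
  linear_combination h2

/-- A discrete net with small rotation coefficients is determined by its data among the nets that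
satisfy the compatibility equations wherever they agree with it to first order. -/
theorem sameDiscreteNet_of_compatible (hm : 1 ≤ m) (hε : 0 < ε)
    {X : Fin m → ℝ → EuclideanSpace ℝ (Fin N)} {C : Fin m → Fin m → ℝ × ℝ → ℝ}
    {x x' : (Fin m → ℕ) → EuclideanSpace ℝ (Fin N)} {c c' : Fin m → Fin m → (Fin m → ℕ) → ℝ}
    (hx : IsDiscreteConjugateNet ε r x c) (hc : IsDiscreteCompatible ε r c)
    (hd : HasDiscreteData ε r X C x c)
    (hsmall : ∀ i j, i ≠ j → ∀ n, shift i (shift j n) ∈ latticeBox m ε r → |ε * c i j n| ≤ 1 / 9)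
    (hx' : IsDiscreteConjugateNet ε r x' c') (hd' : HasDiscreteData ε r X C x' c')
    (hc' : ∀ i j k, i ≠ j → j ≠ k → k ≠ i → ∀ n,
      shift i (shift j (shift k n)) ∈ latticeBox m ε r → x' n = x n →
      (∀ l, shift l n ∈ latticeBox m ε r → x' (shift l n) = x (shift l n)) →
      diff ε i (c' k j) n = c' i k (shift j n) * c' k j n + c' k i (shift j n) * c' i j n -
        c' k j (shift i n) * c' i j n) :
    SameDiscreteNet ε r x' x c' c := by
  -- A coefficient at `n` belongs to a quadrilateral whose far vertex has degree `degree n + 2`, so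
  -- it is known at the same stage as that vertex.
  have main : ∀ s : ℕ, (∀ n ∈ latticeBox m ε r, degree n ≤ s → x' n = x n) ∧
      ∀ i j, i ≠ j → ∀ n, shift i (shift j n) ∈ latticeBox m ε r → degree n + 2 ≤ s →
        c' i j n = c i j n := by
    intro s
    induction s with
    | zero =>
      refine ⟨fun n hn h0 => ?_, fun i j _ n _ h => by omega⟩
      have hn0 : n = Pi.single ⟨0, hm⟩ 0 := by
        rw [Pi.single_zero]
        funext i
        exact (Finset.sum_eq_zero_iff.1 (Nat.le_zero.1 h0)) i (Finset.mem_univ i)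
      subst hn0
      rw [hd.curves _ _ hn, hd'.curves _ _ hn]
    | succ s ih =>
      have hcs : ∀ i j, i ≠ j → ∀ n, shift i (shift j n) ∈ latticeBox m ε r →
          degree n + 2 ≤ s + 1 → c' i j n = c i j n := by
        intro k j hkj n hn hs
        by_cases h0 : ∀ l, l ≠ k → l ≠ j → n l = 0
        · rw [hd.planes k j hkj n hn h0, hd'.planes k j hkj n hn h0]
        push Not at h0
        obtain ⟨i, hik, hij, h0⟩ := h0
        obtain ⟨n, rfl⟩ := exists_eq_shift (Nat.pos_of_ne_zero h0)
        rw [degree_shift] at hs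
        have hijk : shift i (shift j (shift k n)) ∈ latticeBox m ε r := by
          rwa [shift_comm j k, shift_comm i k, shift_comm i j]
        have q1 : shift j (shift k n) ∈ latticeBox m ε r := mem_latticeBox_of_shift hε hijk
        have hxn : x' n = x n :=
          ih.1 n (mem_latticeBox_of_shift hε (mem_latticeBox_of_shift hε q1)) (by omega)
        have hxs : ∀ l, shift l n ∈ latticeBox m ε r → x' (shift l n) = x (shift l n) :=
          fun l hl => ih.1 _ hl (by rw [degree_shift]; omega)
        -- The compatibility equations are linear in the shifted coefficients once those at `n` are
        -- known. Subtracting them gives a homogeneous system for the differences whose coefficients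
        -- involve only the small `c`; no bound on `c'` is needed.
        have hquad : ∀ a b e : Fin m, shift a (shift b (shift e n)) ∈ latticeBox m ε r → a ≠ b →
            b ≠ e → e ≠ a → c' e b n = c e b n ∧ |ε * c e b n| ≤ 1 / 9 ∧
            (c' e b (shift a n) - c e b (shift a n)) * (1 + ε * c a b n) =
              ε * ((c' a e (shift b n) - c a e (shift b n)) * c e b n +
                (c' e a (shift b n) - c e a (shift b n)) * c a b n) := by
          intro a b e h hab hbe hea
          have p1 : shift e (shift b n) ∈ latticeBox m ε r := by
            rw [shift_comm e b]
            exact mem_latticeBox_of_shift hε h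
          have p2 : shift a (shift b n) ∈ latticeBox m ε r := by
            rw [shift_comm b e, shift_comm a e] at h
            exact mem_latticeBox_of_shift hε h
          have e1 := ih.2 e b hbe.symm n p1 (by omega)
          have e2 := ih.2 a b hab n p2 (by omega)
          refine ⟨e1, hsmall e b hbe.symm n p1, ?_⟩
          have h1 := hc a b e hab hbe hea n h
          have h2 := hc' a b e hab hbe hea n h hxn hxs
          rw [diff, smul_eq_mul, inv_mul_eq_iff_eq_mul₀ hε.ne'] at h1 h2
          rw [e1, e2] at h2
          linear_combination h2 - h1
        have o1 := hquad i j k hijk hij hkj.symm hik.symm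
        have o2 := hquad i k j (by rwa [shift_comm k j]) hik hkj hij.symm
        have o3 := hquad j i k (by rwa [shift_comm j i]) hij.symm hik hkj
        have o4 := hquad j k i (by rwa [shift_comm k i, shift_comm j i]) hkj.symm hik.symm hij
        have o5 := hquad k j i (by rwa [shift_comm j i, shift_comm k i, shift_comm k j])
          hkj hij.symm hik
        have o6 := hquad k i j (by rwa [shift_comm k i, shift_comm k j]) hik.symm hij hkj.symm
        refine sub_eq_zero.1 (eq_zero_of_near_identity o5.2.1 o6.2.1 o4.2.1 o3.2.1 o2.2.1 o1.2.1
          o1.2.2 o2.2.2 o3.2.2 o4.2.2 o5.2.2 o6.2.2)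
      refine ⟨fun n hn hs => ?_, hcs⟩
      rcases Nat.lt_or_ge (degree n) (s + 1) with h | h
      · exact ih.1 n hn (by omega)
      have hpos : ∃ i, 0 < n i := by
        by_contra! h0
        have : degree n = 0 := Finset.sum_eq_zero fun i _ => Nat.le_zero.1 (h0 i)
        omega
      obtain ⟨i, hi⟩ := hpos
      by_cases h0 : ∀ j, j ≠ i → n j = 0
      · have hn0 : n = Pi.single i (n i) := by
          funext j
          by_cases hj : j = i
          · subst hj
            simp
          · simp [hj, h0 j hj]
        rw [hn0] at hn ⊢
        rw [hd.curves _ _ hn, hd'.curves _ _ hn]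
      push Not at h0
      obtain ⟨j, hji, h0⟩ := h0
      obtain ⟨p, rfl⟩ := exists_eq_shift hi
      rw [shift_apply_of_ne hji] at h0
      obtain ⟨q, rfl⟩ := exists_eq_shift (Nat.pos_of_ne_zero h0)
      rw [degree_shift, degree_shift] at hs
      have p1 : shift j q ∈ latticeBox m ε r := mem_latticeBox_of_shift hε hn
      have p2 : shift j (shift i q) ∈ latticeBox m ε r := by rwa [shift_comm j i]
      have p3 : shift i q ∈ latticeBox m ε r := mem_latticeBox_of_shift hε p2
      have e1 := ih.1 _ p1 (by rw [degree_shift]; omega)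
      have e2 := ih.1 _ p3 (by rw [degree_shift]; omega)
      have e3 := ih.1 _ (mem_latticeBox_of_shift hε p1) (by omega)
      have step : ∀ {y : (Fin m → ℕ) → EuclideanSpace ℝ (Fin N)}
          {b : Fin m → Fin m → (Fin m → ℕ) → ℝ}, IsDiscreteConjugateNet ε r y b →
          y (shift i (shift j q)) = y (shift j q) + ε • (diff ε i y q +
            ε • (b i j q • diff ε j y q + b j i q • diff ε i y q)) := by
        intro y b hy
        rw [shift_eq_add_smul_diff hε.ne' i y, shift_eq_add_smul_diff hε.ne' j (diff ε i y),
          hy j i hji _ p2]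
      have e4 : diff ε i x' q = diff ε i x q := by rw [diff, diff, e2, e3]
      have e5 : diff ε j x' q = diff ε j x q := by rw [diff, diff, e1, e3]
      rw [step hx, step hx', e1, e4, e5, hcs i j hji.symm q hn (by omega),
        hcs j i hji q p2 (by omega)]
  exact ⟨fun n hn => (main (degree n)).1 n hn le_rfl,
    fun i j hij n hn => (main (degree n + 2)).2 i j hij n hn le_rfl⟩

end DiscreteUniqueness

/-! ### Discrete nets from solutions of the discrete system -/

section DiscreteSolution

variable {m N : ℕ} {ε r ρ : ℝ}

/-- Estimates are made on simplices measured by the degree, the theorem on cubes; a cube of side `r`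
lies in the simplex of size `m * r`. -/
lemma degree_le_of_mem_latticeBox (hr : m * r ≤ ρ) {n : Fin m → ℕ}
    (hn : n ∈ latticeBox m ε r) : ε * (degree n : ℕ) ≤ ρ := by
  refine le_trans ?_ hr
  rw [degree, Nat.cast_sum, Finset.mul_sum]
  calc ∑ i, ε * (n i : ℝ) ≤ ∑ _i : Fin m, r := Finset.sum_le_sum fun i _ => hn i
    _ = m * r := by simp

/-- The numerator is at most `11 / 100` and the denominator at least `99 / 100`, which gives the
threshold `1 / 9` of the uniqueness argument. -/
lemma abs_coefRot_le {p q : ℝ} (hp : |p| ≤ 1 / 10) (hq : |q| ≤ 1 / 10) :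
    |coefRot p q| ≤ 1 / 9 := by
  have h1 := abs_mul_le_of_small hp hq
  have h2 : 99 / 100 ≤ |1 - p * q| := by
    have := (abs_le.1 h1).2
    exact le_trans (by linarith) (le_abs_self _)
  rw [coefRot, abs_div, div_le_iff₀ (by linarith)]
  have := abs_add_le p (p * q)
  linarith

variable {u : Unknown m N → (Fin m → ℕ) → ℝ}

lemma diff_positionOf (hε : 0 < ε)
    (hstep : ∀ k i n, evolves k i → ε * (degree n + 1 : ℕ) ≤ ρ →
      u k (shift i n) = latticeStep ε k i fun l => u l n)
    {i : Fin m} {n : Fin m → ℕ} (hn : ε * (degree n + 1 : ℕ) ≤ ρ) :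
    diff ε i (positionOf u) n = tangentOf u i n := by
  ext a
  have := hstep (.pos a) i n trivial hn
  simp [diff, positionOf, tangentOf, this, latticeStep, hε.ne']

lemma isDiscreteConjugateNet_positionOf (hε : 0 < ε)
    (hstep : ∀ k i n, evolves k i → ε * (degree n + 1 : ℕ) ≤ ρ →
      u k (shift i n) = latticeStep ε k i fun l => u l n)
    (hr : m * r ≤ ρ) :
    IsDiscreteConjugateNet ε r (positionOf u) fun i j n => latticeRot ε (fun l => u l n) i j := by
  intro i j hij n hn
  have h2 := degree_le_of_mem_latticeBox hr hn
  rw [degree_shift, degree_shift] at h2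
  have h1 : ε * (degree n + 1 : ℕ) ≤ ρ := domain_of_le hε h2 (by omega)
  rw [diff, diff_positionOf hε hstep (i := j) h1, diff_positionOf hε hstep (i := i) h1,
    diff_positionOf hε hstep (by rw [degree_shift]; exact h2)]
  ext a
  have := hstep (.tan j a) i n hij h1
  simp [tangentOf, this, latticeStep, hε.ne']

lemma isDiscreteCompatible_latticeRot (hε : 0 < ε)
    (hstep : ∀ k i n, evolves k i → ε * (degree n + 1 : ℕ) ≤ ρ →
      u k (shift i n) = latticeStep ε k i fun l => u l n)
    (hr : m * r ≤ ρ)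
    (hsmall : ∀ k n, ε * (degree n : ℕ) ≤ ρ → |ε * u k n| ≤ 1 / 10) :
    IsDiscreteCompatible ε r fun i j n => latticeRot ε (fun l => u l n) i j := by
  intro i j k hij hjk hki n hn
  have h3 := degree_le_of_mem_latticeBox hr hn
  rw [degree_shift, degree_shift, degree_shift] at h3
  have h1 : ε * (degree n + 1 : ℕ) ≤ ρ := domain_of_le hε h3 (by omega)
  have h := latticeRot_compatible hε.ne' ⟨hij, hjk, hki⟩ (v := fun l => u l n)
    (vi := fun l => u l (shift i n)) (vj := fun l => u l (shift j n))
    (fun l => hsmall l n (domain_of_le hε h1 (by omega)))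
    (fun l hl => hstep l i n hl h1) (fun l hl => hstep l j n hl h1)
  rw [diff, smul_eq_mul, h, inv_mul_cancel_left₀ hε.ne']

end DiscreteSolution


/-! ### Data, nondegeneracy and convergence of the discrete nets -/

section Assembly

variable {m N : ℕ} {ρ₀ ρ r ε₁ : ℝ} {v : Unknown m N → (Fin m → ℝ) → ℝ}
  {X : Fin m → ℝ → EuclideanSpace ℝ (Fin N)} {C : Fin m → Fin m → ℝ × ℝ → ℝ} {i₀ : Fin m}

lemma latticePoint_single (ε : ℝ) (i : Fin m) (t : ℕ) :
    latticePoint ε (Pi.single i t) = Pi.single i (ε * (t : ℝ)) := by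
  funext j
  rcases eq_or_ne j i with rfl | h
  · simp [latticePoint]
  · simp [latticePoint, h]

lemma degree_single (i : Fin m) (t : ℕ) : degree (Pi.single i t) = t := by
  simp [degree]

/-- The tangent data are slopes of the smooth net along the axis, so summing them reproduces the
curve exactly at lattice points. On coordinate planes the rotation unknowns have not evolved, and
`latticeRot_of_data` returns the given coefficients. -/
lemma hasDiscreteData_of_solution {ε : ℝ} (hε : 0 < ε) (hρρ : ρ < ρ₀) (hr : m * r ≤ ρ)
    (hX : ∀ i, ContDiff ℝ ∞ (X i)) (hX0 : ∀ i j, X i 0 = X j 0) (hv : ∀ k, ContDiff ℝ ∞ (v k))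
    (heq : ∀ k i, evolves k i → ∀ ξ, ‖ξ‖ < ρ₀ →
      fderiv ℝ (v k) ξ (Pi.single i 1) = rhs k i (fun l => v l ξ))
    (hdata : ∀ k ξ, ‖ξ‖ < ρ₀ → (∀ i, evolves k i → ξ i = 0) → v k ξ = goursatData X C i₀ k ξ)
    (hsmall : ∀ k ξ, |ε * v k ξ| ≤ 1 / 10) {u : Unknown m N → (Fin m → ℕ) → ℝ}
    (hudata : ∀ k n, (∀ i, evolves k i → n i = 0) → u k n = latticeData v ε k n)
    (hstep : ∀ k i n, evolves k i → ε * (degree n + 1 : ℕ) ≤ ρ →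
      u k (shift i n) = latticeStep ε k i fun l => u l n) :
    HasDiscreteData ε r X C (positionOf u) fun i j n => latticeRot ε (fun l => u l n) i j := by
  refine ⟨fun i t ht => ?_, fun i j hij n hn h => ?_⟩
  · have h1 := degree_le_of_mem_latticeBox hr ht
    rw [degree_single] at h1
    have h2 : ∀ a, ∀ t : ℕ, ε * (t : ℕ) ≤ ρ →
        u (.pos a) (Pi.single i t) = v (.pos a) (latticePoint ε (Pi.single i t)) := by
      intro a t
      induction t with
      | zero => exact fun _ => hudata (.pos a) _ fun j _ => by simp
      | succ t ih =>
        intro ht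
        have h3 : (Pi.single i (t + 1) : Fin m → ℕ) = shift i (Pi.single i t) := by
          rw [shift, ← Pi.single_add]
        have h4 := hudata (.tan i a) (Pi.single i t) fun j (hj : j ≠ i) => by simp [hj]
        rw [h3, hstep (.pos a) i _ trivial (by rwa [degree_single])]
        simp only [latticeStep]
        rw [ih (domain_of_le hε ht (by omega)), h4, latticePoint_shift]
        simp only [latticeData, slopeAlong]
        rw [mul_inv_cancel_left₀ hε.ne']
        ring
    rw [← positionOf_axis hX hX0 hv heq hdata i (t := ε * t) (by positivity)
      (h1.trans_lt hρρ), ← latticePoint_single]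
    ext a
    exact h2 a t h1
  · have h1 : ε * (degree n : ℕ) ≤ ρ := degree_le_of_mem_latticeBox hr
      (mem_latticeBox_of_shift hε (mem_latticeBox_of_shift hε hn))
    have h2 := ((norm_latticePoint_le hε n).trans h1).trans_lt hρρ
    have h3 : ∀ k l, k ≠ l → (∀ a, a ≠ k → a ≠ l → n a = 0) →
        u (.rot k l) n = v (.rot k l) (latticePoint ε n) /
          (1 + ε * v (.rot l k) (latticePoint ε n)) := fun k l _ h =>
      hudata (.rot k l) n fun a ha => h a (Ne.symm ha.2.2) ha.1
    have h4 : v (.rot i j) (latticePoint ε n) = C i j (ε * n i, ε * n j) := by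
      rw [hdata (.rot i j) _ h2 fun a ha => by
        simp [latticePoint, h a (Ne.symm ha.2.2) ha.1]]
      exact if_neg hij
    rw [← h4]
    simp only [latticeRot]
    rw [h3 i j hij h, h3 j i hij.symm fun a h5 h6 => h a h6 h5]
    exact latticeRot_of_data hε.ne' (hsmall _ _) (hsmall _ _)

/-- The tangent vectors of a solution and of its discrete approximations remain linearly
independent near the origin. -/
lemma exists_independent_tangents {u : ℝ → Unknown m N → (Fin m → ℕ) → ℝ}
    (hv : ∀ k, ContDiff ℝ ∞ (v k))
    (h0 : ∀ i j k, i ≠ j → j ≠ k → k ≠ i →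
      LinearIndependent ℝ ![tangentOf v i 0, tangentOf v j 0, tangentOf v k 0])
    (hy : ∀ k, BoundedBy ε₁ ρ (fun _ _ => 1) 0
      fun ε n => ε⁻¹ * (u ε k n - v k (latticePoint ε n))) :
    ∃ η ε₂ : ℝ, 0 < η ∧ 0 < ε₂ ∧
      (∀ ξ, ‖ξ‖ ≤ η → ∀ i j k, i ≠ j → j ≠ k → k ≠ i →
        LinearIndependent ℝ ![tangentOf v i ξ, tangentOf v j ξ, tangentOf v k ξ]) ∧
      ∀ ε n, 0 < ε → ε < ε₁ → ε < ε₂ → ε * (degree n : ℕ) ≤ ρ → ε * (degree n : ℕ) ≤ η →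
        ∀ i j k, i ≠ j → j ≠ k → k ≠ i →
        LinearIndependent ℝ ![tangentOf (u ε) i n, tangentOf (u ε) j n, tangentOf (u ε) k n] := by
  have hT : Continuous fun (z : Unknown m N → ℝ) (j : Fin m) =>
      (WithLp.toLp 2 fun a => z (.tan j a) : EuclideanSpace ℝ (Fin N)) := by
    refine continuous_pi fun j => (PiLp.continuous_toLp 2 _).comp ?_
    fun_prop
  have hopen := (isOpen_independent_triples (m := m) (N := N)).preimage hT
  obtain ⟨δ, hδ, hball⟩ := Metric.isOpen_iff.1 hopen (fun k => v k 0) h0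
  have hmem : ∀ z : Unknown m N → ℝ, (∀ k, |z k - v k 0| < δ) → ∀ i j k, i ≠ j → j ≠ k → k ≠ i →
      LinearIndependent ℝ ![(WithLp.toLp 2 fun a => z (.tan i a) : EuclideanSpace ℝ (Fin N)),
        WithLp.toLp 2 fun a => z (.tan j a), WithLp.toLp 2 fun a => z (.tan k a)] := by
    intro z hz
    have h1 : z ∈ Metric.ball (fun k => v k 0) δ := Metric.mem_ball.2 ((dist_pi_lt_iff hδ).2 hz)
    have h2 := hball h1
    rwa [Set.mem_preimage, Set.mem_ofPred_eq] at h2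
  have hcont : Continuous fun ξ k => v k ξ := continuous_pi fun k => (hv k).continuous
  obtain ⟨η, hη, hηv⟩ := Metric.continuous_iff.1 hcont 0 (δ / 2) (by positivity)
  obtain ⟨K, hK, HK⟩ := BoundedBy.uniform (fun _ _ => zero_le_one) hy
  have hnear : ∀ ξ, ‖ξ‖ ≤ η / 2 → ∀ k, |v k ξ - v k 0| < δ / 2 := fun ξ hξ k =>
    lt_of_le_of_lt (dist_le_pi_dist (fun k => v k ξ) (fun k => v k 0) k)
      (hηv ξ (by rw [dist_zero_right]; linarith))
  -- Half of the tolerance `δ` is spent on moving away from the origin, the other half on the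
  -- discretisation error `ε * K`.
  refine ⟨η / 2, δ / (2 * (K + 1)), by positivity, by positivity, fun ξ hξ => ?_,
    fun ε n h1 h2 h3 h4 h5 => ?_⟩
  · refine hmem (fun k => v k ξ) fun k => ?_
    exact (hnear ξ hξ k).trans (by linarith)
  · refine hmem (fun k => u ε k n) fun k => ?_
    have h6 := hnear _ ((norm_latticePoint_le h1 n).trans h5) k
    have h7 := HK k ε n h1 h2 h4
    rw [abs_mul, abs_inv, abs_of_pos h1, mul_one, inv_mul_le_iff₀ h1] at h7
    have h8 : ε * K ≤ δ / 2 := by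
      rw [lt_div_iff₀ (by positivity)] at h3
      nlinarith
    have := abs_sub_le (u ε k n) (v k (latticePoint ε n)) (v k 0)
    linarith

lemma listDiff_const_mul (ε c : ℝ) (L : List (Fin m)) (u : (Fin m → ℕ) → ℝ) :
    listDiff ε L (fun n => c * u n) = fun n => c * listDiff ε L u n := by
  induction L generalizing u with
  | nil => rfl
  | cons i L ih =>
    rw [listDiff, listDiff, ← ih]
    congr 1
    funext n
    simp only [diff, smul_eq_mul]
    ring

/-- The list in which every direction `i` occurs `α i` times. -/
def directions (α : Fin m → ℕ) : List (Fin m) :=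
  (List.finRange m).flatMap fun i => List.replicate (α i) i

lemma length_directions (α : Fin m → ℕ) : (directions α).length = ∑ i, α i := by
  simp [directions, List.length_flatMap, Fin.sum_univ_def]

lemma multiDiff_apply (ε : ℝ) (α : Fin m → ℕ) (w : (Fin m → ℕ) → EuclideanSpace ℝ (Fin N))
    (n : Fin m → ℕ) (a : Fin N) :
    multiDiff ε α w n a = listDiff ε (directions α) (fun n => w n a) n := by
  have hiter : ∀ (i : Fin m) (k : ℕ) (L : List (Fin m))
      (w₁ w₂ : (Fin m → ℕ) → EuclideanSpace ℝ (Fin N)),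
      (∀ n, w₁ n a = listDiff ε L (fun n => w₂ n a) n) → ∀ n,
      ((diff ε i)^[k] w₁) n a = listDiff ε (List.replicate k i ++ L) (fun n => w₂ n a) n := by
    intro i k L w₁ w₂ h
    induction k with
    | zero => exact h
    | succ k ih =>
      intro n
      rw [Function.iterate_succ_apply', List.replicate_succ, List.cons_append, listDiff,
        listDiff_diff]
      simp [diff, ih]
  have hlist : ∀ (l : List (Fin m)) n, (l.foldr (fun i v => (diff ε i)^[α i] v) w) n a =
      listDiff ε (l.flatMap fun i => List.replicate (α i) i) (fun n => w n a) n := by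
    intro l
    induction l with
    | nil => exact fun _ => rfl
    | cons i l ih => exact hiter i (α i) _ _ w ih
  exact hlist _ n

lemma norm_le_sum_abs (x : EuclideanSpace ℝ (Fin N)) : ‖x‖ ≤ ∑ a, |x a| := by
  rw [EuclideanSpace.norm_eq]
  refine Real.sqrt_le_iff.2 ⟨by positivity, ?_⟩
  exact Finset.sum_sq_le_sq_sum_of_nonneg fun a _ => abs_nonneg (x a)

/-- The error is `ε` times the scaled error, whose difference quotients of each order are bounded
uniformly in `ε`, component by component. -/
lemma convergesSmoothly_of_tame (hm : 1 ≤ m) (hr : m * r ≤ ρ)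
    {u : ℝ → Unknown m N → (Fin m → ℕ) → ℝ}
    (hy : ∀ ℓ k, Tame ε₁ ρ (fun _ _ => 1) ℓ 0
      fun ε n => ε⁻¹ * (u ε k n - v k (latticePoint ε n))) {ε₂ : ℝ} (hε₂ : ε₂ ≤ ε₁) :
    ConvergesSmoothly r ε₂ (fun ε => positionOf (u ε)) (positionOf v) := by
  have h : ∀ (α : Fin m → ℕ) (a : Fin N), ∃ K : ℝ, ∀ ε n, 0 < ε → ε < ε₁ →
      ε * (degree n + ∑ i, α i : ℕ) ≤ ρ → |listDiff ε (directions α)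
        (fun n => ε⁻¹ * (u ε (.pos a) n - v (.pos a) (latticePoint ε n))) n| ≤ K := by
    intro α a
    obtain ⟨K, -, H⟩ := (tame_iff.1 (hy _ (.pos a))).2 (directions α) rfl
    refine ⟨K, fun ε n h1 h2 h3 => ?_⟩
    have := H ε n h1 h2
    rw [zero_add, length_directions, mul_one] at this
    exact this h3
  choose K hK using h
  refine ⟨fun ℓ => ∑ α ∈ Finset.Iic fun _ => ℓ, |∑ a, K α a|, fun ℓ ε h1 h2 _ α hα n hn => ?_⟩
  have h3 : α ∈ Finset.Iic fun _ => ℓ := Finset.mem_Iic.2 fun i =>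
    (Finset.single_le_sum (f := α) (fun _ _ => Nat.zero_le _) (Finset.mem_univ i)).trans hα
  -- The shrunken cube has side `r - ε|α|`, hence degree bound `m * (r - ε|α|)`; since `m ≥ 1` this
  -- leaves room for `|α|` further steps.
  have h4 : ε * (degree n + ∑ i, α i : ℕ) ≤ ρ := by
    have h5 := degree_le_of_mem_latticeBox le_rfl hn
    have h6 : (1 : ℝ) ≤ m := by exact_mod_cast hm
    have h7 : 0 ≤ ε * ((∑ i, α i : ℕ) : ℝ) := by positivity
    rw [Nat.cast_add, mul_add]
    nlinarith
  have h5 : ∀ a, |multiDiff ε α (fun n => positionOf (u ε) n -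
      positionOf v (latticePoint ε n)) n a| ≤ ε * K α a := by
    intro a
    have h6 : (fun n => (positionOf (u ε) n - positionOf v (latticePoint ε n)) a) =
        fun n => ε * (ε⁻¹ * (u ε (.pos a) n - v (.pos a) (latticePoint ε n))) := by
      funext n
      rw [mul_inv_cancel_left₀ h1.ne']
      rfl
    rw [multiDiff_apply, h6, listDiff_const_mul, abs_mul, abs_of_pos h1]
    exact mul_le_mul_of_nonneg_left (hK α a ε n h1 (h2.trans_le hε₂) h4) h1.le
  calc _ ≤ ∑ a, |multiDiff ε α (fun n => positionOf (u ε) n -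
      positionOf v (latticePoint ε n)) n a| := norm_le_sum_abs _
    _ ≤ ∑ a, ε * K α a := Finset.sum_le_sum fun a _ => h5 a
    _ = (∑ a, K α a) * ε := by rw [← Finset.mul_sum, mul_comm]
    _ ≤ (∑ α ∈ Finset.Iic fun _ => ℓ, |∑ a, K α a|) * ε := by
      refine mul_le_mul_of_nonneg_right ((le_abs_self _).trans ?_) h1.le
      exact Finset.single_le_sum (f := fun α => |∑ a, K α a|) (fun _ _ => abs_nonneg _) h3

end Assembly

end ConjugateNet

end

/-! ### The approximation theorem -/

theorem mainTheorem4 (m N : ℕ) (hm : 1 ≤ m)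
    (X : Fin m → ℝ → EuclideanSpace ℝ (Fin N)) (C : Fin m → Fin m → ℝ × ℝ → ℝ)
    (hX : ∀ i, ContDiff ℝ ∞ (X i)) (hX0 : ∀ i j, X i 0 = X j 0)
    (hC : ∀ i j, i ≠ j → ContDiff ℝ ∞ (C i j)) :
    ∃ r₀ : ℝ, 0 < r₀ ∧ ∀ r : ℝ, 0 < r → r ≤ r₀ →
      ∃ (x : (Fin m → ℝ) → EuclideanSpace ℝ (Fin N)) (c : Fin m → Fin m → (Fin m → ℝ) → ℝ),
        -- existence of the conjugate net
        (ConjugateNet.IsConjugateNet r x c ∧ ConjugateNet.IsCompatible r c ∧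
          ConjugateNet.HasData r X C x c) ∧
        -- its uniqueness; for regular data the compatibility equations need not be required
        (∀ x' c', ConjugateNet.IsConjugateNet r x' c' →
          (ConjugateNet.IsCompatible r c' ∨ ConjugateNet.IsRegularData X) →
          ConjugateNet.HasData r X C x' c' → ConjugateNet.SameNet r x' x c' c) ∧
        -- the family of discrete conjugate nets
        ∃ ε₁ : ℝ, 0 < ε₁ ∧
          ∃ (xd : ℝ → (Fin m → ℕ) → EuclideanSpace ℝ (Fin N))
            (cd : ℝ → Fin m → Fin m → (Fin m → ℕ) → ℝ),
            (∀ ε : ℝ, 0 < ε → ε < ε₁ →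
              (ConjugateNet.IsDiscreteConjugateNet ε r (xd ε) (cd ε) ∧
                ConjugateNet.IsDiscreteCompatible ε r (cd ε) ∧
                ConjugateNet.HasDiscreteData ε r X C (xd ε) (cd ε)) ∧
              (∀ x' c', ConjugateNet.IsDiscreteConjugateNet ε r x' c' →
                (ConjugateNet.IsDiscreteCompatible ε r c' ∨ ConjugateNet.IsRegularData X) →
                ConjugateNet.HasDiscreteData ε r X C x' c' →
                ConjugateNet.SameDiscreteNet ε r x' (xd ε) c' (cd ε))) ∧
            -- the convergence of the discrete nets
            ConjugateNet.ConvergesSmoothly r ε₁ xd x := by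
  have i₀ : Fin m := ⟨0, hm⟩
  have hm1 : (1 : ℝ) ≤ m := by exact_mod_cast hm
  obtain ⟨ρ₀, hρ₀, v, hv, hcs, heq, hdata⟩ := ConjugateNet.exists_goursat_solution
    (ConjugateNet.evolves (m := m) (N := N)) ConjugateNet.rhs ConjugateNet.contDiff_rhs
    ConjugateNet.rhs_eq_zero ConjugateNet.rhs_consistent (ConjugateNet.goursatData X C i₀)
    (ConjugateNet.contDiff_goursatData X C hX hC i₀)
  replace hdata : ∀ k ξ, ‖ξ‖ < ρ₀ → (∀ i, ConjugateNet.evolves k i → ξ i = 0) →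
      v k ξ = ConjugateNet.goursatData X C i₀ k ξ := fun k ξ => hdata k ξ
  obtain ⟨ρ, ε₁, M, hρ, hρρ, hε₁, hM, hε₁M, hvM, u, huM, hudata, hustep, hy⟩ :=
    ConjugateNet.exists_discrete_approximation hρ₀ hv hcs heq
  -- Regularity is not assumed throughout, but the bounds on `r` and `ε` must be chosen before it is
  -- invoked. For irregular data the values `1` are placeholders.
  have hind : ∃ η ε₂ : ℝ, 0 < η ∧ 0 < ε₂ ∧ (ConjugateNet.IsRegularData X →
      (∀ ξ, ‖ξ‖ ≤ η → ∀ i j k, i ≠ j → j ≠ k → k ≠ i → LinearIndependent ℝ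
        ![ConjugateNet.tangentOf v i ξ, ConjugateNet.tangentOf v j ξ,
          ConjugateNet.tangentOf v k ξ]) ∧
      ∀ ε n, 0 < ε → ε < ε₁ → ε < ε₂ → ε * (ConjugateNet.degree n : ℕ) ≤ ρ →
        ε * (ConjugateNet.degree n : ℕ) ≤ η → ∀ i j k, i ≠ j → j ≠ k → k ≠ i →
        LinearIndependent ℝ ![ConjugateNet.tangentOf (u ε) i n, ConjugateNet.tangentOf (u ε) j n,
          ConjugateNet.tangentOf (u ε) k n]) := by
    by_cases hreg : ConjugateNet.IsRegularData X
    · have h0 : ∀ i, ConjugateNet.tangentOf v i 0 = deriv (X i) 0 := fun i => by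
        ext a
        exact hdata (.tan i a) 0 (by rwa [norm_zero]) fun _ _ => rfl
      obtain ⟨η, ε₂, h1, h2, h3, h4⟩ := ConjugateNet.exists_independent_tangents (u := u) hv
        (fun i j k hij hjk hki => by
          rw [h0, h0, h0]
          exact hreg i j k hij hjk hki) fun k => (hy 0 k).bounded
      exact ⟨η, ε₂, h1, h2, fun _ => ⟨h3, h4⟩⟩
    · exact ⟨1, 1, one_pos, one_pos, fun h => absurd h hreg⟩
  obtain ⟨η, ε₂, hη, hε₂, hind⟩ := hind
  have hm0 : (0 : ℝ) < m := by linarith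
  refine ⟨min ρ η / m, by positivity, fun r hr hrr => ?_⟩
  rw [le_div_iff₀' hm0] at hrr
  have hrρ' : m * r ≤ ρ := hrr.trans (min_le_left _ _)
  have hrη' : m * r ≤ η := hrr.trans (min_le_right _ _)
  have hrm : r ≤ m * r := le_mul_of_one_le_left hr.le hm1
  have hrρ : r < ρ₀ := by linarith
  have hx := ConjugateNet.isConjugateNet_positionOf hv heq hr hrρ
  have hc := ConjugateNet.isCompatible_of_solution hv heq hr hrρ
  have hd := ConjugateNet.hasData_of_solution hX hX0 hv heq hdata hr hrρ
  refine ⟨ConjugateNet.positionOf v, fun i j => v (.rot i j), ⟨hx, hc, hd⟩, ?_,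
    min ε₁ ε₂, lt_min hε₁ hε₂, fun ε => ConjugateNet.positionOf (u ε),
    fun ε i j n => ConjugateNet.latticeRot ε (fun l => u ε l n) i j, ?_,
    ConjugateNet.convergesSmoothly_of_tame hm hrρ' hy (min_le_left _ _)⟩
  · rintro x' c' hx' (hc' | hreg) hd'
    · exact ConjugateNet.sameNet_of_compatible hm hr hX hx hc hd hx' hc' hd'
    · refine ConjugateNet.sameNet_of_linearIndependent hm hr hX hC hx hc hd
        (fun ξ hξ i j k hij hjk hki => ?_) hx' hd'
      rw [ConjugateNet.partialDeriv_positionOf hv heq hr hrρ i hξ,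
        ConjugateNet.partialDeriv_positionOf hv heq hr hrρ j hξ,
        ConjugateNet.partialDeriv_positionOf hv heq hr hrρ k hξ]
      refine (hind hreg).1 ξ ((pi_norm_le_iff_of_nonneg hη.le).2 fun i => ?_) i j k hij hjk hki
      rw [Real.norm_of_nonneg (ConjugateNet.mem_box.1 hξ i).1]
      exact (ConjugateNet.mem_box.1 hξ i).2.trans (hrm.trans hrη')
  · intro ε hε hεε
    have h1 : ε < ε₁ := hεε.trans_le (min_le_left _ _)
    have h2 : ε < ε₂ := hεε.trans_le (min_le_right _ _)
    have hεM : ∀ {a : ℝ}, |a| ≤ M → |ε * a| ≤ 1 / 10 := fun ha =>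
      (ConjugateNet.abs_mul_le_of_small (by rw [abs_of_pos hε]; exact h1.le) ha).trans hε₁M
    have hstep : ∀ k i n, ConjugateNet.evolves k i → ε * (ConjugateNet.degree n + 1 : ℕ) ≤ ρ →
        u ε k (ConjugateNet.shift i n) = ConjugateNet.latticeStep ε k i fun l => u ε l n :=
      fun k i n hk h => hustep ε k i n hk hε h1 h
    have hsmall : ∀ k n, ε * (ConjugateNet.degree n : ℕ) ≤ ρ → |ε * u ε k n| ≤ 1 / 10 :=
      fun k n h => hεM (huM ε k n hε h1 h)
    have hxd := ConjugateNet.isDiscreteConjugateNet_positionOf hε hstep hrρ'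
    have hcd := ConjugateNet.isDiscreteCompatible_latticeRot hε hstep hrρ' hsmall
    have hdd := ConjugateNet.hasDiscreteData_of_solution hε hρρ hrρ' hX hX0 hv heq hdata
      (fun k ξ => hεM (hvM k ξ)) (fun k n hn => hudata ε k n hε h1 hn) hstep
    refine ⟨⟨hxd, hcd, hdd⟩, fun x' c' hx' hor hd' => ?_⟩
    refine ConjugateNet.sameDiscreteNet_of_compatible hm hε hxd hcd hdd
      (fun i j _ n hn => ?_) hx' hd' fun i j k hij hjk hki n hn hxn hxs => ?_
    · have h3 := ConjugateNet.degree_le_of_mem_latticeBox hrρ'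
        (ConjugateNet.mem_latticeBox_of_shift hε (ConjugateNet.mem_latticeBox_of_shift hε hn))
      rw [ConjugateNet.mul_latticeRot hε.ne']
      exact ConjugateNet.abs_coefRot_le (hsmall _ n h3) (hsmall _ n h3)
    -- For regular data compatibility of `c'` is derived only at hexahedra where `x'` already agrees
    -- with the constructed net at `n` and its neighbours: there the edges of `x'` are the
    -- independent tangents of that net.
    · rcases hor with hc' | hreg
      · exact hc' i j k hij hjk hki n hn
      · have p1 := ConjugateNet.mem_latticeBox_of_shift hε hn
        have p2 := ConjugateNet.mem_latticeBox_of_shift hε p1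
        have p3 : ConjugateNet.shift j n ∈ ConjugateNet.latticeBox m ε r :=
          ConjugateNet.mem_latticeBox_of_shift hε (i := k) (by rwa [ConjugateNet.shift_comm])
        have p4 : ConjugateNet.shift i n ∈ ConjugateNet.latticeBox m ε r :=
          ConjugateNet.mem_latticeBox_of_shift hε (i := k)
            (ConjugateNet.mem_latticeBox_of_shift hε (i := j)
              (by rwa [ConjugateNet.shift_comm k i, ConjugateNet.shift_comm j i]))
        have h3 := ConjugateNet.degree_le_of_mem_latticeBox hrρ' p2
        have h4 := ConjugateNet.degree_le_of_mem_latticeBox hrη'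
          (ConjugateNet.mem_latticeBox_of_shift hε p2)
        rw [ConjugateNet.degree_shift] at h3
        have hdiff : ∀ l, ConjugateNet.shift l n ∈ ConjugateNet.latticeBox m ε r →
            ConjugateNet.diff ε l x' n = ConjugateNet.tangentOf (u ε) l n := fun l hl => by
          rw [← ConjugateNet.diff_positionOf hε hstep h3, ConjugateNet.diff,
            ConjugateNet.diff, hxn, hxs l hl]
        refine ConjugateNet.discrete_compat_of_linearIndependent hε hx' hij hjk hki hn ?_
        rw [hdiff i p4, hdiff j p3, hdiff k p2]
        exact (hind hreg).2 ε n hε h1 h2 (ConjugateNet.domain_of_le hε h3 (by omega)) h4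
          i j k hij hjk hki
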